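/- **Definitions.** Every finitely generated group carries the word metric of a finite generating set. *Obstructor complexes.* Let $m\ge 0$ be an integer. A finite simplicial complex $K$ of dimension $\le m$ is an *$m$-obstructor complex* if there is a collection $\Sigma$ of unordered pairs $\{\sigma,\tau\}$ of disjoint simplices of $K$ with $\dim\sigma+\dim\tau=m$ such that (1) $\Sigma$ is an $m$-cycle over $\mathbb Z/2$ in $\bigcup\{\sigma\times\tau\subset K\times K : \sigma\cap\tau=\emptyset\}/(\mathbb Z/2)$, where $\mathbb Z/2$ acts by $(x,y)\mapsto(y,x)$; (2) for some (equivalently, any) general position map $f:K\to\mathbb R^m$ the number $\sum_{\{\sigma,\tau\}\in\Sigma}|f(\sigma)\cap f(\tau)|$ is odd; (3) for every $m$-simplex $\sigma$ of $K$ the number of vertices $v$ with $\{\sigma,v\}\in\Sigma$ is even. *Obstructor dimension.* For a finite complex $K$ let $\mathrm{cone}(K)=K\times[0,\infty)/K\times\{0\}$. Triangulate $\mathrm{cone}(K)$ (locally finitely) so that $\mathrm{cone}(\sigma)$ is a subcomplex for each simplex $\sigma$ of $K$. A map $f$ from the vertex set $\mathrm{cone}(K)^{(0)}$ to a group $\Gamma$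 is *proper* if preimages of finite sets are finite, *Lipschitz* if the distance between the images of adjacent vertices is uniformly bounded, and *expanding* if for all disjoint simplices $\sigma,\tau$ of $K$ and every $D>0$ there are finite sets $C_1\subset\mathrm{cone}(\sigma)^{(0)}$, $C_2\subset\mathrm{cone}(\tau)^{(0)}$ with $d(f(a),f(b))>D$ for all $a\in\mathrm{cone}(\sigma)^{(0)}\setminus C_1$, $b\in\mathrm{cone}(\tau)^{(0)}\setminus C_2$. For a finitely generated group $\Gamma$, $\operatorname{obdim}\Gamma\in\{0,1,2,\dots,\infty\}$ is $0$ if $\Gamma$ is finite, $1$ if $\Gamma$ is two-ended, and otherwise the supremum of $m+2$ over all $m\ge0$ for which there are an $m$-obstructor complex $K$, a triangulation of $\mathrm{cone}(K)$ as above, and a proper, Lipschitz, expanding map $\mathrm{cone}(K)^{(0)}\to\Gamma$. *Weak convexity.* A finitely generated group $\Gamma$ is *weakly convex* if there are (not necessarily continuous) paths $\phi_{z,w}:[0,1]\to\Gamma$, $z,w\in\Gamma$, and a constant $M>0$ such that (1) $\phi_{z,w}(0)=z$ and $\phi_{z,w}(1)=w$; (2) there is a function $\gamma:[0,\infty)\to[0,\infty)$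 such that $d(z,w)\le R$ implies $\operatorname{diam}(\operatorname{Im}\phi_{z,w})\le\gamma(R)$; (3) for all $z,w$ there is $\epsilon>0$ such that $\phi_{z,w}$ sends subintervals of length $<\epsilon$ to sets of diameter $<M$; (4) if $d(z,z')\le1$ and $d(w,w')\le1$ then $d(\phi_{z,w}(t),\phi_{z',w'}(t))\le M$ for all $t\in[0,1]$. **Theorem.** Let $1\to H\to G\xrightarrow{\pi}Q\to1$ be a short exact sequence of finitely generated groups. Suppose that $H$ is weakly convex and that $\pi$ admits a Lipschitz section $s:Q\to G$ (a map with $\pi\circ s=\mathrm{id}_Q$, not necessarily a homomorphism, which is Lipschitz for the word metrics). Then $$\operatorname{obdim}G\ \ge\ \operatorname{obdim}H+\operatorname{obdim}Q .$$ In particular, if $H$ and $Q$ are finitely generated and $H$ is weakly convex, then every semidirect product $G=H\rtimes Q$ is finitely generated and satisfies $\operatorname{obdim}G\ge\operatorname{obdim}H+\operatorname{obdim}Q$. -/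

import Mathlib

universe u v w

namespace ObstructorDim

/-! ### Obstructor complexes

Simplices of a finite complex `K` on the vertex set `V` are finite nonempty sets of vertices, so the
dimension of `σ` is `σ.card - 1`, and two simplices are disjoint iff their vertex sets are. -/

section Obstructor

variable {V : Type*}

/-- The simplexwise affine map `K → ℝᵐ` with vertex map `f` is in general position: any at most
`m + 1` vertices of `K` have affinely independent images. -/
def GeneralPosition (m : ℕ) (f : V → Fin m → ℝ) : Prop :=
  ∀ s : Finset V, s.card ≤ m + 1 → AffineIndependent ℝ (fun v : s => f v)

/-- The number `|f(σ) ∩ f(τ)|` for an unordered pair `{σ, τ}` of simplices, where `f` is the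
simplexwise affine map given by its values on the vertices. For general position maps and disjoint
simplices with `dim σ + dim τ = m` the intersection is finite. -/
noncomputable def intersectionCount {m : ℕ} (f : V → Fin m → ℝ) : Sym2 (Finset V) → ℕ :=
  Sym2.lift ⟨fun σ τ =>
    (convexHull ℝ (f '' (σ : Set V)) ∩ convexHull ℝ (f '' (τ : Set V))).ncard,
    fun σ τ => congrArg Set.ncard (Set.inter_comm _ _)⟩

/-- `P` is a set of unordered pairs of disjoint simplices of `K` with `dim σ + dim τ = m`. -/
def IsPairSet (K : AbstractSimplicialComplex V) (m : ℕ)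
    (P : Finset (Sym2 (Finset V))) : Prop :=
  ∀ σ τ : Finset V, s(σ, τ) ∈ P →
    σ ∈ K.faces ∧ τ ∈ K.faces ∧ Disjoint σ τ ∧ σ.card + τ.card = m + 2

/-- The `m`-cells in `P` form a mod 2 cycle in `⋃ {σ × τ | σ ∩ τ = ∅} / ℤ₂`: every `(m-1)`-cell
`{ρ, τ}` is a codimension one face of an even number of elements of `P`. Those elements are the
pairs `{ρ ∪ {v}, τ}` and `{ρ, τ ∪ {v}}` which lie in `P`, and all these pairs are distinct. -/
def IsCycle [DecidableEq V] (K : AbstractSimplicialComplex V) (m : ℕ)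
    (P : Finset (Sym2 (Finset V))) : Prop :=
  ∀ ρ ∈ K.faces, ∀ τ ∈ K.faces, Disjoint ρ τ → ρ.card + τ.card = m + 1 →
    Even ({v : V | s(insert v ρ, τ) ∈ P}.ncard + {v : V | s(ρ, insert v τ) ∈ P}.ncard)

/-- The finite simplicial complex `K` is an `m`-obstructor complex. -/
def IsObstructor [Fintype V] [DecidableEq V] (K : AbstractSimplicialComplex V) (m : ℕ) : Prop :=
  (∀ σ ∈ K.faces, σ.card ≤ m + 1) ∧
  ∃ P : Finset (Sym2 (Finset V)),
    IsPairSet K m P ∧ IsCycle K m P ∧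
    (∃ f : V → Fin m → ℝ, GeneralPosition m f ∧ Odd (∑ p ∈ P, intersectionCount f p)) ∧
    (∀ σ ∈ K.faces, σ.card = m + 1 → Even {v : V | s(σ, {v}) ∈ P}.ncard)

end Obstructor

/-! ### Open cones and their triangulations -/

section Cone

variable {V : Type*}

/-- The open cone `K × [0,∞) / K × {0}` of a finite complex `K`, realized in `ℝ^V`: the class of
`(p, t)`, with `p` given by barycentric coordinates, is the point `t • p`. -/
def openCone (K : AbstractSimplicialComplex V) : Set (V → ℝ) :=
  {x | (∀ v, 0 ≤ x v) ∧ (x = 0 ∨ ∃ σ ∈ K.faces, Function.support x = (σ : Set V))}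

/-- The open cone over the simplex `σ`, as a subset of the open cone over `K`. -/
def simplexCone (K : AbstractSimplicialComplex V) (σ : Finset V) : Set (openCone K) :=
  {x | Function.support (x : V → ℝ) ⊆ (σ : Set V)}

/-- A (locally finite) triangulation of a topological space `X`: a homeomorphism to `X` from the
underlying space of a locally finite simplicial complex in `E`. -/
structure Triangulation (E X : Type*) [NormedAddCommGroup E] [NormedSpace ℝ E]
    [TopologicalSpace X] where
  /-- the simplicial complex -/
  complex : Geometry.SimplicialComplex ℝ E
  /-- every point of the underlying space has a neighbourhood which meets finitely many simplices -/
  locallyFinite : LocallyFinite fun s : complex.faces =>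
    {x : complex.space | (x : E) ∈ convexHull ℝ ((s : Finset E) : Set E)}
  /-- the homeomorphism -/
  homeo : complex.space ≃ₜ X

namespace Triangulation

variable {E X : Type*} [NormedAddCommGroup E] [NormedSpace ℝ E] [TopologicalSpace X]

/-- The `0`-skeleton of a triangulation. -/
def Vertex (T : Triangulation E X) : Type _ := T.complex.vertices

/-- Two vertices are adjacent if they span an edge. -/
def Adj (T : Triangulation E X) (a b : T.Vertex) : Prop :=
  ∃ s ∈ T.complex.faces, s.card = 2 ∧ (s : Set E) = {a.1, b.1}

/-- The subset `A` of `X` is (the image of) a subcomplex, i.e. a union of closed simplices. -/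
def IsSubcomplex (T : Triangulation E X) (A : Set X) : Prop :=
  ∃ F ⊆ T.complex.faces,
    {x : E | ∃ h : x ∈ T.complex.space, T.homeo ⟨x, h⟩ ∈ A} = ⋃ s ∈ F, convexHull ℝ (s : Set E)

/-- The vertices which lie in the subset `A` of `X`. -/
def verticesIn (T : Triangulation E X) (A : Set X) : Set T.Vertex :=
  {a | ∃ h : a.1 ∈ T.complex.space, T.homeo ⟨a.1, h⟩ ∈ A}

end Triangulation

end Cone

/-! ### Word metrics -/

section Groups

variable {Γ : Type*} [Group Γ]

/-- The word metric `d(g, h) = |g⁻¹h|` of `Γ` with respect to the generating set `S`: the distance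
in the Cayley graph. -/
noncomputable def wordDist (S : Finset Γ) (g h : Γ) : ℕ :=
  (SimpleGraph.mulCayley (S : Set Γ)).dist g h

/-- `Γ`, with finite generating set `S`, is two-ended: its Cayley graph has exactly two ends. -/
def IsTwoEnded (S : Finset Γ) : Prop :=
  (SimpleGraph.mulCayley (S : Set Γ)).end.ncard = 2

/-- The restrictions of `f : A → Γ` to `A₁` and `A₂` diverge, where `A` is discrete (so that
compact sets are finite). -/
def Diverge (S : Finset Γ) {A : Type*} (f : A → Γ) (A₁ A₂ : Set A) : Prop :=
  ∀ D : ℕ, ∃ C₁ C₂ : Set A, C₁.Finite ∧ C₂.Finite ∧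
    ∀ a ∈ A₁ \ C₁, ∀ b ∈ A₂ \ C₂, D < wordDist S (f a) (f b)

/-- A proper, Lipschitz, expanding map from the `0`-skeleton of a triangulation `T` of the open cone
of `K` to `Γ` with the word metric of `S`. -/
structure IsExpanding (S : Finset Γ) {V E : Type*} [NormedAddCommGroup E] [NormedSpace ℝ E]
    (K : AbstractSimplicialComplex V) (T : Triangulation E (openCone K)) (f : T.Vertex → Γ) :
    Prop where
  proper : ∀ B : Set Γ, B.Finite → (f ⁻¹' B).Finite
  lipschitz : ∃ C : ℕ, ∀ a b, T.Adj a b → wordDist S (f a) (f b) ≤ C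
  diverge : ∀ σ ∈ K.faces, ∀ τ ∈ K.faces, Disjoint σ τ →
    Diverge S f (T.verticesIn (simplexCone K σ)) (T.verticesIn (simplexCone K τ))

/-- For some `m`-obstructor complex `K` and some triangulation of the open cone of `K`, in which
the cones over the simplices of `K` are subcomplexes, there is a proper, Lipschitz, expanding map
from the `0`-skeleton to `Γ`. -/
def HasExpandingObstructor (S : Finset Γ) (m : ℕ) : Prop :=
  ∃ (V ι : Type) (_ : Fintype V) (_ : DecidableEq V) (_ : Fintype ι)
    (K : AbstractSimplicialComplex V) (T : Triangulation (ι → ℝ) (openCone K)),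
    IsObstructor K m ∧ (∀ σ ∈ K.faces, T.IsSubcomplex (simplexCone K σ)) ∧
    ∃ f : T.Vertex → Γ, IsExpanding S K T f

open Classical in
/-- The obstructor dimension of `Γ` with respect to the word metric of the finite generating set
`S`. -/
noncomputable def obdim (S : Finset Γ) : ℕ∞ :=
  if Finite Γ then 0
  else if IsTwoEnded S then 1
  else ⨆ (m : ℕ) (_ : HasExpandingObstructor S m), ((m + 2 : ℕ) : ℕ∞)

/-- `Γ`, with the word metric of the finite generating set `S`, is weakly convex. -/
def WeaklyConvex (S : Finset Γ) : Prop :=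
  ∃ (φ : Γ → Γ → unitInterval → Γ) (M : ℝ), 0 < M ∧
    (∀ z w, φ z w 0 = z ∧ φ z w 1 = w) ∧
    (∃ γ : ℝ → ℝ, ∀ R, 0 ≤ R → ∀ z w, (wordDist S z w : ℝ) ≤ R →
      ∀ t t', (wordDist S (φ z w t) (φ z w t') : ℝ) ≤ γ R) ∧
    (∀ z w, ∃ ε : ℝ, 0 < ε ∧ ∀ t t' : unitInterval, |(t : ℝ) - t'| < ε →
      (wordDist S (φ z w t) (φ z w t') : ℝ) < M) ∧
    (∀ z z' w w', wordDist S z z' ≤ 1 → wordDist S w w' ≤ 1 →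
      ∀ t, (wordDist S (φ z w t) (φ z' w' t) : ℝ) ≤ M)

/-- A map between groups which is Lipschitz for the word metrics of `S` and `S'`. -/
def IsLipschitz {Γ' : Type*} [Group Γ'] (S : Finset Γ) (S' : Finset Γ') (s : Γ → Γ') : Prop :=
  ∃ L : ℕ, ∀ a b, wordDist S' (s a) (s b) ≤ L * wordDist S a b

end Groups

end ObstructorDim

/-! The obstructor dimension adds up because obstructors can be joined and a map on the cone of the
join can be assembled from maps into the kernel and the quotient.

Complexes. The join `K * L` of an `m`-obstructor and an `n`-obstructor is an `(m + n +
2)`-obstructor (`IsObstructor.join`). To see this the van Kampen number is made linear: for vertex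
images in general position, `f(σ)` and `f(τ)` meet exactly when `(σ, τ)` is the pair of positive and
negative supports of an affine dependency (`intersectionCount_eq`), so the number counts Radon
partitions. With suitable vectors for the join, Radon partitions of the join correspond to pairs of
Radon partitions (`ncard_isRadon_joinVec`), and odd times odd is odd. Allowing empty simplices in
the pairs turns condition (3) into part of the cycle condition, and makes a single point a
"(-1)-obstructor"; this explains the summand 1 contributed by a ray.

Maps. Let `f : cone(K) → H` and `g : cone(L) → Q` be expanding. Since `cone(K * L) = cone(K) ×
cone(L)`, there is the candidate `F₀(x, y) = ι(f x) s(g y)`. It is proper and expanding, but not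
Lipschitz: a step in `x` is conjugated by `s(g y)`, and becomes long as `y` goes to infinity. Such
long steps stay close to a coset of `H`, and cosets are left translates of `H`. Weak convexity thus
supplies paths in the fibres of `π` (`exists_isFibrewisePath`), along which `F₀` is extended over
each unit cube, by induction over the dimension, to a coarsely continuous map on the whole real cone
(`coarselyContinuous_interpolate`). The extension projects to `g` of the integral part, and it is
close to `F₀` wherever `y` is bounded; these two facts give properness and divergence
(`exists_isCoarseExpanding_joinComplex`).

Coarsely continuous maps become Lipschitz after reparametrizing the cone radially so slowly that
adjacent lattice points are mapped within the local Lebesgue number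
(`IsCoarseExpanding.exists_isLatticeExpanding`). Lattice points are the vertices of the Kuhn
triangulation of the cone. Conversely a map on the vertices of any triangulation extends coarsely by
sending a point to a vertex of its carrier (`IsExpanding.exists_isCoarseExpanding`), so the choice
of triangulation is immaterial.

Degenerate cases. If `H` or `Q` is finite, the section or the inclusion is a coarse equivalence, and
`obdim` is monotone under those. If both are infinite, `G` is not two-ended
(`not_isTwoEnded_of_groupExtension`), so `obdim G` is given by obstructors; when only rays are
available in `H` and `Q`, three diverging rays in `G` give a 0-obstructor. -/

namespace ObstructorDim

/-! ### Word metrics -/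

section WordMetric

variable {Γ : Type*} [Group Γ] {S : Finset Γ}

/-- Left multiplication as an automorphism of the Cayley graph. -/
def mulLeftIso (S : Set Γ) (a : Γ) : SimpleGraph.mulCayley S ≃g SimpleGraph.mulCayley S where
  toEquiv := Equiv.mulLeft a
  map_rel_iff' := by simp

theorem mulCayley_connected (hS : Subgroup.closure (S : Set Γ) = ⊤) :
    (SimpleGraph.mulCayley (S : Set Γ)).Connected := by
  have key : ∀ g : Γ, (SimpleGraph.mulCayley (S : Set Γ)).Reachable 1 g := by
    intro g
    have hg : g ∈ Subgroup.closure (S : Set Γ) := hS ▸ Subgroup.mem_top g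
    have step : ∀ x s : Γ, s ∈ (S : Set Γ) → (SimpleGraph.mulCayley (S : Set Γ)).Reachable x (x * s) := by
      intro x s hs
      by_cases h : x = x * s
      · rw [← h]
      · exact SimpleGraph.Adj.reachable ((SimpleGraph.mulCayley_adj _ _ _).2 ⟨h, by simp_all⟩)
    induction hg using Subgroup.closure_induction_right with
    | one => exact .refl _
    | mul_right x _ y hy ih => exact ih.trans (step x y hy)
    | mul_inv_cancel x _ y hy ih =>
      refine ih.trans (.symm ?_)
      simpa using step (x * y⁻¹) y hy
  have : Nonempty Γ := ⟨1⟩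
  exact ⟨fun a b => (key a).symm.trans (key b)⟩

theorem wordDist_self (x : Γ) : wordDist S x x = 0 := SimpleGraph.dist_self

theorem wordDist_comm (x y : Γ) : wordDist S x y = wordDist S y x := SimpleGraph.dist_comm

theorem wordDist_triangle (hS : Subgroup.closure (S : Set Γ) = ⊤) (x y z : Γ) :
    wordDist S x z ≤ wordDist S x y + wordDist S y z :=
  (mulCayley_connected hS).dist_triangle

theorem wordDist_mul_left (hS : Subgroup.closure (S : Set Γ) = ⊤) (a x y : Γ) :
    wordDist S (a * x) (a * y) = wordDist S x y := by
  have key : ∀ a x y : Γ, wordDist S (a * x) (a * y) ≤ wordDist S x y := by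
    intro a x y
    obtain ⟨p, hp⟩ := (mulCayley_connected hS).exists_walk_length_eq_dist x y
    have := SimpleGraph.dist_le (p.map (mulLeftIso (S : Set Γ) a).toHom)
    rw [SimpleGraph.Walk.length_map, hp] at this
    exact this
  refine le_antisymm (key a x y) ?_
  simpa using key a⁻¹ (a * x) (a * y)

theorem wordDist_eq_one (hS : Subgroup.closure (S : Set Γ) = ⊤) (x y : Γ) :
    wordDist S x y = wordDist S 1 (x⁻¹ * y) := by
  rw [← wordDist_mul_left hS x⁻¹ x y, inv_mul_cancel]

open scoped Pointwise in
theorem finite_wordDist_le (hS : Subgroup.closure (S : Set Γ) = ⊤) (x : Γ) (n : ℕ) :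
    {y | wordDist S x y ≤ n}.Finite := by
  classical
  have key : ∀ (x y : Γ) (p : (SimpleGraph.mulCayley (S : Set Γ)).Walk x y),
      x⁻¹ * y ∈ (insert 1 ((S : Set Γ) ∪ (S : Set Γ)⁻¹)) ^ p.length := by
    intro x y p
    induction p with
    | nil => simp
    | cons h p ih =>
      rename_i u v w
      rw [SimpleGraph.Walk.length_cons, pow_succ']
      refine ⟨u⁻¹ * v, ?_, _, ih, by simp⟩
      rcases (SimpleGraph.mulCayley_adj _ _ _).1 h with ⟨-, h | h⟩
      · exact Or.inr (Or.inl h)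
      · exact Or.inr (Or.inr (by simpa using h))
  have hfin : ((insert 1 ((S : Set Γ) ∪ (S : Set Γ)⁻¹)) ^ n : Set Γ).Finite :=
    by
    have h0 : (insert 1 ((S : Set Γ) ∪ (S : Set Γ)⁻¹)).Finite :=
      (S.finite_toSet.union S.finite_toSet.inv).insert 1
    induction n with
    | zero => simp
    | succ n ih => exact pow_succ (insert 1 ((S : Set Γ) ∪ (S : Set Γ)⁻¹)) n ▸ ih.mul h0
  refine (hfin.image (x * ·)).subset ?_
  intro y hy
  obtain ⟨p, hp⟩ := (mulCayley_connected hS).exists_walk_length_eq_dist x y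
  have h1 := Set.pow_subset_pow_right (by simp) (show p.length ≤ n from hp ▸ hy) (key x y p)
  exact ⟨_, h1, by simp⟩

/-- A map is Lipschitz as soon as it is so on the edges of the Cayley graph. -/
theorem wordDist_le_mul_of_adj {Γ' : Type*} [Group Γ'] {S' : Finset Γ'}
    (hS : Subgroup.closure (S : Set Γ) = ⊤) (hS' : Subgroup.closure (S' : Set Γ') = ⊤)
    {φ : Γ → Γ'} {L : ℕ}
    (h : ∀ a b, (SimpleGraph.mulCayley (S : Set Γ)).Adj a b → wordDist S' (φ a) (φ b) ≤ L)
    (a b : Γ) : wordDist S' (φ a) (φ b) ≤ L * wordDist S a b := by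
  have key : ∀ (x y : Γ) (p : (SimpleGraph.mulCayley (S : Set Γ)).Walk x y),
      wordDist S' (φ x) (φ y) ≤ L * p.length := by
    intro x y p
    induction p with
    | nil => simp [wordDist_self]
    | cons h' p ih =>
      rename_i u v w
      have := wordDist_triangle hS' (φ u) (φ v) (φ w)
      have := h _ _ h'
      rw [SimpleGraph.Walk.length_cons, mul_add]
      omega
  obtain ⟨p, hp⟩ := (mulCayley_connected hS).exists_walk_length_eq_dist a b
  change _ ≤ L * (SimpleGraph.mulCayley (S : Set Γ)).dist a b
  rw [← hp]
  exact key a b p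

theorem isLipschitz_monoidHom {Γ' : Type*} [Group Γ'] {S' : Finset Γ'}
    (hS : Subgroup.closure (S : Set Γ) = ⊤) (hS' : Subgroup.closure (S' : Set Γ') = ⊤)
    (φ : Γ →* Γ') : IsLipschitz S S' φ := by
  refine ⟨S.sup fun s => wordDist S' 1 (φ s), wordDist_le_mul_of_adj hS hS' ?_⟩
  intro a b hab
  have h1 : ∀ s ∈ S, wordDist S' 1 (φ s) ≤ S.sup fun s => wordDist S' 1 (φ s) :=
    fun s hs => Finset.le_sup (f := fun s => wordDist S' 1 (φ s)) hs
  rcases (SimpleGraph.mulCayley_adj _ _ _).1 hab with ⟨-, h | h⟩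
  · rw [wordDist_eq_one hS', ← map_inv, ← map_mul]
    exact h1 _ h
  · rw [wordDist_comm, wordDist_eq_one hS', ← map_inv, ← map_mul]
    exact h1 _ h

/-- Homomorphisms with finite kernel are uniformly proper. -/
theorem exists_wordDist_le_of_finite_ker {Γ' : Type*} [Group Γ'] {S' : Finset Γ'}
    (hS : Subgroup.closure (S : Set Γ) = ⊤) (hS' : Subgroup.closure (S' : Set Γ') = ⊤)
    (φ : Γ →* Γ') (hφ : (φ.ker : Set Γ).Finite) (D : ℕ) :
    ∃ D', ∀ a b, wordDist S' (φ a) (φ b) ≤ D → wordDist S a b ≤ D' := by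
  have hfin : {x | wordDist S' 1 (φ x) ≤ D}.Finite := by
    refine (finite_wordDist_le hS' 1 D).preimage' (f := φ) fun y _ => ?_
    rcases (φ ⁻¹' {y}).eq_empty_or_nonempty with h | ⟨x, hx⟩
    · simp [h]
    · refine (hφ.image (x * ·)).subset fun z hz => ⟨x⁻¹ * z, ?_, by simp⟩
      simp_all [MonoidHom.mem_ker]
  obtain ⟨N, hN⟩ := (hfin.image (wordDist S 1)).bddAbove
  refine ⟨N, fun a b hab => ?_⟩
  rw [wordDist_eq_one hS]
  rw [wordDist_eq_one hS', ← map_inv, ← map_mul] at hab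
  exact hN ⟨_, hab, rfl⟩

theorem exists_wordDist_lt_of_infinite [Infinite Γ] (hS : Subgroup.closure (S : Set Γ) = ⊤)
    (x : Γ) (n : ℕ) : ∃ y, n < wordDist S x y := by
  by_contra! h
  exact Set.infinite_univ ((finite_wordDist_le hS x n).subset fun y _ => h y)

end WordMetric

/-! ### Geodesic lines -/

section Line

variable {Γ : Type*} [Group Γ] {S : Finset Γ}

theorem exists_geodesic_segment [Infinite Γ] (hS : Subgroup.closure (S : Set Γ) = ⊤) (n : ℕ) :
    ∃ r : ℕ → Γ, ∀ i ≤ n, ∀ j ≤ n, i ≤ j → wordDist S (r i) (r j) = j - i := by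
  obtain ⟨y, hy⟩ := exists_wordDist_lt_of_infinite hS 1 n
  obtain ⟨p, hp⟩ := (mulCayley_connected hS).exists_walk_length_eq_dist 1 y
  have hlen : p.length = wordDist S 1 y := hp
  have hle : ∀ i j, i ≤ j → wordDist S (p.getVert i) (p.getVert j) ≤ j - i := by
    intro i j hij
    induction j, hij using Nat.le_induction with
    | base => simp [wordDist_self]
    | succ j hij ih =>
      have h1 := wordDist_triangle hS (p.getVert i) (p.getVert j) (p.getVert (j + 1))
      have h2 : wordDist S (p.getVert j) (p.getVert (j + 1)) ≤ 1 := by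
        rcases lt_or_ge j p.length with hj | hj
        · exact (SimpleGraph.dist_eq_one_iff_adj.2 (p.adj_getVert_succ hj)).le
        · rw [p.getVert_of_length_le hj, p.getVert_of_length_le (by omega), wordDist_self]
          omega
      omega
  refine ⟨p.getVert, fun i hi j hj hij => le_antisymm (hle i j hij) ?_⟩
  have h0 := hle 0 i (Nat.zero_le _)
  have h1 := hle j p.length (by omega)
  rw [p.getVert_zero] at h0
  rw [p.getVert_length] at h1
  have h2 := wordDist_triangle hS 1 (p.getVert i) y
  have h3 := wordDist_triangle hS (p.getVert i) (p.getVert j) y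
  omega

/-- An infinite finitely generated group contains a bi-infinite geodesic. -/
theorem exists_geodesic_line [Infinite Γ] (hS : Subgroup.closure (S : Set Γ) = ⊤) :
    ∃ r : ℤ → Γ, ∀ i j, wordDist S (r i) (r j) = (i - j).natAbs := by
  have h1 : ∀ n : ℕ, ∃ r : ℤ → Γ, r 0 = 1 ∧ ∀ i j : ℤ, i.natAbs ≤ n → j.natAbs ≤ n →
      wordDist S (r i) (r j) = (i - j).natAbs := by
    intro n
    obtain ⟨r, hr⟩ := exists_geodesic_segment hS (2 * n)
    refine ⟨fun i => (r n)⁻¹ * r (i + n).toNat, by simp, fun i j hi hj => ?_⟩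
    rw [wordDist_mul_left hS]
    rcases le_total i j with h | h
    · rw [hr _ (by omega) _ (by omega) (by omega)]; omega
    · rw [wordDist_comm, hr _ (by omega) _ (by omega) (by omega)]; omega
  choose r hr0 hr using h1
  -- The segments centred at 1 take finitely many values at each fixed time, so an ultrafilter limit
  -- of them exists pointwise; it replaces a diagonal subsequence argument.
  let U : Ultrafilter ℕ := Filter.hyperfilter ℕ
  have hU : ∀ k : ℕ, ∀ᶠ n in (U : Filter ℕ), k ≤ n := fun k =>
    Nat.hyperfilter_le_atTop (Filter.eventually_ge_atTop k)
  have h2 : ∀ i : ℤ, ∃ x : Γ, ∀ᶠ n in (U : Filter ℕ), r n i = x := by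
    intro i
    have hfin := finite_wordDist_le hS (1 : Γ) i.natAbs
    have : ∀ᶠ n in (U : Filter ℕ), r n i ∈ ⋃ x ∈ {y | wordDist S (1 : Γ) y ≤ i.natAbs}, {x} := by
      filter_upwards [hU i.natAbs] with n hn
      have := hr n 0 i (by simp) hn
      rw [hr0] at this
      simp [this]
    have h3 := (Ultrafilter.finite_biUnion_mem_iff (f := U.map (fun n => r n i)) hfin
      (s := fun x => {x})).1 this
    obtain ⟨x, -, hx⟩ := h3
    exact ⟨x, hx⟩
  choose x hx using h2
  refine ⟨x, fun i j => ?_⟩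
  obtain ⟨n, h1, h2, h3, h4⟩ := ((hx i).and ((hx j).and ((hU i.natAbs).and (hU j.natAbs)))).exists
  rw [← h1, ← h2, hr n i j h3 h4]

end Line

/-! ### Ends of graphs -/

section Ends

open SimpleGraph CategoryTheory

variable {V V' V'' : Type*} {G : SimpleGraph V} {G' : SimpleGraph V'} {G'' : SimpleGraph V''}

/-- The component of the complement of the finite set `K` which contains the end `e`. -/
def endComponent (e : G.end) (K : Finset V) : G.ComponentCompl (K : Set V) :=
  e.1 (Opposite.op K)

theorem endComponent_hom (e : G.end) {K L : Finset V} (h : K ⊆ L) :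
    (endComponent e L).hom h = endComponent e K :=
  e.2 (opHomOfLE h)

theorem endComponent_mono (e : G.end) {K L : Finset V} (h : K ⊆ L) {v : V}
    (hv : v ∈ endComponent e L) : v ∈ endComponent e K := by
  rw [← endComponent_hom e h]
  exact ComponentCompl.subset_hom _ h hv

theorem end_ext {e e' : G.end} (h : ∀ K, endComponent e K = endComponent e' K) : e = e' :=
  Subtype.ext (funext fun K => h K.unop)

theorem endComponent_infinite (e : G.end) (K : Finset V) : (endComponent e K).supp.Infinite :=
  (endComponent e K).infinite_iff_in_all_ranges.2 fun L h =>
    ⟨endComponent e L, endComponent_hom e h⟩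

/-- The vertices `x` and `y` are connected outside `K`. -/
def ConnectedOutside (G : SimpleGraph V) (K : Set V) (x y : V) : Prop :=
  ∀ C : G.ComponentCompl K, x ∈ C ↔ y ∈ C

theorem ConnectedOutside.trans {K : Set V} {x y z : V} (h : ConnectedOutside G K x y)
    (h' : ConnectedOutside G K y z) : ConnectedOutside G K x z := fun C => (h C).trans (h' C)

theorem ConnectedOutside.symm {K : Set V} {x y : V} (h : ConnectedOutside G K x y) :
    ConnectedOutside G K y x := fun C => (h C).symm

theorem connectedOutside_of_walk {K : Set V} {x y : V} (p : G.Walk x y)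
    (hp : ∀ v ∈ p.support, v ∉ K) : ConnectedOutside G K x y := by
  induction p with
  | nil => exact fun C => Iff.rfl
  | cons h p ih =>
    rename_i u v w
    refine ConnectedOutside.trans (y := v) ?_ (ih fun z hz => hp z (by simp [hz]))
    have hu : u ∉ K := hp u (by simp)
    have hv : v ∉ K := hp v (by simp)
    exact fun C => ⟨fun hC => ComponentCompl.mem_of_adj _ _ hC hv h,
      fun hC => ComponentCompl.mem_of_adj _ _ hC hu h.symm⟩

/-- The map `φ` sends the end `e` to the end `e'`. -/
def EndRel (φ : V → V') (e : G.end) (e' : G'.end) : Prop :=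
  ∀ K', ∃ K, ∀ v ∈ endComponent e K, φ v ∈ endComponent e' K'

theorem EndRel.unique {φ : V → V'} {e : G.end} {e₁ e₂ : G'.end} (h₁ : EndRel φ e e₁)
    (h₂ : EndRel φ e e₂) : e₁ = e₂ := by
  classical
  refine end_ext fun K' => ?_
  obtain ⟨K₁, hK₁⟩ := h₁ K'
  obtain ⟨K₂, hK₂⟩ := h₂ K'
  obtain ⟨v, hv⟩ := (endComponent e (K₁ ∪ K₂)).nonempty
  have hv₁ := hK₁ v (endComponent_mono e Finset.subset_union_left hv)
  have hv₂ := hK₂ v (endComponent_mono e Finset.subset_union_right hv)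
  by_contra hne
  exact Set.disjoint_left.1 (ComponentCompl.pairwise_disjoint hne) hv₁ hv₂

theorem EndRel.comp {φ : V → V'} {ψ : V' → V''} {e : G.end} {e' : G'.end} {e'' : G''.end}
    (h : EndRel φ e e') (h' : EndRel ψ e' e'') : EndRel (ψ ∘ φ) e e'' := by
  intro K''
  obtain ⟨K', hK'⟩ := h' K''
  obtain ⟨K, hK⟩ := h K'
  exact ⟨K, fun v hv => hK' _ (hK v hv)⟩

/-- The part of `e` outside a large finite set is connected through edges whose images stay
connected outside `K'`; so its image lies in one component. The components chosen for different `K'`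
are compatible because they share the image of a vertex far out along `e`. -/
theorem exists_endRel {φ : V → V'}
    (hφ : ∀ K' : Finset V', ∃ K : Finset V, (∀ x ∉ K, φ x ∉ K') ∧
      ∀ x ∉ K, ∀ y ∉ K, G.Adj x y → ConnectedOutside G' K' (φ x) (φ y)) (e : G.end) :
    ∃ e' : G'.end, EndRel φ e e' := by
  classical
  choose k hk₁ hk₂ using hφ
  have h1 : ∀ K' : Finset V', ∃ C : G'.ComponentCompl (K' : Set V'),
      ∀ v ∈ endComponent e (k K'), φ v ∈ C := by
    intro K'
    obtain ⟨v, hv⟩ := (endComponent e (k K')).nonempty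
    have hvk := ComponentCompl.notMem_of_mem hv
    refine ⟨G'.componentComplMk (hk₁ K' v hvk), ?_⟩
    rintro w ⟨hw, hwe⟩
    obtain ⟨hv', hve⟩ := hv
    obtain ⟨p⟩ := ConnectedComponent.exact (hve.trans hwe.symm)
    have walk : ∀ (a b : ((k K' : Set V)ᶜ : Set V)) (p : (G.induce (k K' : Set V)ᶜ).Walk a b),
        ConnectedOutside G' K' (φ a) (φ b) := by
      intro a b p
      induction p with
      | nil => exact fun C => Iff.rfl
      | cons h p ih =>
        rename_i a b c
        exact (hk₂ K' a a.2 b b.2 h).trans ih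
    exact (walk _ _ p _).1 ⟨hk₁ K' v hvk, rfl⟩
  choose c hc using h1
  have hsec : (fun K' => c K'.unop : ∀ K', G'.componentComplFunctor.obj K') ∈ G'.end := by
    intro K L f
    have hLK : L.unop ⊆ K.unop := leOfHom f.unop
    obtain ⟨v, hv⟩ := (endComponent e (k K.unop ∪ k L.unop)).nonempty
    have h1 := hc K.unop v (endComponent_mono e Finset.subset_union_left hv)
    have h2 := hc L.unop v (endComponent_mono e Finset.subset_union_right hv)
    change (c K.unop).hom hLK = c L.unop
    exact (ComponentCompl.hom_eq_iff_not_disjoint _ hLK _).2 (Set.not_disjoint_iff.2 ⟨_, h1, h2⟩)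
  exact ⟨⟨_, hsec⟩, fun K' => ⟨k K', hc K'⟩⟩

theorem nonempty_end_equiv {φ : V → V'} {ψ : V' → V} (hφ : ∀ e : G.end, ∃ e' : G'.end, EndRel φ e e')
    (hψ : ∀ e' : G'.end, ∃ e : G.end, EndRel ψ e' e) (hψφ : ∀ e : G.end, EndRel (ψ ∘ φ) e e)
    (hφψ : ∀ e : G'.end, EndRel (φ ∘ ψ) e e) : Nonempty (G.end ≃ G'.end) := by
  choose f hf using hφ
  choose g hg using hψ
  exact ⟨⟨f, g, fun e => ((hf e).comp (hg _)).unique (hψφ e),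
    fun e => ((hg e).comp (hf _)).unique (hφψ e)⟩⟩

end Ends

/-! ### Quasi-isometries and ends -/

section QuasiIsometry

variable {Γ : Type*} [Group Γ] {S : Finset Γ} {Γ' : Type*} [Group Γ'] {S' : Finset Γ'}

/-- A geodesic of length at most `n` starting farther than `n` from `K` cannot reach `K`. -/
theorem connectedOutside_of_wordDist_le (hS : Subgroup.closure (S : Set Γ) = ⊤) {K : Set Γ}
    {x y : Γ} {n : ℕ} (hx : ∀ k ∈ K, n < wordDist S x k) (hxy : wordDist S x y ≤ n) :
    ConnectedOutside (SimpleGraph.mulCayley (S : Set Γ)) K x y := by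
  classical
  obtain ⟨p, hp⟩ := (mulCayley_connected hS).exists_walk_length_eq_dist x y
  refine connectedOutside_of_walk p fun v hv hvK => ?_
  have h1 : wordDist S x v ≤ (p.takeUntil v hv).length := SimpleGraph.dist_le _
  have h2 := p.length_takeUntil_le_length hv
  have h3 := hx v hvK
  have h4 : p.length = wordDist S x y := hp
  omega

/-- The points at distance at most `n` from the finite set `K`. -/
noncomputable def finsetNhd (hS : Subgroup.closure (S : Set Γ) = ⊤) (K : Finset Γ) (n : ℕ) :
    Finset Γ :=
  (K.finite_toSet.biUnion fun k _ => finite_wordDist_le hS k n).toFinset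

theorem lt_wordDist_of_notMem_finsetNhd (hS : Subgroup.closure (S : Set Γ) = ⊤) {K : Finset Γ}
    {n : ℕ} {x : Γ} (hx : x ∉ finsetNhd hS K n) : ∀ k ∈ (K : Set Γ), n < wordDist S x k := by
  intro k hk
  rw [wordDist_comm]
  by_contra! h
  exact hx (by simpa [finsetNhd] using ⟨k, hk, h⟩)

theorem exists_endRel_of_lipschitz (hS' : Subgroup.closure (S' : Set Γ') = ⊤) {φ : Γ → Γ'} {L : ℕ}
    (hφ : ∀ a b, (SimpleGraph.mulCayley (S : Set Γ)).Adj a b → wordDist S' (φ a) (φ b) ≤ L)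
    (hfin : ∀ B : Set Γ', B.Finite → (φ ⁻¹' B).Finite)
    (e : (SimpleGraph.mulCayley (S : Set Γ)).end) :
    ∃ e' : (SimpleGraph.mulCayley (S' : Set Γ')).end, EndRel φ e e' := by
  refine exists_endRel (fun K' => ⟨(hfin _ (finsetNhd hS' K' L).finite_toSet).toFinset, ?_, ?_⟩) e
  · intro x hx hx'
    have := lt_wordDist_of_notMem_finsetNhd hS' (K := K') (n := L) (x := φ x) (by simpa using hx) _ hx'
    rw [wordDist_self] at this
    omega
  · intro x hx y _ hxy
    exact connectedOutside_of_wordDist_le hS'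
      (lt_wordDist_of_notMem_finsetNhd hS' (by simpa using hx)) (hφ x y hxy)

theorem endRel_self_of_close (hS : Subgroup.closure (S : Set Γ) = ⊤) {θ : Γ → Γ} {D : ℕ}
    (hθ : ∀ x, wordDist S x (θ x) ≤ D) (e : (SimpleGraph.mulCayley (S : Set Γ)).end) :
    EndRel θ e e := by
  classical
  intro K
  refine ⟨K ∪ finsetNhd hS K D, fun v hv => ?_⟩
  have hv' := SimpleGraph.ComponentCompl.notMem_of_mem hv
  rw [Finset.coe_union, Set.mem_union, not_or] at hv'
  exact (connectedOutside_of_wordDist_le hS (lt_wordDist_of_notMem_finsetNhd hS hv'.2) (hθ v) _).1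
    (endComponent_mono e Finset.subset_union_left hv)

/-- A map between groups which is a coarse embedding for the word metrics and Lipschitz. -/
structure IsCoarseEmbedding (S : Finset Γ) (S' : Finset Γ') (φ : Γ → Γ') : Prop where
  lipschitz : IsLipschitz S S' φ
  expanding : ∀ D, ∃ D', ∀ a b, wordDist S' (φ a) (φ b) ≤ D → wordDist S a b ≤ D'

theorem IsCoarseEmbedding.finite_preimage (hS : Subgroup.closure (S : Set Γ) = ⊤) {φ : Γ → Γ'}
    (h : IsCoarseEmbedding S S' φ) {B : Set Γ'} (hB : B.Finite) : (φ ⁻¹' B).Finite := by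
  refine hB.preimage' fun y _ => ?_
  rcases (φ ⁻¹' {y}).eq_empty_or_nonempty with h0 | ⟨x, hx⟩
  · simp [h0]
  · obtain ⟨D, hD⟩ := h.expanding 0
    refine (finite_wordDist_le hS x D).subset fun z hz => hD x z ?_
    rw [show φ x = y from hx, show φ z = y from hz, wordDist_self]

/-- Coarse surjectivity gives a coarse inverse `ψ`, which is again Lipschitz and proper; both maps
act on ends, and maps at bounded distance from the identity act trivially. -/
theorem isTwoEnded_iff_of_isCoarseEmbedding (hS : Subgroup.closure (S : Set Γ) = ⊤)
    (hS' : Subgroup.closure (S' : Set Γ') = ⊤) {φ : Γ → Γ'} (h : IsCoarseEmbedding S S' φ)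
    {D : ℕ} (hD : ∀ y, ∃ x, wordDist S' y (φ x) ≤ D) : IsTwoEnded S ↔ IsTwoEnded S' := by
  choose ψ hψ using hD
  obtain ⟨L, hL⟩ := h.lipschitz
  obtain ⟨D₁, hD₁⟩ := h.expanding (D + 1 + D)
  have hψ' : IsLipschitz S' S ψ := by
    refine ⟨D₁, wordDist_le_mul_of_adj hS' hS fun a b hab => hD₁ _ _ ?_⟩
    have h1 := wordDist_triangle hS' (φ (ψ a)) a (φ (ψ b))
    have h2 := wordDist_triangle hS' a b (φ (ψ b))
    have h3 : wordDist S' a b = 1 := SimpleGraph.dist_eq_one_iff_adj.2 hab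
    have h4 := hψ a
    have h5 := hψ b
    rw [wordDist_comm] at h4
    omega
  obtain ⟨L', hL'⟩ := hψ'
  have hψfin : ∀ B : Set Γ, B.Finite → (ψ ⁻¹' B).Finite := by
    intro B hB
    refine hB.preimage' fun y _ => (finite_wordDist_le hS' (φ y) D).subset fun z hz => ?_
    rw [← show ψ z = y from hz]
    have := hψ z
    rwa [wordDist_comm] at this
  obtain ⟨D₂, hD₂⟩ := h.expanding D
  obtain ⟨ε⟩ := nonempty_end_equiv (G := SimpleGraph.mulCayley (S : Set Γ))
    (G' := SimpleGraph.mulCayley (S' : Set Γ')) (φ := φ) (ψ := ψ)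
    (exists_endRel_of_lipschitz (L := L) hS'
      (fun a b hab => (hL a b).trans (by
        rw [show wordDist S a b = 1 from SimpleGraph.dist_eq_one_iff_adj.2 hab, mul_one]))
      fun B hB => h.finite_preimage hS hB)
    (exists_endRel_of_lipschitz (L := L') hS
      (fun a b hab => (hL' a b).trans (by
        rw [show wordDist S' a b = 1 from SimpleGraph.dist_eq_one_iff_adj.2 hab, mul_one])) hψfin)
    (endRel_self_of_close (D := D₂) hS fun x => hD₂ _ _ (hψ (φ x)))
    (endRel_self_of_close (D := D) hS' hψ)
  rw [IsTwoEnded, IsTwoEnded, ← Nat.card_coe_set_eq, ← Nat.card_coe_set_eq, Nat.card_congr ε]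

end QuasiIsometry

/-! ### Extensions of infinite groups by infinite groups -/

section Extension

variable {H Q G : Type*} [Group H] [Group Q] [Group G] {SH : Finset H} {SG : Finset G}

/-- The group in fact has at most one end: outside a finite set `K`, all cosets of the kernel that
avoid a neighbourhood of `K` are connected to each other, and every end meets such a coset. -/
theorem not_isTwoEnded_of_groupExtension [Infinite H] [Infinite Q]
    (hSH : Subgroup.closure (SH : Set H) = ⊤) (hSG : Subgroup.closure (SG : Set G) = ⊤)
    (X : GroupExtension H G Q) : ¬ IsTwoEnded SG := by
  classical
  obtain ⟨C, hC⟩ := isLipschitz_monoidHom hSH hSG X.inl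
  have hsub : ∀ e e' : (SimpleGraph.mulCayley (SG : Set G)).end, e = e' := by
    intro e e'
    refine end_ext fun K => ?_
    set N := finsetNhd hSG K C with hN
    -- A coset disjoint from `N` is farther than `C` from `K`, and generators of `H` move its points
    -- by at most `C`.
    have coset : ∀ x : G, (∀ y ∈ N, X.rightHom y ≠ X.rightHom x) → ∀ h : H,
        ConnectedOutside (SimpleGraph.mulCayley (SG : Set G)) K x (x * X.inl h) := by
      intro x hx h
      have walk : ∀ (a b : H) (p : (SimpleGraph.mulCayley (SH : Set H)).Walk a b),
          ConnectedOutside (SimpleGraph.mulCayley (SG : Set G)) K (x * X.inl a) (x * X.inl b) := by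
        intro a b p
        induction p with
        | nil => exact fun C => Iff.rfl
        | cons h p ih =>
          rename_i u v w
          refine ConnectedOutside.trans (connectedOutside_of_wordDist_le (n := C) hSG ?_ ?_) ih
          · exact lt_wordDist_of_notMem_finsetNhd hSG fun hu => hx _ hu (by simp)
          · rw [wordDist_mul_left hSG]
            refine (hC u v).trans ?_
            rw [show wordDist SH u v = 1 from SimpleGraph.dist_eq_one_iff_adj.2 h, mul_one]
      obtain ⟨p⟩ := (mulCayley_connected hSH).1 1 h
      simpa using walk 1 h p
    have cosets : ∀ x x' : G, (∀ y ∈ N, X.rightHom y ≠ X.rightHom x) →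
        (∀ y ∈ N, X.rightHom y ≠ X.rightHom x') →
        ConnectedOutside (SimpleGraph.mulCayley (SG : Set G)) K x x' := by
      intro x x' hx hx'
      -- Slide along the first coset until `K` is farther away than `d(x, x')`; right multiplication
      -- by `x⁻¹ x'` then crosses to the second coset, by normality, without meeting `K`.
      obtain ⟨h, hh⟩ : ∃ h : H, x * X.inl h ∉ finsetNhd hSG K (wordDist SG x x') := by
        by_contra! hcon
        have hinj : Function.Injective fun h : H => x * X.inl h :=
          (mul_right_injective x).comp X.inl_injective
        exact Set.infinite_univ (((finsetNhd hSG K (wordDist SG x x')).finite_toSet.preimage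
          hinj.injOn).subset fun h _ => hcon h)
      obtain ⟨h', hh'⟩ : ∃ h' : H, X.inl h' = x'⁻¹ * (x * X.inl h * (x⁻¹ * x')) := by
        have : x'⁻¹ * (x * X.inl h * (x⁻¹ * x')) ∈ X.inl.range := by
          rw [X.range_inl_eq_ker_rightHom, MonoidHom.mem_ker]
          simp
        exact this
      refine (coset x hx h).trans (ConnectedOutside.trans (y := x' * X.inl h') ?_
        (coset x' hx' h').symm)
      refine connectedOutside_of_wordDist_le hSG (lt_wordDist_of_notMem_finsetNhd hSG hh) ?_
      rw [hh', wordDist_eq_one hSG, wordDist_eq_one hSG x x']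
      exact le_of_eq (congrArg _ (by group))
    -- As `Q` is infinite, one `g` moves every coset meeting `N` off `N`. Multiplying a sufficiently
    -- distant point of an end by this `g` keeps it in the same component.
    obtain ⟨g, hg⟩ : ∃ g : G, ∀ y ∈ N, ∀ z ∈ N, X.rightHom y * X.rightHom g ≠ X.rightHom z := by
      obtain ⟨q, hq⟩ := Infinite.exists_notMem_finset
        ((N ×ˢ N).image fun p => (X.rightHom p.1)⁻¹ * X.rightHom p.2)
      obtain ⟨g, rfl⟩ := X.rightHom_surjective q
      refine ⟨g, fun y hy z hz h => hq ?_⟩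
      rw [Finset.mem_image]
      exact ⟨(y, z), by simp [hy, hz], by simp [← h]⟩
    have far : ∀ e : (SimpleGraph.mulCayley (SG : Set G)).end, ∃ x ∈ endComponent e K,
        ∀ y ∈ N, X.rightHom y ≠ X.rightHom x := by
      intro e
      obtain ⟨x, hx, hx'⟩ := (endComponent_infinite e K).exists_notMem_finset
        (finsetNhd hSG K (wordDist SG 1 g))
      by_cases h : ∀ y ∈ N, X.rightHom y ≠ X.rightHom x
      · exact ⟨x, hx, h⟩
      · push Not at h
        obtain ⟨y, hy, hyx⟩ := h
        refine ⟨x * g, ?_, fun z hz hzx => hg y hy z hz ?_⟩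
        · refine (connectedOutside_of_wordDist_le hSG (lt_wordDist_of_notMem_finsetNhd hSG hx')
            ?_ _).1 hx
          rw [wordDist_eq_one hSG, inv_mul_cancel_left]
        · rw [hzx, map_mul, hyx]
    obtain ⟨x, hx, hxN⟩ := far e
    obtain ⟨x', hx', hxN'⟩ := far e'
    have h1 : x' ∈ endComponent e K := (cosets x x' hxN hxN' _).1 hx
    by_contra hne
    exact Set.disjoint_left.1 (SimpleGraph.ComponentCompl.pairwise_disjoint hne) h1 hx'
  have : Subsingleton (SimpleGraph.mulCayley (SG : Set G)).end := ⟨hsub⟩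
  intro h
  rw [IsTwoEnded, ← Nat.card_coe_set_eq] at h
  have := Finite.card_le_one_iff_subsingleton.2 this
  omega

end Extension

/-! ### Joins of simplicial complexes -/

section Join

variable {V W : Type*}

/-- The join of two simplicial complexes. -/
def joinComplex (K : AbstractSimplicialComplex V) (L : AbstractSimplicialComplex W) :
    AbstractSimplicialComplex (V ⊕ W) where
  faces := {s | s.Nonempty ∧ (s.toLeft.Nonempty → s.toLeft ∈ K.faces) ∧
    (s.toRight.Nonempty → s.toRight ∈ L.faces)}
  isRelLowerSet_faces := by
    rintro s ⟨hs, hK, hL⟩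
    refine ⟨hs, fun t hts ht => ⟨ht, fun h => ?_, fun h => ?_⟩⟩
    · have h1 := Finset.toLeft_subset_toLeft hts
      exact (K.isRelLowerSet_faces (hK (h.mono h1))).2 h1 h
    · have h1 := Finset.toRight_subset_toRight hts
      exact (L.isRelLowerSet_faces (hL (h.mono h1))).2 h1 h
  singleton_mem := by
    classical
    rintro (v | w)
    · have h1 : ({Sum.inl v} : Finset (V ⊕ W)).toLeft = {v} := by ext; simp
      have h2 : ({Sum.inl v} : Finset (V ⊕ W)).toRight = ∅ := by ext; simp
      refine ⟨by simp, fun _ => ?_, fun h => ?_⟩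
      · rw [h1]; exact K.singleton_mem v
      · simp [h2] at h
    · have h1 : ({Sum.inr w} : Finset (V ⊕ W)).toLeft = ∅ := by ext; simp
      have h2 : ({Sum.inr w} : Finset (V ⊕ W)).toRight = {w} := by ext; simp
      refine ⟨by simp, fun h => ?_, fun _ => ?_⟩
      · simp [h1] at h
      · rw [h2]; exact L.singleton_mem w

/-- The pairs in the join of two complexes which project to pairs in `P` and in `P'`. -/
def joinPairs [Fintype V] [Fintype W] [DecidableEq V] [DecidableEq W] (P : Finset (Sym2 (Finset V)))
    (P' : Finset (Sym2 (Finset W))) : Finset (Sym2 (Finset (V ⊕ W))) :=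
  {r | r.map Finset.toLeft ∈ P ∧ r.map Finset.toRight ∈ P'}

end Join

/-! ### Linear dependencies and Radon partitions -/

section Radon

variable {V : Type*} {E : Type*} [AddCommGroup E] [Module ℝ E]

/-- The vertices of a pair of simplices. -/
def pairSupport (p : Sym2 (Finset V)) : Set V := {v | ∃ σ ∈ p, v ∈ σ}

theorem mem_pairSupport {σ τ : Finset V} {v : V} : v ∈ pairSupport s(σ, τ) ↔ v ∈ σ ∨ v ∈ τ := by
  simp [pairSupport]

theorem inl_mem_pairSupport {W : Type*} (r : Sym2 (Finset (V ⊕ W))) (v : V) :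
    Sum.inl v ∈ pairSupport r ↔ v ∈ pairSupport (r.map Finset.toLeft) := by
  induction r with | _ σ τ => simp [mem_pairSupport]

theorem inr_mem_pairSupport {W : Type*} (r : Sym2 (Finset (V ⊕ W))) (w : W) :
    Sum.inr w ∈ pairSupport r ↔ w ∈ pairSupport (r.map Finset.toRight) := by
  induction r with | _ σ τ => simp [mem_pairSupport]

theorem support_comp_inl_subset {W : Type*} {c : V ⊕ W → ℝ} {r : Sym2 (Finset (V ⊕ W))}
    (hs : Function.support c ⊆ pairSupport r) :
    Function.support (c ∘ Sum.inl) ⊆ pairSupport (r.map Finset.toLeft) := fun v hv =>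
  (inl_mem_pairSupport r v).1 (hs hv)

theorem support_comp_inr_subset {W : Type*} {c : V ⊕ W → ℝ} {r : Sym2 (Finset (V ⊕ W))}
    (hs : Function.support c ⊆ pairSupport r) :
    Function.support (c ∘ Sum.inr) ⊆ pairSupport (r.map Finset.toRight) := fun v hv =>
  (inr_mem_pairSupport r v).1 (hs hv)

variable [Fintype V]

open Classical in
/-- The positive and the negative support of `c`. -/
noncomputable def signPair (c : V → ℝ) : Sym2 (Finset V) :=
  s(Finset.univ.filter fun v => 0 < c v, Finset.univ.filter fun v => c v < 0)

theorem mem_pairSupport_signPair {c : V → ℝ} {v : V} : v ∈ pairSupport (signPair c) ↔ c v ≠ 0 := by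
  rw [signPair, mem_pairSupport]
  simp only [Finset.mem_filter, Finset.mem_univ, true_and]
  exact lt_or_lt_iff_ne.trans ne_comm

theorem support_subset_pairSupport_signPair (c : V → ℝ) :
    Function.support c ⊆ pairSupport (signPair c) := fun _ hv => mem_pairSupport_signPair.2 hv

theorem signPair_smul_of_pos {κ : ℝ} (hκ : 0 < κ) (c : V → ℝ) : signPair (κ • c) = signPair c := by
  simp [signPair, hκ, mul_neg_iff, hκ.not_gt]

theorem signPair_smul {κ : ℝ} (hκ : κ ≠ 0) (c : V → ℝ) : signPair (κ • c) = signPair c := by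
  rcases hκ.lt_or_gt with h | h
  · rw [signPair, signPair, Sym2.eq_swap]
    simp [h, mul_neg_iff, mul_pos_iff, h.not_gt]
  · exact signPair_smul_of_pos h c

/-- `c` is a linear dependency between the vectors `f v`. -/
def IsDependency (f : V → E) (c : V → ℝ) : Prop := ∑ v, c v • f v = 0

theorem IsDependency.smul {f : V → E} {c : V → ℝ} (h : IsDependency f c) (κ : ℝ) :
    IsDependency f (κ • c) := by
  simp only [IsDependency, Pi.smul_apply, smul_eq_mul, mul_smul, ← Finset.smul_sum]
  rw [IsDependency] at h
  rw [h, smul_zero]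

theorem IsDependency.sub {f : V → E} {c c' : V → ℝ} (h : IsDependency f c)
    (h' : IsDependency f c') : IsDependency f (c - c') := by
  simp only [IsDependency, Pi.sub_apply, sub_smul, Finset.sum_sub_distrib]
  rw [IsDependency] at h h'
  rw [h, h', sub_zero]

/-- The pair `p` is the Radon partition of a linear dependency. -/
def IsRadon (f : V → E) (p : Sym2 (Finset V)) : Prop := ∃ c, IsDependency f c ∧ signPair c = p

/-- The vectors `f v`, for `v ∈ u`, form a circuit: they are dependent, and all coefficients of
each nontrivial dependency are nonzero. -/
structure IsCircuit (f : V → E) (u : Set V) : Prop where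
  exists_dependency : ∃ c, c ≠ 0 ∧ IsDependency f c ∧ Function.support c ⊆ u
  ne_zero : ∀ c, c ≠ 0 → IsDependency f c → Function.support c ⊆ u → ∀ v ∈ u, c v ≠ 0

theorem IsCircuit.exists_smul_eq {f : V → E} {u : Set V} (hu : IsCircuit f u) {c c' : V → ℝ}
    (hc : c ≠ 0) (hc' : c' ≠ 0) (hf : IsDependency f c) (hf' : IsDependency f c')
    (hs : Function.support c ⊆ u) (hs' : Function.support c' ⊆ u) : ∃ κ : ℝ, κ ≠ 0 ∧ c' = κ • c := by
  obtain ⟨v, hv⟩ := Function.ne_iff.1 hc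
  have hvu : v ∈ u := hs hv
  have hcv : c v ≠ 0 := hv
  have hcv' := hu.ne_zero c' hc' hf' hs' v hvu
  refine ⟨c' v / c v, div_ne_zero hcv' hcv, ?_⟩
  by_contra hne
  have h1 := hu.ne_zero (c' - (c' v / c v) • c) (sub_ne_zero.2 hne) (hf'.sub (hf.smul _)) ?_ v hvu
  · apply h1
    simp [hcv]
  · intro w hw
    by_contra hwu
    have h2 : c w = 0 := by
      by_contra h; exact hwu (hs h)
    have h3 : c' w = 0 := by
      by_contra h; exact hwu (hs' h)
    simp [h2, h3] at hw

/-- The vectors `f v` exhibit the set `P` of pairs of (possibly empty) simplices of `K` with `N`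
vertices altogether as a cycle with nontrivial van Kampen obstruction. -/
structure IsLinearObstructor [DecidableEq V] (K : AbstractSimplicialComplex V) (N : ℕ)
    (P : Finset (Sym2 (Finset V))) (f : V → E) : Prop where
  mem_faces : ∀ σ τ, s(σ, τ) ∈ P → σ.Nonempty → σ ∈ K.faces
  disjoint : ∀ σ τ, s(σ, τ) ∈ P → Disjoint σ τ
  card_add : ∀ σ τ, s(σ, τ) ∈ P → σ.card + τ.card = N
  cycle : ∀ ρ τ : Finset V, ρ.card + τ.card + 1 = N →
    Even (∑ v, ((if s(insert v ρ, τ) ∈ P then 1 else 0) + if s(ρ, insert v τ) ∈ P then 1 else 0))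
  circuit : ∀ p ∈ P, IsCircuit f (pairSupport p)
  odd : Odd {p | p ∈ P ∧ IsRadon f p}.ncard

/-- The heights `h` are nonzero on the nontrivial dependencies of the pairs in `P`. -/
def IsGenericHeight (P : Finset (Sym2 (Finset V))) (f : V → E) (h : V → ℝ) : Prop :=
  ∀ p ∈ P, ∀ c, c ≠ 0 → IsDependency f c → Function.support c ⊆ pairSupport p → ∑ v, c v * h v ≠ 0

end Radon

/-! ### Radon partitions and cycles in joins -/

section JoinObstructor

variable {V W : Type*} [Fintype V] [Fintype W] {E E' : Type*} [AddCommGroup E] [Module ℝ E]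
  [AddCommGroup E'] [Module ℝ E']

/-- The vectors for the join of two complexes. -/
def joinVec (f : V → E) (g : W → E') (h : V → ℝ) (h' : W → ℝ) : V ⊕ W → E × E' × ℝ :=
  Sum.elim (fun v => (f v, 0, h v)) (fun w => (0, g w, h' w))

theorem isDependency_joinVec {f : V → E} {g : W → E'} {h : V → ℝ} {h' : W → ℝ} {c : V ⊕ W → ℝ} :
    IsDependency (joinVec f g h h') c ↔ IsDependency f (c ∘ Sum.inl) ∧ IsDependency g (c ∘ Sum.inr) ∧
      ∑ v, c (.inl v) * h v + ∑ w, c (.inr w) * h' w = 0 := by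
  simp only [IsDependency, joinVec, Fintype.sum_sum_type, Prod.ext_iff, Prod.fst_add, Prod.snd_add,
    Prod.fst_sum, Prod.snd_sum, Sum.elim_inl, Sum.elim_inr, Prod.smul_mk, smul_zero,
    Finset.sum_const_zero, add_zero, zero_add, Prod.fst_zero, Prod.snd_zero, smul_eq_mul,
    Function.comp_apply]

theorem signPair_map_toLeft (c : V ⊕ W → ℝ) :
    (signPair c).map Finset.toLeft = signPair (c ∘ Sum.inl) := by
  simp only [signPair, Sym2.map_mk]
  congr 2 <;> ext v <;> simp

theorem signPair_map_toRight (c : V ⊕ W → ℝ) :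
    (signPair c).map Finset.toRight = signPair (c ∘ Sum.inr) := by
  simp only [signPair, Sym2.map_mk]
  congr 2 <;> ext v <;> simp

variable [DecidableEq V] [DecidableEq W]

theorem mem_joinPairs {P : Finset (Sym2 (Finset V))} {P' : Finset (Sym2 (Finset W))}
    {r : Sym2 (Finset (V ⊕ W))} :
    r ∈ joinPairs P P' ↔ r.map Finset.toLeft ∈ P ∧ r.map Finset.toRight ∈ P' := by
  simp [joinPairs]

/-- A dependency of the joined vectors is a pair of dependencies whose heights cancel. Generic
heights prevent either part from vanishing alone, and a nontrivial dependency of a circuit has no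
zero coefficient. -/
theorem isCircuit_joinVec {P : Finset (Sym2 (Finset V))} {P' : Finset (Sym2 (Finset W))}
    {f : V → E} {g : W → E'} {h : V → ℝ} {h' : W → ℝ} (hP : ∀ p ∈ P, IsCircuit f (pairSupport p))
    (hP' : ∀ p ∈ P', IsCircuit g (pairSupport p)) (hh : IsGenericHeight P f h)
    (hh' : IsGenericHeight P' g h') {r : Sym2 (Finset (V ⊕ W))} (hr : r ∈ joinPairs P P') :
    IsCircuit (joinVec f g h h') (pairSupport r) := by
  obtain ⟨hr1, hr2⟩ := mem_joinPairs.1 hr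
  constructor
  · obtain ⟨a, ha0, haf, has⟩ := (hP _ hr1).exists_dependency
    obtain ⟨b, hb0, hbf, hbs⟩ := (hP' _ hr2).exists_dependency
    have hha := hh _ hr1 a ha0 haf has
    have hhb := hh' _ hr2 b hb0 hbf hbs
    -- Each dependency is scaled by the height of the other one, with opposite signs, so that the
    -- total height vanishes.
    refine ⟨Sum.elim ((∑ w, b w * h' w) • a) ((-∑ v, a v * h v) • b), ?_, ?_, ?_⟩
    · intro h0
      apply ha0
      funext v
      have := congrFun h0 (.inl v)
      simpa [hhb] using this
    · rw [isDependency_joinVec]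
      refine ⟨haf.smul _, hbf.smul _, ?_⟩
      simp only [Sum.elim_inl, Sum.elim_inr, Pi.smul_apply, smul_eq_mul, mul_assoc,
        ← Finset.mul_sum]
      ring
    · rintro (v | w) hv
      · rw [inl_mem_pairSupport]
        exact has (right_ne_zero_of_mul hv)
      · rw [inr_mem_pairSupport]
        exact hbs (right_ne_zero_of_mul hv)
  · intro c hc0 hc hcs
    obtain ⟨h1, h2, h3⟩ := isDependency_joinVec.1 hc
    have hl := support_comp_inl_subset hcs
    have hr := support_comp_inr_subset hcs
    have key : c ∘ Sum.inl ≠ 0 ∧ c ∘ Sum.inr ≠ 0 := by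
      by_cases hx : c ∘ Sum.inl = 0
      · by_cases hy : c ∘ Sum.inr = 0
        · exact absurd (funext fun x => by
            rcases x with v | w
            · exact congrFun hx v
            · exact congrFun hy w) hc0
        · refine absurd ?_ (hh' _ hr2 _ hy h2 hr)
          have h4 : ∑ v, c (.inl v) * h v = 0 :=
            Finset.sum_eq_zero fun v _ => by rw [show c (.inl v) = 0 from congrFun hx v, zero_mul]
          rwa [h4, zero_add] at h3
      · refine ⟨hx, fun hy => hh _ hr1 _ hx h1 hl ?_⟩
        have h4 : ∑ w, c (.inr w) * h' w = 0 :=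
          Finset.sum_eq_zero fun v _ => by rw [show c (.inr v) = 0 from congrFun hy v, zero_mul]
        rwa [h4, add_zero] at h3
    rintro (v | w) hv
    · exact (hP _ hr1).ne_zero _ key.1 h1 hl v ((inl_mem_pairSupport r v).1 hv)
    · exact (hP' _ hr2).ne_zero _ key.2 h2 hr w ((inr_mem_pairSupport r w).1 hv)

/-- A pair `{σ, τ}` in `P` and a pair `{σ', τ'}` in `P'` have two lifts, matching `σ` with `σ'` or
with `τ'`. If both are Radon, the vanishing of the total height fixes the relative sign of the two
dependencies, so exactly one of the lifts is Radon. -/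
theorem ncard_isRadon_joinVec {P : Finset (Sym2 (Finset V))} {P' : Finset (Sym2 (Finset W))}
    {f : V → E} {g : W → E'} {h : V → ℝ} {h' : W → ℝ} (hP : ∀ p ∈ P, IsCircuit f (pairSupport p))
    (hP' : ∀ p ∈ P', IsCircuit g (pairSupport p)) (hh : IsGenericHeight P f h)
    (hh' : IsGenericHeight P' g h') :
    {r | r ∈ joinPairs P P' ∧ IsRadon (joinVec f g h h') r}.ncard =
      {p | p ∈ P ∧ IsRadon f p}.ncard * {p | p ∈ P' ∧ IsRadon g p}.ncard := by
  have hne : ∀ p ∈ P, ∀ c : V → ℝ, signPair c = p → c ≠ 0 := by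
    rintro p hp c rfl rfl
    obtain ⟨c, hc0, -, hcs⟩ := (hP _ hp).exists_dependency
    obtain ⟨v, hv⟩ := Function.ne_iff.1 hc0
    exact mem_pairSupport_signPair.1 (hcs hv) rfl
  have hne' : ∀ p ∈ P', ∀ c : W → ℝ, signPair c = p → c ≠ 0 := by
    rintro p hp c rfl rfl
    obtain ⟨c, hc0, -, hcs⟩ := (hP' _ hp).exists_dependency
    obtain ⟨v, hv⟩ := Function.ne_iff.1 hc0
    exact mem_pairSupport_signPair.1 (hcs hv) rfl
  rw [← Set.ncard_prod]
  refine Set.ncard_congr (fun r _ => (r.map Finset.toLeft, r.map Finset.toRight)) ?_ ?_ ?_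
  · rintro r ⟨hr, c, hc, rfl⟩
    obtain ⟨hr1, hr2⟩ := mem_joinPairs.1 hr
    obtain ⟨h1, h2, -⟩ := isDependency_joinVec.1 hc
    exact ⟨⟨hr1, _, h1, (signPair_map_toLeft c).symm⟩, ⟨hr2, _, h2, (signPair_map_toRight c).symm⟩⟩
  · rintro r r' ⟨hr, c, hc, rfl⟩ ⟨hr', c', hc', rfl⟩ heq
    obtain ⟨hr1, hr2⟩ := mem_joinPairs.1 hr
    obtain ⟨hr1', hr2'⟩ := mem_joinPairs.1 hr'
    obtain ⟨h1, h2, h3⟩ := isDependency_joinVec.1 hc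
    obtain ⟨h1', h2', h3'⟩ := isDependency_joinVec.1 hc'
    simp only [Prod.mk.injEq, signPair_map_toLeft, signPair_map_toRight] at heq hr1 hr2 hr1' hr2'
    obtain ⟨α, hα, hcα⟩ := (hP _ hr1).exists_smul_eq (hne _ hr1 _ rfl) (hne _ hr1' _ rfl) h1 h1'
      (support_subset_pairSupport_signPair _) (heq.1 ▸ support_subset_pairSupport_signPair _)
    obtain ⟨β, hβ, hcβ⟩ := (hP' _ hr2).exists_smul_eq (hne' _ hr2 _ rfl) (hne' _ hr2' _ rfl) h2 h2'
      (support_subset_pairSupport_signPair _) (heq.2 ▸ support_subset_pairSupport_signPair _)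
    have hA := hh _ hr1 _ (hne _ hr1 _ rfl) h1 (support_subset_pairSupport_signPair _)
    have hcα' : ∀ v, c' (.inl v) = α * c (.inl v) := fun v => congrFun hcα v
    have hcβ' : ∀ v, c' (.inr v) = β * c (.inr v) := fun v => congrFun hcβ v
    simp only [hcα', hcβ', mul_assoc, ← Finset.mul_sum] at h3'
    simp only [Function.comp_apply] at hA
    -- The two scaling factors agree since both dependencies have total height zero and the height
    -- of the first part is nonzero.
    have hαβ : α = β := by
      have : (α - β) * ∑ v, c (.inl v) * h v = 0 := by linear_combination h3' - β * h3
      simpa [hA, sub_eq_zero] using this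
    subst hαβ
    have : c' = α • c := by
      funext x
      rcases x with v | w
      · exact hcα' v
      · exact hcβ' w
    rw [this, signPair_smul hα]
  · rintro ⟨p, q⟩ ⟨⟨hp, a, ha, rfl⟩, ⟨hq, b, hb, rfl⟩⟩
    have hA := hh _ hp a (hne _ hp _ rfl) ha (support_subset_pairSupport_signPair _)
    have hB := hh' _ hq b (hne' _ hq _ rfl) hb (support_subset_pairSupport_signPair _)
    set c : V ⊕ W → ℝ := Sum.elim ((∑ w, b w * h' w) • a) ((-∑ v, a v * h v) • b) with hc
    have h1 : signPair (c ∘ Sum.inl) = signPair a := signPair_smul hB a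
    have h2 : signPair (c ∘ Sum.inr) = signPair b := signPair_smul (neg_ne_zero.2 hA) b
    rw [← signPair_map_toLeft] at h1
    rw [← signPair_map_toRight] at h2
    refine ⟨signPair c, ⟨?_, c, ?_, rfl⟩, by rw [h1, h2]⟩
    · rw [mem_joinPairs, h1, h2]
      exact ⟨hp, hq⟩
    · rw [isDependency_joinVec]
      refine ⟨ha.smul _, hb.smul _, ?_⟩
      simp only [hc, Sum.elim_inl, Sum.elim_inr, Pi.smul_apply, smul_eq_mul, mul_assoc,
        ← Finset.mul_sum]
      ring

theorem IsLinearObstructor.join {K : AbstractSimplicialComplex V} {L : AbstractSimplicialComplex W}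
    {N N' : ℕ} {P : Finset (Sym2 (Finset V))} {P' : Finset (Sym2 (Finset W))}
    {f : V → E} {g : W → E'} (hP : IsLinearObstructor K N P f) (hP' : IsLinearObstructor L N' P' g)
    {h : V → ℝ} {h' : W → ℝ} (hh : IsGenericHeight P f h) (hh' : IsGenericHeight P' g h') :
    IsLinearObstructor (joinComplex K L) (N + N') (joinPairs P P') (joinVec f g h h') where
  mem_faces := by
    intro σ τ hr hσ
    obtain ⟨h1, h2⟩ := mem_joinPairs.1 hr
    rw [Sym2.map_mk] at h1 h2
    exact ⟨hσ, hP.mem_faces _ _ h1, hP'.mem_faces _ _ h2⟩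
  disjoint := by
    intro σ τ hr
    obtain ⟨h1, h2⟩ := mem_joinPairs.1 hr
    rw [Sym2.map_mk] at h1 h2
    have h3 := Finset.disjoint_left.1 (hP.disjoint _ _ h1)
    have h4 := Finset.disjoint_left.1 (hP'.disjoint _ _ h2)
    rw [Finset.disjoint_left]
    rintro (v | w) hv hv'
    · exact h3 (Finset.mem_toLeft.2 hv) (Finset.mem_toLeft.2 hv')
    · exact h4 (Finset.mem_toRight.2 hv) (Finset.mem_toRight.2 hv')
  card_add := by
    intro σ τ hr
    obtain ⟨h1, h2⟩ := mem_joinPairs.1 hr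
    rw [Sym2.map_mk] at h1 h2
    have h3 := hP.card_add _ _ h1
    have h4 := hP'.card_add _ _ h2
    have h5 := Finset.card_toLeft_add_card_toRight (u := σ)
    have h6 := Finset.card_toLeft_add_card_toRight (u := τ)
    omega
  cycle := by
    intro A B hAB
    have h5 := Finset.card_toLeft_add_card_toRight (u := A)
    have h6 := Finset.card_toLeft_add_card_toRight (u := B)
    rw [Fintype.sum_sum_type]
    simp only [mem_joinPairs, Sym2.map_mk, Finset.toLeft_insert_inl, Finset.toLeft_insert_inr,
      Finset.toRight_insert_inl, Finset.toRight_insert_inr]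
    -- Adding a vertex of `V` changes only the left pair. Hence the sum over `V` vanishes unless the
    -- right pair lies in `P'`, and then it is a cycle sum for `P`; the sum over `W` is symmetric.
    refine Even.add ?_ ?_
    · by_cases hq : s(A.toRight, B.toRight) ∈ P'
      · have := hP'.card_add _ _ hq
        simpa [hq] using hP.cycle A.toLeft B.toLeft (by omega)
      · simp [hq]
    · by_cases hq : s(A.toLeft, B.toLeft) ∈ P
      · have := hP.card_add _ _ hq
        simpa [hq] using hP'.cycle A.toRight B.toRight (by omega)
      · simp [hq]
  circuit := fun r hr => isCircuit_joinVec hP.circuit hP'.circuit hh hh' hr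
  odd := by
    rw [ncard_isRadon_joinVec hP.circuit hP'.circuit hh hh']
    exact hP.odd.mul hP'.odd

end JoinObstructor

/-! ### General position -/

section GeneralPosition

variable {V : Type*} [Fintype V] {E : Type*} [AddCommGroup E] [Module ℝ E]

/-- At most `n` of the vectors `f v` are always linearly independent. -/
def LinearGeneralPosition (n : ℕ) (f : V → E) : Prop :=
  ∀ s : Finset V, s.card ≤ n → ∀ c, IsDependency f c → Function.support c ⊆ s → c = 0

theorem sum_eq_sum_of_support {M : Type*} [AddCommMonoid M] {s : Finset V} {F : V → M}
    (h : ∀ v ∉ s, F v = 0) : ∑ v, F v = ∑ v ∈ s, F v :=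
  (Finset.sum_subset (Finset.subset_univ s) fun v _ hv => h v hv).symm

theorem affineIndependent_iff_of_finset {m : ℕ} {f : V → Fin m → ℝ} {s : Finset V} :
    AffineIndependent ℝ (fun v : s => f v) ↔
      ∀ c : V → ℝ, ∑ v, c v = 0 → ∑ v, c v • f v = 0 → Function.support c ⊆ s → c = 0 := by
  classical
  rw [affineIndependent_iff]
  constructor
  · intro h c hc hcf hcs
    have hz : ∀ v ∉ s, c v = 0 := fun v hv => by
      by_contra hne; exact hv (hcs hne)
    rw [sum_eq_sum_of_support hz] at hc
    rw [sum_eq_sum_of_support (s := s) fun v hv => by rw [hz v hv, zero_smul]] at hcf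
    have := h Finset.univ (fun v => c v) (by rw [← hc]; exact Finset.sum_coe_sort s c)
      (by rw [← hcf]; exact Finset.sum_coe_sort s fun v => c v • f v)
    funext v
    by_cases hv : v ∈ s
    · exact this ⟨v, hv⟩ (Finset.mem_univ _)
    · exact hz v hv
  · intro h t w hw hwf v hv
    set c : V → ℝ := fun v => if hv : v ∈ s then if (⟨v, hv⟩ : s) ∈ t then w ⟨v, hv⟩ else 0 else 0
      with hc
    have hz : ∀ v ∉ s, c v = 0 := fun v hv => by simp [hc, hv]
    have hcv : ∀ v : s, c v = if v ∈ t then w v else 0 := fun v => by simp [hc]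
    have h0 := h c ?_ ?_ ?_
    · have := congrFun h0 v
      rwa [hcv, if_pos hv] at this
    · rw [sum_eq_sum_of_support hz, ← Finset.sum_coe_sort]
      simp only [hcv, Finset.sum_ite_mem, Finset.univ_inter]
      exact hw
    · rw [sum_eq_sum_of_support (s := s) fun v hv => by rw [hz v hv, zero_smul],
        ← Finset.sum_coe_sort]
      simp only [hcv, ite_smul, zero_smul, Finset.sum_ite_mem, Finset.univ_inter]
      exact hwf
    · intro v hv
      by_contra hvs
      exact hv (hz v hvs)

theorem isDependency_one_prod {m : ℕ} {f : V → Fin m → ℝ} {c : V → ℝ} :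
    IsDependency (fun v => ((1 : ℝ), f v)) c ↔ ∑ v, c v = 0 ∧ ∑ v, c v • f v = 0 := by
  simp [IsDependency, Prod.ext_iff, Prod.fst_sum, Prod.snd_sum]

theorem generalPosition_iff {m : ℕ} {f : V → Fin m → ℝ} :
    GeneralPosition m f ↔ LinearGeneralPosition (m + 1) (fun v => ((1 : ℝ), f v)) := by
  simp only [GeneralPosition, LinearGeneralPosition, affineIndependent_iff_of_finset,
    isDependency_one_prod, and_imp]

theorem exists_dependency_of_finrank_lt_card [FiniteDimensional ℝ E] (f : V → E) {s : Finset V}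
    (hs : Module.finrank ℝ E < s.card) :
    ∃ c, c ≠ 0 ∧ IsDependency f c ∧ Function.support c ⊆ (s : Set V) := by
  classical
  have h : ¬ LinearIndependent ℝ (fun v : s => f v) := fun h => by
    have := h.fintype_card_le_finrank
    rw [Fintype.card_coe] at this
    omega
  obtain ⟨g, hg, v, hv⟩ := Fintype.not_linearIndependent_iff.1 h
  set c : V → ℝ := fun v => if hv : v ∈ s then g ⟨v, hv⟩ else 0 with hc
  have hz : ∀ v ∉ s, c v = 0 := fun v hv => by simp [hc, hv]
  have hcv : ∀ v : s, c v = g v := fun v => by simp [hc]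
  refine ⟨c, fun h0 => hv ?_, ?_, fun v hv => ?_⟩
  · rw [← hcv, h0]; rfl
  · rw [IsDependency, sum_eq_sum_of_support (s := s) fun v hv => by rw [hz v hv, zero_smul],
      ← Finset.sum_coe_sort]
    simpa [hcv] using hg
  · by_contra hvs
    exact hv (hz v hvs)

theorem LinearGeneralPosition.isCircuit [FiniteDimensional ℝ E] {n : ℕ} {f : V → E}
    (hf : LinearGeneralPosition n f) (hn : Module.finrank ℝ E ≤ n) {s : Finset V}
    (hs : s.card = n + 1) : IsCircuit f (s : Set V) where
  exists_dependency := exists_dependency_of_finrank_lt_card f (by omega)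
  ne_zero := by
    classical
    intro c hc0 hc hcs v hv hcv
    refine hc0 (hf (s.erase v) ?_ c hc fun w hw => ?_)
    · rw [Finset.card_erase_of_mem (by simpa using hv)]
      omega
    · rw [Finset.coe_erase]
      exact ⟨hcs hw, fun h => hw (by rw [h, hcv])⟩

/-- The moment curve. -/
def momentCurve (m : ℕ) (t : ℝ) : Fin (m + 1) → ℝ := fun j => t ^ (j : ℕ)

/-- Pair the dependency with the polynomial of degree at most `m` which vanishes at all the
parameters of `s` but one: only the remaining coefficient survives, so it is zero. -/
theorem linearGeneralPosition_momentCurve (m : ℕ) {t : V → ℝ} (ht : Function.Injective t) :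
    LinearGeneralPosition (m + 1) fun v => momentCurve m (t v) := by
  classical
  intro s hs c hc hcs
  by_contra hne
  obtain ⟨v₀, hv₀⟩ := Function.ne_iff.1 hne
  have hv₀s : v₀ ∈ s := hcs hv₀
  set p : Polynomial ℝ := ∏ w ∈ s.erase v₀, (Polynomial.X - Polynomial.C (t w)) with hp
  have hdeg : p.natDegree < m + 1 := by
    rw [hp, Polynomial.natDegree_prod_of_monic _ _ fun w _ => Polynomial.monic_X_sub_C _]
    simp only [Polynomial.natDegree_X_sub_C, Finset.sum_const, smul_eq_mul, mul_one]
    rw [Finset.card_erase_of_mem hv₀s]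
    have := Finset.card_pos.2 ⟨v₀, hv₀s⟩
    omega
  have h1 : ∑ v, c v * p.eval (t v) = 0 := by
    simp only [Polynomial.eval_eq_sum_range' hdeg, Finset.mul_sum]
    rw [Finset.sum_comm]
    refine Finset.sum_eq_zero fun j hj => ?_
    have h2 := congrFun hc ⟨j, Finset.mem_range.1 hj⟩
    simp only [Finset.sum_apply, Pi.smul_apply, momentCurve, smul_eq_mul, Pi.zero_apply] at h2
    calc ∑ v, c v * (p.coeff j * t v ^ j) = p.coeff j * ∑ v, c v * t v ^ j := by
          rw [Finset.mul_sum]; exact Finset.sum_congr rfl fun _ _ => by ring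
      _ = 0 := by rw [h2, mul_zero]
  rw [Finset.sum_eq_single v₀] at h1
  · rcases mul_eq_zero.1 h1 with h | h
    · exact hv₀ h
    · rw [hp, Polynomial.eval_prod, Finset.prod_eq_zero_iff] at h
      obtain ⟨w, hw, hw0⟩ := h
      simp only [Polynomial.eval_sub, Polynomial.eval_X, Polynomial.eval_C, sub_eq_zero] at hw0
      exact (Finset.mem_erase.1 hw).1 (ht hw0).symm
  · intro w _ hw
    by_cases hws : w ∈ s
    · rw [hp, Polynomial.eval_prod, Finset.prod_eq_zero (Finset.mem_erase.2 ⟨hw, hws⟩) (by simp),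
        mul_zero]
    · rw [show c w = 0 by by_contra h; exact hws (hcs h), zero_mul]
  · simp

theorem exists_linearGeneralPosition [FiniteDimensional ℝ E] {m : ℕ}
    (hm : Module.finrank ℝ E = m + 1) : ∃ g : V → E, LinearGeneralPosition (m + 1) g := by
  have e : (Fin (m + 1) → ℝ) ≃ₗ[ℝ] E := LinearEquiv.ofFinrankEq _ _ (by simp [hm])
  obtain ⟨t⟩ : Nonempty (V ↪ ℝ) :=
    ⟨(Fintype.equivFin V).toEmbedding.trans (Fin.valEmbedding.trans Nat.castEmbedding)⟩
  refine ⟨fun v => e (momentCurve m (t v)), fun s hs c hc hcs =>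
    linearGeneralPosition_momentCurve m t.injective s hs c ?_ hcs⟩
  apply e.injective
  simpa [IsDependency, map_sum] using hc

end GeneralPosition

/-! ### Perturbations -/

section Perturbation

open Filter Topology

variable {V : Type*} [Fintype V] {E : Type*} [NormedAddCommGroup E] [NormedSpace ℝ E]

/-- For fixed `s`, the vectors of `g` define an injective linear map `A g` with left inverse `B`. A
dependency `c` of `f + ε g` satisfies `A f c = -ε A g c`, so `-ε` is an eigenvalue of `B ∘ A f`;
only finitely many `ε` are excluded. -/
theorem eventually_linearGeneralPosition {n : ℕ} (f : V → E) {g : V → E}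
    (hg : LinearGeneralPosition n g) :
    ∀ᶠ ε in 𝓝[≠] (0 : ℝ), LinearGeneralPosition n (f + ε • g) := by
  classical
  have key : ∀ s : Finset V, s.card ≤ n → ∀ᶠ ε in 𝓝[≠] (0 : ℝ),
      ∀ c, IsDependency (f + ε • g) c → Function.support c ⊆ s → c = 0 := by
    intro s hs
    let W : Submodule ℝ (V → ℝ) :=
      { carrier := {c | Function.support c ⊆ s}
        add_mem' := fun ha hb => (Function.support_add _ _).trans (Set.union_subset ha hb)
        zero_mem' := by simp
        smul_mem' := fun k a ha => (Function.support_const_smul_subset k a).trans ha }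
    let A : (V → E) → W →ₗ[ℝ] E := fun f => (Fintype.linearCombination ℝ f).comp W.subtype
    have hA : ∀ f c, A f c = ∑ v, (c : V → ℝ) v • f v := fun f c => by
      simp [A, Fintype.linearCombination_apply]
    have hinj : LinearMap.ker (A g) = ⊥ := by
      rw [LinearMap.ker_eq_bot']
      intro c hc
      exact Subtype.ext (hg s hs c (by rw [IsDependency, ← hA]; exact hc) c.2)
    obtain ⟨B, hB⟩ := (A g).exists_leftInverse_of_injective hinj
    have hfin : {μ : ℝ | Module.End.HasEigenvalue (B.comp (A f)) μ}.Finite :=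
      Module.End.finite_hasEigenvalue _
    have hfin' : ({ε : ℝ | Module.End.HasEigenvalue (B.comp (A f)) (-ε)} \ {0}).Finite :=
      (hfin.preimage neg_injective.injOn).subset Set.sdiff_subset
    have h1 : ∀ᶠ ε in 𝓝 (0 : ℝ), ε ∉ {ε : ℝ | Module.End.HasEigenvalue (B.comp (A f)) (-ε)} \ {0} :=
      hfin'.isClosed.isOpen_compl.mem_nhds (by simp)
    filter_upwards [eventually_nhdsWithin_of_eventually_nhds h1, self_mem_nhdsWithin] with ε hε hε0
    intro c hc hcs
    by_contra hne
    refine hε ⟨?_, hε0⟩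
    have hc' : A f ⟨c, hcs⟩ = -ε • A g ⟨c, hcs⟩ := by
      rw [IsDependency] at hc
      simp only [Pi.add_apply, Pi.smul_apply, smul_add, Finset.sum_add_distrib] at hc
      rw [hA, hA, eq_comm, ← sub_eq_zero, ← neg_eq_zero, ← hc, neg_smul, Finset.smul_sum]
      simp only [smul_comm ε]
      abel
    refine Module.End.hasEigenvalue_of_hasEigenvector (x := ⟨c, hcs⟩)
      ⟨Module.End.mem_eigenspace_iff.2 ?_, fun h => hne (congrArg Subtype.val h)⟩
    rw [LinearMap.comp_apply, hc', map_smul]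
    congr 1
    exact LinearMap.congr_fun hB _
  have h2 : ∀ᶠ ε in 𝓝[≠] (0 : ℝ), ∀ s : Finset V, s.card ≤ n →
      ∀ c, IsDependency (f + ε • g) c → Function.support c ⊆ s → c = 0 :=
    eventually_all.2 fun s => by
      by_cases hs : s.card ≤ n
      · filter_upwards [key s hs] with ε hε _ using hε
      · exact Eventually.of_forall fun _ h => absurd h hs
  exact h2

theorem signPair_eq_of_mul_pos {c c' : V → ℝ} {u : Set V} (hc : Function.support c ⊆ u)
    (hc' : Function.support c' ⊆ u) (h : ∀ v ∈ u, 0 < c v * c' v) : signPair c = signPair c' := by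
  have h1 : ∀ v, (0 < c v ↔ 0 < c' v) ∧ (c v < 0 ↔ c' v < 0) := by
    intro v
    by_cases hv : v ∈ u
    · rcases mul_pos_iff.1 (h v hv) with ⟨h1, h2⟩ | ⟨h1, h2⟩
      · exact ⟨iff_of_true h1 h2, iff_of_false h1.not_gt h2.not_gt⟩
      · exact ⟨iff_of_false h1.not_gt h2.not_gt, iff_of_true h1 h2⟩
    · have e1 : c v = 0 := by by_contra hh; exact hv (hc hh)
      have e2 : c' v = 0 := by by_contra hh; exact hv (hc' hh)
      simp [e1, e2]
  rw [signPair, signPair]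
  simp only [h1]

/-- All coefficients of the dependency of a circuit are nonzero, so their signs survive small
perturbations; compactness of the unit sphere makes this uniform over the normalized dependencies.
The dimension count guarantees that the perturbed vectors are still dependent. -/
theorem eventually_isRadon_iff [FiniteDimensional ℝ E] {f : V → E} (g : V → E) {p : Sym2 (Finset V)}
    (hp : IsCircuit f (pairSupport p))
    (hdim : ∃ s : Finset V, (s : Set V) = pairSupport p ∧ Module.finrank ℝ E < s.card) :
    ∀ᶠ ε in 𝓝 (0 : ℝ), (IsRadon (f + ε • g) p ↔ IsRadon f p) := by
  obtain ⟨s, hs, hcard⟩ := hdim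
  obtain ⟨c₀, hc₀, hf₀, hs₀⟩ := hp.exists_dependency
  have hne₀ := hp.ne_zero c₀ hc₀ hf₀ hs₀
  set u := pairSupport p with hu
  have hK : IsCompact {c : V → ℝ | c ∈ Metric.sphere 0 1 ∧ ∀ v ∉ u, c v = 0} := by
    have h : {c : V → ℝ | ∀ v ∉ u, c v = 0} = ⋂ v, ⋂ (_ : v ∉ u), {c | c v = 0} := by
      ext; simp
    refine (isCompact_sphere (0 : V → ℝ) 1).inter_right (t := {c | ∀ v ∉ u, c v = 0}) ?_
    rw [h]
    exact isClosed_iInter fun v => isClosed_iInter fun _ =>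
      isClosed_eq (continuous_apply v) continuous_const
  have hcont : Continuous fun z : ℝ × (V → ℝ) => ∑ v, z.2 v • (f + z.1 • g) v := by
    refine continuous_finsetSum _ fun v _ => ?_
    simp only [Pi.add_apply, Pi.smul_apply]
    fun_prop
  have h1 : ∀ᶠ ε in 𝓝 (0 : ℝ), ∀ c ∈ {c : V → ℝ | c ∈ Metric.sphere 0 1 ∧ ∀ v ∉ u, c v = 0},
      IsDependency (f + ε • g) c → (∀ v ∈ u, 0 < c v * c₀ v) ∨ (∀ v ∈ u, 0 < c v * -c₀ v) := by
    refine hK.eventually_forall_of_forall_eventually fun c ⟨hc1, hcu⟩ => ?_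
    have hcs : Function.support c ⊆ u := fun v hv => by by_contra h; exact hv (hcu v h)
    have hc0 : c ≠ 0 := by rintro rfl; simp at hc1
    by_cases hcf : IsDependency f c
    · obtain ⟨κ, hκ, rfl⟩ := hp.exists_smul_eq hc₀ hc0 hf₀ hcf hs₀ hcs
      have hcv : ∀ v, Continuous fun z : ℝ × (V → ℝ) => z.2 v := fun v => by fun_prop
      rcases hκ.lt_or_gt with h | h
      · have : ∀ᶠ z : ℝ × (V → ℝ) in 𝓝 (0, κ • c₀), ∀ v, v ∈ u → 0 < z.2 v * -c₀ v := by
          refine eventually_all.2 fun v => ?_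
          by_cases hv : v ∈ u
          · have h2 : 0 < (κ • c₀) v * -c₀ v := by
              simp only [Pi.smul_apply, smul_eq_mul]
              nlinarith [mul_pos (neg_pos.2 h) (sq_pos_of_ne_zero (hne₀ v hv))]
            filter_upwards [(((hcv v).mul continuous_const).tendsto (0, κ • c₀)).eventually_const_lt h2]
              with z hz _ using hz
          · exact Eventually.of_forall fun _ h => absurd h hv
        filter_upwards [this] with z hz _ using Or.inr hz
      · have : ∀ᶠ z : ℝ × (V → ℝ) in 𝓝 (0, κ • c₀), ∀ v, v ∈ u → 0 < z.2 v * c₀ v := by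
          refine eventually_all.2 fun v => ?_
          by_cases hv : v ∈ u
          · have h2 : 0 < (κ • c₀) v * c₀ v := by
              simp only [Pi.smul_apply, smul_eq_mul]
              nlinarith [mul_pos h (sq_pos_of_ne_zero (hne₀ v hv))]
            filter_upwards [(((hcv v).mul continuous_const).tendsto (0, κ • c₀)).eventually_const_lt h2]
              with z hz _ using hz
          · exact Eventually.of_forall fun _ h => absurd h hv
        filter_upwards [this] with z hz _ using Or.inl hz
    · have h2 : ∑ v, c v • (f + (0 : ℝ) • g) v ≠ 0 := by simpa [IsDependency] using hcf
      filter_upwards [(hcont.tendsto (0, c)).eventually_ne h2] with z hz hz'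
      exact absurd hz' hz
  filter_upwards [h1] with ε hε
  have key : ∀ c, c ≠ 0 → IsDependency (f + ε • g) c → Function.support c ⊆ u →
      signPair c = signPair c₀ := by
    intro c hc hcd hcs
    have hn : (0 : ℝ) < ‖c‖⁻¹ := inv_pos.2 (norm_pos_iff.2 hc)
    rw [← signPair_smul_of_pos hn c]
    have hsupp : Function.support (‖c‖⁻¹ • c) ⊆ u :=
      (Function.support_const_smul_subset _ _).trans hcs
    have hz : ∀ v ∉ u, (‖c‖⁻¹ • c) v = 0 := fun v hv => by by_contra h; exact hv (hsupp h)
    rcases hε (‖c‖⁻¹ • c) ⟨by simp [norm_smul, norm_ne_zero_iff.2 hc], hz⟩ (hcd.smul _) with h | h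
    · exact signPair_eq_of_mul_pos hsupp hs₀ h
    · rw [← signPair_smul (κ := -1) (by norm_num) c₀]
      refine signPair_eq_of_mul_pos hsupp ((Function.support_const_smul_subset _ _).trans hs₀) ?_
      simpa using h
  have hne : ∀ c, signPair c = p → c ≠ 0 ∧ Function.support c ⊆ u := by
    rintro c rfl
    refine ⟨?_, support_subset_pairSupport_signPair c⟩
    rintro rfl
    obtain ⟨v, hv⟩ := Function.ne_iff.1 hc₀
    exact mem_pairSupport_signPair.1 (hs₀ hv) rfl
  constructor
  · rintro ⟨c, hc, hcp⟩
    exact ⟨c₀, hf₀, by rw [← key c (hne c hcp).1 hc (hne c hcp).2, hcp]⟩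
  · rintro ⟨c, hc, hcp⟩
    obtain ⟨c', hc', hd', hs'⟩ := exists_dependency_of_finrank_lt_card (f + ε • g) hcard
    rw [hs] at hs'
    refine ⟨c', hd', ?_⟩
    obtain ⟨κ, hκ, rfl⟩ := hp.exists_smul_eq hc₀ (hne c hcp).1 hf₀ hc hs₀ (hne c hcp).2
    rw [signPair_smul hκ] at hcp
    rw [key c' hc' hd' hs', hcp]

end Perturbation

/-! ### Obstructor complexes and linear dependencies -/

section Intersection

variable {V : Type*} [Fintype V]

theorem mem_convexHull_image_finset {E : Type*} [AddCommGroup E] [Module ℝ E] {f : V → E}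
    {σ : Finset V} {x : E} : x ∈ convexHull ℝ (f '' (σ : Set V)) ↔
      ∃ w : V → ℝ, (∀ v, 0 ≤ w v) ∧ Function.support w ⊆ σ ∧ ∑ v, w v = 1 ∧ ∑ v, w v • f v = x := by
  classical
  constructor
  · intro hx
    obtain ⟨ι, _, w, z, hw0, hw1, hz, rfl⟩ := mem_convexHull_iff_exists_fintype.1 hx
    choose g hg hgz using hz
    refine ⟨fun v => ∑ i with g i = v, w i, fun v => Finset.sum_nonneg fun i _ => hw0 i, ?_, ?_, ?_⟩
    · intro v hv
      obtain ⟨i, hi, -⟩ := Finset.exists_ne_zero_of_sum_ne_zero hv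
      rw [← (Finset.mem_filter.1 hi).2]
      exact hg i
    · exact (Finset.sum_fiberwise _ g w).trans hw1
    · simp only [Finset.sum_smul]
      rw [← Finset.sum_fiberwise (g := g)]
      refine Finset.sum_congr rfl fun v _ => Finset.sum_congr rfl fun i hi => ?_
      rw [← hgz i, (Finset.mem_filter.1 hi).2]
  · rintro ⟨w, hw0, hws, hw1, rfl⟩
    have hz : ∀ v ∉ σ, w v = 0 := fun v hv => by by_contra h; exact hv (hws h)
    rw [sum_eq_sum_of_support (s := σ) fun v hv => by rw [hz v hv, zero_smul]]
    rw [sum_eq_sum_of_support hz] at hw1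
    exact (convex_convexHull ℝ _).sum_mem (fun v _ => hw0 v) hw1
      fun v hv => subset_convexHull ℝ _ ⟨v, hv, rfl⟩

theorem signPair_eq_mk [DecidableEq V] {c : V → ℝ} {σ τ : Finset V} (h : signPair c = s(σ, τ)) :
    ∃ c' : V → ℝ, (c' = c ∨ c' = (-1 : ℝ) • c) ∧ (∀ v, 0 < c' v ↔ v ∈ σ) ∧ (∀ v, c' v < 0 ↔ v ∈ τ) := by
  rw [signPair, Sym2.eq_iff] at h
  rcases h with ⟨h1, h2⟩ | ⟨h1, h2⟩
  · refine ⟨c, .inl rfl, fun v => ?_, fun v => ?_⟩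
    · rw [← h1]; simp
    · rw [← h2]; simp
  · refine ⟨(-1 : ℝ) • c, .inr rfl, fun v => ?_, fun v => ?_⟩
    · rw [← h2]; simp
    · rw [← h1]; simp

theorem signPair_eq_of_pos_neg {c : V → ℝ} {σ τ : Finset V} (hσ : ∀ v, 0 < c v ↔ v ∈ σ)
    (hτ : ∀ v, c v < 0 ↔ v ∈ τ) : signPair c = s(σ, τ) := by
  rw [signPair]
  congr 2
  · ext v; simp [hσ]
  · ext v; simp [hτ]

/-- A common point has two systems of barycentric coordinates, whose difference is an affine
dependency, positive on `σ` and negative on `τ`. General position makes the `m + 2` vertices a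
circuit, so the dependency, and with it the point, is unique after normalization. -/
theorem intersectionCount_eq [DecidableEq V] {m : ℕ} {f : V → Fin m → ℝ} (hf : GeneralPosition m f)
    {σ τ : Finset V} (hσ : σ.Nonempty) (hdisj : Disjoint σ τ) (hcard : σ.card + τ.card = m + 2)
    [Decidable (IsRadon (fun v => ((1 : ℝ), f v)) s(σ, τ))] :
    intersectionCount f s(σ, τ) = if IsRadon (fun v => ((1 : ℝ), f v)) s(σ, τ) then 1 else 0 := by
  change (convexHull ℝ (f '' (σ : Set V)) ∩ convexHull ℝ (f '' (τ : Set V))).ncard = _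
  have hu : IsCircuit (fun v => ((1 : ℝ), f v)) ((σ ∪ τ : Finset V) : Set V) :=
    (generalPosition_iff.1 hf).isCircuit (by simp [add_comm])
      (by rw [Finset.card_union_of_disjoint hdisj, hcard])
  have key : ∀ x ∈ convexHull ℝ (f '' (σ : Set V)) ∩ convexHull ℝ (f '' (τ : Set V)),
      ∃ c, IsDependency (fun v => ((1 : ℝ), f v)) c ∧ (∀ v, 0 < c v ↔ v ∈ σ) ∧
        (∀ v, c v < 0 ↔ v ∈ τ) ∧ ∑ v ∈ σ, c v = 1 ∧ ∑ v ∈ σ, c v • f v = x := by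
    rintro x ⟨hx, hx'⟩
    obtain ⟨w, hw0, hws, hw1, hwx⟩ := mem_convexHull_image_finset.1 hx
    obtain ⟨w', hw0', hws', hw1', hwx'⟩ := mem_convexHull_image_finset.1 hx'
    have hdep : IsDependency (fun v => ((1 : ℝ), f v)) (w - w') := by
      rw [isDependency_one_prod]
      simp [sub_smul, hw1, hw1', hwx, hwx']
    have hz : ∀ v ∉ σ, w v = 0 := fun v hv => by by_contra h; exact hv (hws h)
    have hz' : ∀ v ∉ τ, w' v = 0 := fun v hv => by by_contra h; exact hv (hws' h)
    have hwσ : ∀ v ∈ σ, (w - w') v = w v := fun v hv => by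
      simp [hz' v (Finset.disjoint_left.1 hdisj hv)]
    have hwτ : ∀ v ∈ τ, (w - w') v = - w' v := fun v hv => by
      simp [hz v (Finset.disjoint_right.1 hdisj hv)]
    have hsum : ∑ v ∈ σ, (w - w') v = 1 := by
      rw [Finset.sum_congr rfl hwσ, ← hw1, sum_eq_sum_of_support hz]
    have hne : w - w' ≠ 0 := by
      intro h
      rw [h] at hsum
      simp at hsum
    have hsupp : Function.support (w - w') ⊆ ((σ ∪ τ : Finset V) : Set V) := by
      rw [Finset.coe_union]
      exact (Function.support_sub _ _).trans (Set.union_subset_union hws hws')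
    have hnz := hu.ne_zero _ hne hdep hsupp
    have hσpos : ∀ v ∈ σ, 0 < (w - w') v := fun v hv => by
      rw [hwσ v hv]
      refine (hw0 v).lt_of_ne' ?_
      rw [← hwσ v hv]
      exact hnz v (by simp [hv])
    have hτneg : ∀ v ∈ τ, (w - w') v < 0 := fun v hv => by
      rw [hwτ v hv, neg_lt_zero]
      refine (hw0' v).lt_of_ne' ?_
      rw [← neg_ne_zero, ← hwτ v hv]
      exact hnz v (by simp [hv])
    refine ⟨w - w', hdep, fun v => ⟨fun h => ?_, hσpos v⟩, fun v => ⟨fun h => ?_, hτneg v⟩, hsum, ?_⟩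
    · by_contra hv
      have := hw0' v
      simp only [Pi.sub_apply, hz v hv] at h
      linarith
    · by_contra hv
      have := hw0 v
      simp only [Pi.sub_apply, hz' v hv] at h
      linarith
    · rw [Finset.sum_congr rfl fun v hv => by rw [hwσ v hv], ← hwx,
        sum_eq_sum_of_support (s := σ) fun v hv => by rw [hz v hv, zero_smul]]
  have hprops : ∀ c : V → ℝ, (∀ v, 0 < c v ↔ v ∈ σ) → (∀ v, c v < 0 ↔ v ∈ τ) →
      c ≠ 0 ∧ Function.support c ⊆ ((σ ∪ τ : Finset V) : Set V) := by
    intro c h1 h2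
    refine ⟨?_, fun v hv => ?_⟩
    · rintro rfl
      obtain ⟨v, hv⟩ := hσ
      exact lt_irrefl (0 : ℝ) ((h1 v).2 hv)
    · rw [Finset.coe_union, Set.mem_union, Finset.mem_coe, Finset.mem_coe, ← h1, ← h2]
      exact (lt_or_gt_of_ne hv).symm
  split_ifs with h
  · obtain ⟨c₁, hc₁, hcp⟩ := h
    obtain ⟨c, hcc, hcσ, hcτ⟩ := signPair_eq_mk hcp
    have hc : IsDependency (fun v => ((1 : ℝ), f v)) c := by
      rcases hcc with rfl | rfl
      · exact hc₁
      · exact hc₁.smul _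
    obtain ⟨hs0, hsf⟩ := isDependency_one_prod.1 hc
    have hz : ∀ v ∉ σ ∪ τ, c v = 0 := fun v hv => by
      by_contra h; exact hv ((hprops c hcσ hcτ).2 h)
    rw [sum_eq_sum_of_support hz, Finset.sum_union hdisj] at hs0
    rw [sum_eq_sum_of_support (s := σ ∪ τ) fun v hv => by rw [hz v hv, zero_smul],
      Finset.sum_union hdisj] at hsf
    have hS : 0 < ∑ v ∈ σ, c v := Finset.sum_pos (fun v hv => (hcσ v).2 hv) hσ
    set S₀ := ∑ v ∈ σ, c v with hS₀
    rw [Set.ncard_eq_one]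
    refine ⟨S₀⁻¹ • ∑ v ∈ σ, c v • f v, Set.Subset.antisymm ?_ ?_⟩
    · intro x hx
      obtain ⟨c', hc', hcσ', hcτ', hsum, rfl⟩ := key x hx
      obtain ⟨κ, hκ, rfl⟩ := hu.exists_smul_eq (hprops c hcσ hcτ).1 (hprops c' hcσ' hcτ').1 hc hc'
        (hprops c hcσ hcτ).2 (hprops c' hcσ' hcτ').2
      simp only [Pi.smul_apply, smul_eq_mul, ← Finset.mul_sum] at hsum
      rw [← hS₀] at hsum
      rw [Set.mem_singleton_iff, ← eq_inv_of_mul_eq_one_left hsum]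
      simp only [Pi.smul_apply, smul_eq_mul, mul_smul, Finset.smul_sum]
    · rintro x rfl
      constructor
      · rw [Finset.smul_sum]
        simp only [smul_smul]
        refine (convex_convexHull ℝ _).sum_mem
          (fun v hv => mul_nonneg (inv_nonneg.2 hS.le) ((hcσ v).2 hv).le) ?_
          fun v hv => subset_convexHull ℝ _ ⟨v, hv, rfl⟩
        rw [← Finset.mul_sum, inv_mul_cancel₀ hS.ne']
      · rw [eq_neg_of_add_eq_zero_left hsf, ← Finset.sum_neg_distrib, Finset.smul_sum]
        simp only [← neg_smul, smul_smul]
        refine (convex_convexHull ℝ _).sum_mem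
          (fun v hv => mul_nonneg (inv_nonneg.2 hS.le) (neg_nonneg.2 ((hcτ v).2 hv).le)) ?_
          fun v hv => subset_convexHull ℝ _ ⟨v, hv, rfl⟩
        rw [← Finset.mul_sum, Finset.sum_neg_distrib, ← eq_neg_of_add_eq_zero_left hs0,
          inv_mul_cancel₀ hS.ne']
  · have hempty : convexHull ℝ (f '' (σ : Set V)) ∩ convexHull ℝ (f '' (τ : Set V)) = ∅ := by
      by_contra hne
      obtain ⟨x, hx⟩ := Set.nonempty_iff_ne_empty.2 hne
      obtain ⟨c, hc, hcσ, hcτ, -⟩ := key x hx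
      exact h ⟨c, hc, signPair_eq_of_pos_neg hcσ hcτ⟩
    rw [hempty, Set.ncard_empty]

theorem sum_intersectionCount_eq [DecidableEq V] {m : ℕ} {f : V → Fin m → ℝ}
    (hf : GeneralPosition m f) {P : Finset (Sym2 (Finset V))}
    (hP : ∀ σ τ, s(σ, τ) ∈ P → σ.Nonempty ∧ Disjoint σ τ ∧ σ.card + τ.card = m + 2) :
    ∑ p ∈ P, intersectionCount f p = {p | p ∈ P ∧ IsRadon (fun v => ((1 : ℝ), f v)) p}.ncard := by
  classical
  have h1 : ∀ p ∈ P, intersectionCount f p =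
      if IsRadon (fun v => ((1 : ℝ), f v)) p then 1 else 0 := by
    intro p hp
    induction p with | _ σ τ =>
    obtain ⟨h1, h2, h3⟩ := hP σ τ hp
    exact intersectionCount_eq hf h1 h2 h3
  rw [Finset.sum_congr rfl h1, ← Finset.card_filter, ← Set.ncard_coe_finset, Finset.coe_filter]

theorem sum_ite_add_ite_eq_ncard [DecidableEq V] (P : Finset (Sym2 (Finset V))) (ρ τ : Finset V) :
    ∑ v, ((if s(insert v ρ, τ) ∈ P then 1 else 0) + if s(ρ, insert v τ) ∈ P then 1 else 0) =
      {v : V | s(insert v ρ, τ) ∈ P}.ncard + {v : V | s(ρ, insert v τ) ∈ P}.ncard := by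
  rw [Finset.sum_add_distrib, ← Finset.card_filter, ← Finset.card_filter, ← Set.ncard_coe_finset,
    ← Set.ncard_coe_finset, Finset.coe_filter, Finset.coe_filter]
  simp

end Intersection

/-! ### Passing between obstructors and linear obstructors -/

section Conversion

variable {V : Type*} [Fintype V]

theorem isDependency_smul_iff {E : Type*} [AddCommGroup E] [Module ℝ E] {f : V → E} {l : V → ℝ}
    {c : V → ℝ} : IsDependency (fun v => l v • f v) c ↔ IsDependency f (fun v => c v * l v) := by
  simp [IsDependency, smul_smul]

variable [DecidableEq V]

theorem IsObstructor.exists_isLinearObstructor {K : AbstractSimplicialComplex V} {m : ℕ}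
    (h : IsObstructor K m) : ∃ (P : Finset (Sym2 (Finset V))) (f : V → Fin m → ℝ),
      IsLinearObstructor K (m + 2) P (fun v => ((1 : ℝ), f v)) ∧
        ∀ σ τ, s(σ, τ) ∈ P → σ.Nonempty := by
  obtain ⟨-, P, hP, hcyc, ⟨f, hf, hodd⟩, hlast⟩ := h
  have hne : ∀ σ τ, s(σ, τ) ∈ P → σ.Nonempty := fun σ τ h => (K.isRelLowerSet_faces (hP σ τ h).1).1
  have hdn : ∀ {s t : Finset V}, s ∈ K.faces → t ⊆ s → t.Nonempty → t ∈ K.faces :=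
    fun h h' h'' => (K.isRelLowerSet_faces h).2 h' h''
  refine ⟨P, f, ⟨fun σ τ h _ => (hP σ τ h).1, fun σ τ h => (hP σ τ h).2.2.1,
    fun σ τ h => (hP σ τ h).2.2.2, fun ρ τ hρτ => ?_, fun p hp => ?_, ?_⟩, hne⟩
  · rw [sum_ite_add_ite_eq_ncard]
    -- Condition (3) is the cycle condition at the cell formed by `τ` and the empty simplex.
    have empty_case : ∀ τ : Finset V, τ.card = m + 1 →
        Even ({v : V | s(insert v ∅, τ) ∈ P}.ncard + {v : V | s(∅, insert v τ) ∈ P}.ncard) := by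
      intro τ hτ
      have h0 : {v : V | s(∅, insert v τ) ∈ P} = ∅ := by
        ext v
        simp only [Set.mem_ofPred_eq, Set.mem_empty_iff_false, iff_false]
        exact fun h => Finset.not_nonempty_empty (hne _ _ h)
      rw [h0, Set.ncard_empty, add_zero]
      by_cases hτK : τ ∈ K.faces
      · simpa [Sym2.eq_swap] using hlast τ hτK hτ
      · have h1 : {v : V | s(insert v ∅, τ) ∈ P} = ∅ := by
          ext v
          simp only [Set.mem_ofPred_eq, Set.mem_empty_iff_false, iff_false]
          exact fun h => hτK (hP _ _ h).2.1
        rw [h1, Set.ncard_empty]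
        exact Even.zero
    rcases ρ.eq_empty_or_nonempty with rfl | hρne
    · exact empty_case τ (by simpa using hρτ)
    rcases τ.eq_empty_or_nonempty with rfl | hτne
    · have := empty_case ρ (by simpa using hρτ)
      rw [add_comm] at this
      simpa [Sym2.eq_swap] using this
    by_cases hgood : ρ ∈ K.faces ∧ τ ∈ K.faces ∧ Disjoint ρ τ
    · exact hcyc ρ hgood.1 τ hgood.2.1 hgood.2.2 (by omega)
    · have h0 : {v : V | s(ρ, insert v τ) ∈ P} = ∅ := by
        ext v
        simp only [Set.mem_ofPred_eq, Set.mem_empty_iff_false, iff_false]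
        exact fun h => hgood ⟨(hP _ _ h).1, hdn (hP _ _ h).2.1 (Finset.subset_insert _ _) hτne,
          (hP _ _ h).2.2.1.mono_right (Finset.subset_insert _ _)⟩
      have h1 : {v : V | s(insert v ρ, τ) ∈ P} = ∅ := by
        ext v
        simp only [Set.mem_ofPred_eq, Set.mem_empty_iff_false, iff_false]
        exact fun h => hgood ⟨hdn (hP _ _ h).1 (Finset.subset_insert _ _) hρne, (hP _ _ h).2.1,
          (hP _ _ h).2.2.1.mono_left (Finset.subset_insert _ _)⟩
      simp [h0, h1]
  · induction p with | _ σ τ =>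
    have h1 : pairSupport s(σ, τ) = ((σ ∪ τ : Finset V) : Set V) := by
      ext v; simp [mem_pairSupport]
    rw [h1]
    exact (generalPosition_iff.1 hf).isCircuit (by simp [add_comm])
      (by rw [Finset.card_union_of_disjoint (hP σ τ hp).2.2.1, (hP σ τ hp).2.2.2])
  · rw [← sum_intersectionCount_eq hf fun σ τ h => ⟨hne σ τ h, (hP σ τ h).2.2⟩]
    exact hodd

-- A small perturbation puts the vectors in general position without changing which pairs of `P` are
-- Radon. Positivity of `l` then allows rescaling them into the affine hyperplane `l = 1`, a copy of
-- `ℝᵐ`; positive factors do not affect signs, so the van Kampen number stays odd.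
open Filter Topology in
theorem IsLinearObstructor.isObstructor {E : Type*} [NormedAddCommGroup E] [NormedSpace ℝ E]
    [FiniteDimensional ℝ E] {K : AbstractSimplicialComplex V} {m : ℕ}
    {P : Finset (Sym2 (Finset V))} {f : V → E} (hP : IsLinearObstructor K (m + 2) P f)
    (hm : Module.finrank ℝ E = m + 1) {l : E →ₗ[ℝ] ℝ} (hl : ∀ v, 0 < l (f v))
    (hne : ∀ σ τ, s(σ, τ) ∈ P → σ.Nonempty) (hdim : ∀ σ ∈ K.faces, σ.card ≤ m + 1) :
    IsObstructor K m := by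
  refine ⟨hdim, P, ?_, ?_, ?_, ?_⟩
  · intro σ τ h
    exact ⟨hP.mem_faces σ τ h (hne σ τ h),
      hP.mem_faces τ σ (Sym2.eq_swap ▸ h) (hne τ σ (Sym2.eq_swap ▸ h)), hP.disjoint σ τ h,
      hP.card_add σ τ h⟩
  · intro ρ _ τ _ _ hcard
    rw [← sum_ite_add_ite_eq_ncard]
    exact hP.cycle ρ τ (by omega)
  · obtain ⟨g, hg⟩ := exists_linearGeneralPosition (V := V) hm
    have h1 := eventually_linearGeneralPosition f hg
    have h2 : ∀ᶠ ε in 𝓝 (0 : ℝ), ∀ p : Sym2 (Finset V), p ∈ P →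
        (IsRadon (f + ε • g) p ↔ IsRadon f p) := by
      refine eventually_all.2 fun p => ?_
      by_cases hp : p ∈ P
      · have := eventually_isRadon_iff g (hP.circuit p hp) (by
          induction p with | _ σ τ =>
          refine ⟨σ ∪ τ, by ext; simp [mem_pairSupport], ?_⟩
          rw [Finset.card_union_of_disjoint (hP.disjoint σ τ hp), hP.card_add σ τ hp, hm]
          omega)
        filter_upwards [this] with ε hε _ using hε
      · exact Eventually.of_forall fun _ h => absurd h hp
    have h3 : ∀ᶠ ε in 𝓝 (0 : ℝ), ∀ v, 0 < l ((f + ε • g) v) := by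
      refine eventually_all.2 fun v => ?_
      have hc : Continuous fun ε : ℝ => l (f v) + ε * l (g v) := by fun_prop
      have h0 := (hc.tendsto 0).eventually_const_lt (u := 0) (by simpa using hl v)
      filter_upwards [h0] with ε hε
      simpa using hε
    obtain ⟨ε, hε1, hε2, hε3⟩ := (h1.and (eventually_nhdsWithin_of_eventually_nhds (h2.and h3))).exists
    set F : V → E := f + ε • g with hF
    -- `κ` extends an isomorphism from the `m`-dimensional kernel of `l`, so `(l, κ)` are linear
    -- coordinates on `E`.
    obtain ⟨κ, hκ⟩ : ∃ κ : E →ₗ[ℝ] (Fin m → ℝ), ∀ x, l x = 0 → κ x = 0 → x = 0 := by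
      have hker : Module.finrank ℝ (LinearMap.ker l) = Module.finrank ℝ (Fin m → ℝ) := by
        rcases isEmpty_or_nonempty V with hV | ⟨⟨v⟩⟩
        · obtain ⟨p, hp, -⟩ : {p | p ∈ P ∧ IsRadon f p}.Nonempty := by
            rw [Set.nonempty_iff_ne_empty]
            intro h
            have := hP.odd
            simp [h] at this
          induction p with | _ σ τ =>
          obtain ⟨v, -⟩ := hne σ τ hp
          exact (hV.false v).elim
        · have hsurj : LinearMap.range l = ⊤ :=
            LinearMap.range_eq_top.2 (LinearMap.surjective fun h => (hl v).ne' (by simp [h]))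
          have := l.finrank_range_add_finrank_ker
          rw [hsurj, finrank_top, hm] at this
          simp only [Module.finrank_self, Module.finrank_fintype_fun_eq_card, Fintype.card_fin]
            at this ⊢
          omega
      obtain ⟨i, hi⟩ : ∃ i : LinearMap.ker l →ₗ[ℝ] (Fin m → ℝ), Function.Injective i :=
        ⟨(LinearEquiv.ofFinrankEq _ _ hker).toLinearMap, LinearEquiv.injective _⟩
      obtain ⟨κ, hκ⟩ := i.exists_extend
      refine ⟨κ, fun x hx hx' => ?_⟩
      have h4 : i ⟨x, hx⟩ = 0 := by rw [← hx', ← hκ]; rfl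
      simpa using congrArg Subtype.val (hi (h4.trans (map_zero i).symm))
    set l' : V → ℝ := fun v => (l (F v))⁻¹ with hl'
    have hl'pos : ∀ v, 0 < l' v := fun v => inv_pos.2 (hε3 v)
    set φ : V → Fin m → ℝ := fun v => κ (l' v • F v) with hφ
    have hdep : ∀ c, IsDependency (fun v => ((1 : ℝ), φ v)) c ↔
        IsDependency F (fun v => c v * l' v) := by
      intro c
      rw [← isDependency_smul_iff, isDependency_one_prod]
      have e1 : ∑ v, c v = l (∑ v, c v • l' v • F v) := by
        rw [map_sum]
        refine Finset.sum_congr rfl fun v _ => ?_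
        rw [map_smul, map_smul, smul_eq_mul, smul_eq_mul, hl', inv_mul_cancel₀ (hε3 v).ne', mul_one]
      have e2 : ∑ v, c v • φ v = κ (∑ v, c v • l' v • F v) := by
        rw [map_sum]
        exact Finset.sum_congr rfl fun v _ => by rw [map_smul]
      rw [e1, e2]
      exact ⟨fun h => hκ _ h.1 h.2, fun h => by rw [IsDependency] at h; simp [h]⟩
    have hsign : ∀ c : V → ℝ, signPair (fun v => c v * l' v) = signPair c := by
      intro c
      have ha : ∀ v, 0 < c v * l' v ↔ 0 < c v := fun v => mul_pos_iff_of_pos_right (hl'pos v)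
      have hb : ∀ v, c v * l' v < 0 ↔ c v < 0 := fun v => by
        rw [mul_neg_iff]
        simp [hl'pos v, (hl'pos v).not_gt]
      simp only [signPair, ha, hb]
    have hradon : ∀ p, IsRadon (fun v => ((1 : ℝ), φ v)) p ↔ IsRadon F p := by
      intro p
      constructor
      · rintro ⟨c, hc, rfl⟩
        exact ⟨_, (hdep c).1 hc, hsign c⟩
      · rintro ⟨c, hc, rfl⟩
        have e : c = fun v => (c v / l' v) * l' v := by
          funext v
          rw [div_mul_cancel₀ _ (hl'pos v).ne']
        refine ⟨fun v => c v / l' v, (hdep _).2 (e ▸ hc), ?_⟩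
        rw [← hsign, ← e]
    have hGP : GeneralPosition m φ := by
      rw [generalPosition_iff]
      intro s hs c hc hcs
      have := hε1 s hs _ ((hdep c).1 hc) fun v hv => hcs (left_ne_zero_of_mul hv)
      funext v
      have h5 := congrFun this v
      simpa [(hl'pos v).ne'] using h5
    refine ⟨φ, hGP, ?_⟩
    rw [sum_intersectionCount_eq hGP fun σ τ h => ⟨hne σ τ h, hP.disjoint σ τ h, hP.card_add σ τ h⟩]
    have : {p | p ∈ P ∧ IsRadon (fun v => ((1 : ℝ), φ v)) p} = {p | p ∈ P ∧ IsRadon f p} := by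
      ext p
      simp only [Set.mem_ofPred_eq, hradon]
      exact and_congr_right fun hp => hε2 p hp
    rw [this]
    exact hP.odd
  · intro σ _ hcard
    have := hP.cycle σ ∅ (by simp [hcard])
    rw [sum_ite_add_ite_eq_ncard] at this
    have h0 : {v : V | s(insert v σ, ∅) ∈ P} = ∅ := by
      ext v
      simp only [Set.mem_ofPred_eq, Set.mem_empty_iff_false, iff_false]
      exact fun h => Finset.not_nonempty_empty (hne ∅ _ (Sym2.eq_swap ▸ h))
    simpa [h0] using this

/-- Each pair in `P` has a single dependency up to scaling, so the bad heights lie in finitely many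
hyperplanes, which do not cover `ℝ^V`. -/
theorem exists_isGenericHeight {E : Type*} [AddCommGroup E] [Module ℝ E]
    {P : Finset (Sym2 (Finset V))} {f : V → E} (hP : ∀ p ∈ P, IsCircuit f (pairSupport p)) :
    ∃ h : V → ℝ, IsGenericHeight P f h := by
  have hc : ∀ p : P, ∃ c, c ≠ 0 ∧ IsDependency f c ∧ Function.support c ⊆ pairSupport p.1 :=
    fun p => (hP p p.2).exists_dependency
  choose c hc0 hcf hcs using hc
  let W : P → Submodule ℝ (V → ℝ) := fun p => LinearMap.ker (Fintype.linearCombination ℝ (c p))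
  have hW : ∀ p (h : V → ℝ), h ∈ W p ↔ ∑ v, c p v * h v = 0 := by
    intro p h
    simp [W, Fintype.linearCombination_apply, mul_comm]
  have hne : ⋃ p ∈ Set.range W, (p : Set (V → ℝ)) ≠ Set.univ := by
    have h1 : (⊤ : Submodule ℝ (V → ℝ)) ∉ Finset.univ.image W := by
      rw [Finset.mem_image]
      rintro ⟨p, -, hp⟩
      obtain ⟨v, hv⟩ := Function.ne_iff.1 (hc0 p)
      have : Pi.single v (1 : ℝ) ∈ W p := hp ▸ Submodule.mem_top
      rw [hW, Finset.sum_eq_single v] at this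
      · exact hv (by simpa using this)
      · intro w _ hw
        simp [hw]
      · simp
    have := Subspace.biUnion_ne_univ_of_top_notMem h1
    simpa using this
  obtain ⟨h, hh⟩ := (Set.ne_univ_iff_exists_notMem _).1 hne
  refine ⟨h, fun p hp c' hc' hf' hs' h0 => hh ?_⟩
  obtain ⟨κ, hκ, rfl⟩ := (hP p hp).exists_smul_eq (hc0 ⟨p, hp⟩) hc' (hcf _) hf' (hcs _) hs'
  simp only [Pi.smul_apply, smul_eq_mul, mul_assoc, ← Finset.mul_sum] at h0
  refine Set.mem_biUnion ⟨⟨p, hp⟩, rfl⟩ ((hW _ _).2 ?_)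
  simpa [hκ] using h0

end Conversion

/-! ### Joins and cones of obstructor complexes -/

section JoinOfObstructors

variable {V W : Type*}

theorem card_le_of_mem_joinComplex {K : AbstractSimplicialComplex V}
    {L : AbstractSimplicialComplex W} {n n' : ℕ} (hK : ∀ σ ∈ K.faces, σ.card ≤ n)
    (hL : ∀ σ ∈ L.faces, σ.card ≤ n') (σ : Finset (V ⊕ W)) (hσ : σ ∈ (joinComplex K L).faces) :
    σ.card ≤ n + n' := by
  rw [← Finset.card_toLeft_add_card_toRight (u := σ)]
  refine add_le_add ?_ ?_
  · rcases σ.toLeft.eq_empty_or_nonempty with h | h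
    · simp [h]
    · exact hK _ (hσ.2.1 h)
  · rcases σ.toRight.eq_empty_or_nonempty with h | h
    · simp [h]
    · exact hL _ (hσ.2.2 h)

variable [Fintype V] [DecidableEq V] [Fintype W] [DecidableEq W]

/-- Empty simplices are allowed in a linear obstructor but not in an obstructor; one factor without
them suffices to remove them from the join. -/
theorem joinPairs_nonempty_of_right {P : Finset (Sym2 (Finset V))} {P' : Finset (Sym2 (Finset W))}
    (h : ∀ σ τ, s(σ, τ) ∈ P' → σ.Nonempty) (σ τ : Finset (V ⊕ W)) (hr : s(σ, τ) ∈ joinPairs P P') :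
    σ.Nonempty := by
  obtain ⟨w, hw⟩ := h _ _ (mem_joinPairs.1 hr).2
  exact ⟨_, Finset.mem_toRight.1 hw⟩

/-- The join of an `m`-obstructor and an `n`-obstructor is an `m + n + 2`-obstructor. -/
theorem IsObstructor.join {K : AbstractSimplicialComplex V} {L : AbstractSimplicialComplex W}
    {m n : ℕ} (hK : IsObstructor K m) (hL : IsObstructor L n) :
    IsObstructor (joinComplex K L) (m + n + 2) := by
  obtain ⟨P, f, hP, hPne⟩ := hK.exists_isLinearObstructor
  obtain ⟨P', g, hP', hPne'⟩ := hL.exists_isLinearObstructor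
  obtain ⟨h, hh⟩ := exists_isGenericHeight hP.circuit
  obtain ⟨h', hh'⟩ := exists_isGenericHeight hP'.circuit
  have hj := hP.join hP' hh hh'
  rw [show m + 2 + (n + 2) = m + n + 2 + 2 by ring] at hj
  -- The functional adds the two homogenizing coordinates, so it equals 1 on every joined vector.
  refine hj.isObstructor (l := (LinearMap.fst ℝ ℝ (Fin m → ℝ)).coprod
      (((LinearMap.fst ℝ ℝ (Fin n → ℝ))).coprod (0 : ℝ →ₗ[ℝ] ℝ))) ?_ ?_
    (joinPairs_nonempty_of_right hPne') ?_
  · simp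
    ring
  · rintro (v | w) <;> simp [joinVec]
  · intro σ hσ
    have := card_le_of_mem_joinComplex hK.1 hL.1 σ hσ
    omega

/-- The complex which consists of one vertex. -/
def pointComplex : AbstractSimplicialComplex Unit where
  faces := {s | s.Nonempty}
  isRelLowerSet_faces := fun _ hs => ⟨hs, fun _ _ ht => ht⟩
  singleton_mem := fun _ => Finset.singleton_nonempty _

/-- This is the "(-1)-obstructor": a single zero vector in the zero space is a circuit, and its
Radon partition has one empty side. -/
theorem isLinearObstructor_point :
    IsLinearObstructor pointComplex 1 {s(∅, {()})} (fun _ => (0 : Fin 0 → ℝ)) where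
  mem_faces := fun _ _ _ h => h
  disjoint := by
    intro σ τ h
    rw [Finset.mem_singleton, Sym2.eq_iff] at h
    rcases h with ⟨rfl, rfl⟩ | ⟨rfl, rfl⟩ <;> simp
  card_add := by
    intro σ τ h
    rw [Finset.mem_singleton, Sym2.eq_iff] at h
    rcases h with ⟨rfl, rfl⟩ | ⟨rfl, rfl⟩ <;> simp
  cycle := by
    intro ρ τ h
    obtain rfl : ρ = ∅ := Finset.card_eq_zero.1 (by omega)
    obtain rfl : τ = ∅ := Finset.card_eq_zero.1 (by omega)
    -- The only cycle condition is at the pair of empty simplices; both ways of adding the point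
    -- give the same unordered pair, and it is counted twice.
    have : s(({()} : Finset Unit), ∅) = s(∅, {()}) := Sym2.eq_swap
    simp [this]
  circuit := by
    intro p hp
    refine ⟨⟨fun _ => 1, fun h => one_ne_zero (congrFun h ()), Subsingleton.elim _ _, ?_⟩, ?_⟩
    · rw [Finset.mem_singleton.1 hp]
      rintro ⟨⟩ -
      simp [mem_pairSupport]
    · intro c hc _ _ v _ hv
      exact hc (funext fun w => hv)
  odd := by
    have : {p | p ∈ ({s(∅, {()})} : Finset (Sym2 (Finset Unit))) ∧
        IsRadon (fun _ => (0 : Fin 0 → ℝ)) p} = {s(∅, {()})} := by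
      ext p
      simp only [Finset.mem_singleton, Set.mem_ofPred_eq, Set.mem_singleton_iff, and_iff_left_iff_imp]
      rintro rfl
      refine ⟨fun _ => -1, Subsingleton.elim _ _, signPair_eq_of_pos_neg ?_ ?_⟩ <;> simp
    rw [this, Set.ncard_singleton]
    exact odd_one

theorem isGenericHeight_point :
    IsGenericHeight {s(∅, {()})} (fun _ => (0 : Fin 0 → ℝ)) (fun _ => 1) := by
  intro p _ c hc _ _ h
  refine hc (funext fun v => ?_)
  simpa using h

/-- The cone over an `m`-obstructor is an `m + 1`-obstructor. -/
theorem IsObstructor.cone {L : AbstractSimplicialComplex W} {m : ℕ} (hL : IsObstructor L m) :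
    IsObstructor (joinComplex pointComplex L) (m + 1) := by
  obtain ⟨P', g, hP', hPne'⟩ := hL.exists_isLinearObstructor
  obtain ⟨h', hh'⟩ := exists_isGenericHeight hP'.circuit
  have hj := isLinearObstructor_point.join hP' isGenericHeight_point hh'
  rw [show 1 + (m + 2) = m + 1 + 2 by ring] at hj
  -- The vector of the cone point has height 1 and no homogenizing coordinate, so the positive
  -- functional has to include the height; `T + 1` compensates negative heights on `L`.
  obtain ⟨T, hT⟩ := (Set.finite_range fun w => -h' w).bddAbove
  refine hj.isObstructor (l := (0 : (Fin 0 → ℝ) →ₗ[ℝ] ℝ).coprod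
      (((T + 1) • (LinearMap.fst ℝ ℝ (Fin m → ℝ))).coprod LinearMap.id)) ?_ ?_
    (joinPairs_nonempty_of_right hPne') ?_
  · simp
    ring
  · rintro (v | w)
    · simp [joinVec]
    · have := hT ⟨w, rfl⟩
      simp only [joinVec, Sum.elim_inr, LinearMap.coprod_apply, LinearMap.zero_apply,
        LinearMap.smul_apply, LinearMap.fst_apply, LinearMap.id_apply, smul_eq_mul]
      linarith
  · intro σ hσ
    have := card_le_of_mem_joinComplex (K := pointComplex) (n := 1)
      (fun σ _ => by simpa using Finset.card_le_univ σ) hL.1 σ hσ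
    omega

theorem IsObstructor.join_point {L : AbstractSimplicialComplex W} {m : ℕ} (hL : IsObstructor L m) :
    IsObstructor (joinComplex L pointComplex) (m + 1) := by
  obtain ⟨P', g, hP', hPne'⟩ := hL.exists_isLinearObstructor
  obtain ⟨h', hh'⟩ := exists_isGenericHeight hP'.circuit
  have hj := hP'.join isLinearObstructor_point hh' isGenericHeight_point
  rw [show m + 2 + 1 = m + 1 + 2 by ring] at hj
  obtain ⟨T, hT⟩ := (Set.finite_range fun w => -h' w).bddAbove
  refine hj.isObstructor (l := ((T + 1) • (LinearMap.fst ℝ ℝ (Fin m → ℝ))).coprod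
      ((0 : (Fin 0 → ℝ) →ₗ[ℝ] ℝ).coprod LinearMap.id)) ?_ ?_ ?_ ?_
  · simp
    ring
  · rintro (w | v)
    · have := hT ⟨w, rfl⟩
      simp only [joinVec, Sum.elim_inl, LinearMap.coprod_apply, LinearMap.zero_apply,
        LinearMap.smul_apply, LinearMap.fst_apply, LinearMap.id_apply, smul_eq_mul]
      linarith
    · simp [joinVec]
  · intro σ τ hr
    obtain ⟨w, hw⟩ := hPne' _ _ (mem_joinPairs.1 hr).1
    exact ⟨_, Finset.mem_toLeft.1 hw⟩
  · intro σ hσ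
    have := card_le_of_mem_joinComplex (L := pointComplex) (n' := 1) hL.1
      (fun σ _ => by simpa using Finset.card_le_univ σ) σ hσ
    omega

end JoinOfObstructors

/-! ### Three points as a 0-obstructor -/

section ThreePoints

/-- The complex which consists of three points. -/
def threePoints : AbstractSimplicialComplex (Fin 3) where
  faces := {s | s.card = 1}
  isRelLowerSet_faces := by
    intro s hs
    have hs' : s.card = 1 := hs
    refine ⟨Finset.card_pos.1 (by omega), fun t hts ht => ?_⟩
    have h1 := Finset.card_le_card hts
    have h2 := Finset.card_pos.2 ht
    change t.card = 1
    omega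
  singleton_mem := fun v => Finset.card_singleton v

/-- All three pairs meet in the one-point space `ℝ⁰`, giving the odd number 3, and each vertex lies
in exactly two of the pairs. -/
theorem isObstructor_threePoints : IsObstructor threePoints 0 := by
  refine ⟨fun σ hσ => (show σ.card = 1 from hσ).le,
    {s({0}, {1}), s({0}, {2}), s({1}, {2})}, ?_, ?_, ⟨fun _ => 0, ?_, ?_⟩, ?_⟩
  · intro σ τ h
    simp only [Finset.mem_insert, Finset.mem_singleton, Sym2.eq_iff] at h
    rcases h with (⟨rfl, rfl⟩ | ⟨rfl, rfl⟩) | (⟨rfl, rfl⟩ | ⟨rfl, rfl⟩) |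
      (⟨rfl, rfl⟩ | ⟨rfl, rfl⟩) <;> simp [threePoints]
  · intro ρ hρ τ hτ _ h
    have h1 : ρ.card = 1 := hρ
    have h2 : τ.card = 1 := hτ
    omega
  · intro s hs
    have : Subsingleton s := Finset.card_le_one_iff_subsingleton_coe.1 (by omega)
    exact affineIndependent_of_subsingleton ℝ _
  · have h1 : ∀ i j : Fin 3, intersectionCount (fun _ => (0 : Fin 0 → ℝ)) s({i}, {j}) = 1 := by
      intro i j
      change (_ ∩ _ : Set _).ncard = 1
      simp
    rw [Finset.sum_insert (by decide), Finset.sum_insert (by decide), Finset.sum_singleton, h1, h1,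
      h1]
    decide
  · intro σ hσ h
    obtain ⟨i, rfl⟩ := Finset.card_eq_one.1 hσ
    rw [Set.ncard_eq_toFinset_card']
    clear hσ h
    revert i
    decide

end ThreePoints

/-! ### Integral points of the open cone -/

section Lattice

variable {V : Type*}

/-- A vector of natural numbers as a real vector. -/
def natVec (x : V → ℕ) : V → ℝ := fun v => x v

theorem natVec_injective : Function.Injective (natVec : (V → ℕ) → V → ℝ) := fun _ _ h =>
  funext fun v => Nat.cast_injective (R := ℝ) (congrFun h v)

/-- The embedding of vectors of natural numbers in real vectors. -/
def natEmb : (V → ℕ) ↪ (V → ℝ) := ⟨natVec, natVec_injective⟩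

/-- The componentwise integral part. -/
noncomputable def floorVec (z : V → ℝ) : V → ℕ := fun v => ⌊z v⌋₊

/-- The componentwise fractional part. -/
noncomputable def fracVec (z : V → ℝ) : V → ℝ := fun v => z v - ⌊z v⌋₊

@[simp]
theorem floorVec_natVec (x : V → ℕ) : floorVec (natVec x) = x := by
  funext v; simp [floorVec, natVec]

theorem mem_openCone_of_support_subset {K : AbstractSimplicialComplex V} {y z : V → ℝ}
    (hz : z ∈ openCone K) (hy : ∀ v, 0 ≤ y v)
    (h : Function.support y ⊆ Function.support z) : y ∈ openCone K := by
  classical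
  refine ⟨hy, ?_⟩
  by_cases hy0 : y = 0
  · exact .inl hy0
  · right
    rcases hz.2 with rfl | ⟨σ, hσ, hzσ⟩
    · refine absurd (Function.support_eq_empty_iff.1 (Set.subset_empty_iff.1 (h.trans ?_))) hy0
      simp
    · rw [hzσ] at h
      have h1 : ((σ.filter fun v => y v ≠ 0 : Finset V) : Set V) = Function.support y := by
        ext v
        simp only [Finset.coe_filter, Set.mem_ofPred_eq, Function.mem_support, and_iff_right_iff_imp]
        exact fun hv => h hv
      refine ⟨σ.filter fun v => y v ≠ 0, (K.isRelLowerSet_faces hσ).2 (Finset.filter_subset _ _) ?_,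
        h1.symm⟩
      rw [← Finset.coe_nonempty, h1]
      exact Function.support_nonempty_iff.2 hy0

theorem mem_openCone_of_support_subset_face {K : AbstractSimplicialComplex V} {y : V → ℝ}
    {σ : Finset V} (hσ : σ ∈ K.faces) (hy : ∀ v, 0 ≤ y v) (h : Function.support y ⊆ σ) :
    y ∈ openCone K := by
  classical
  refine mem_openCone_of_support_subset (z := fun v => if v ∈ σ then 1 else 0)
    ⟨fun v => by positivity, .inr ⟨σ, hσ, ?_⟩⟩ hy (h.trans fun v hv => ?_)
  · ext v; simp
  · simpa using hv

theorem fracVec_nonneg {z : V → ℝ} (hz : ∀ v, 0 ≤ z v) (v : V) : 0 ≤ fracVec z v :=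
  sub_nonneg.2 (Nat.floor_le (hz v))

theorem fracVec_lt_one (z : V → ℝ) (v : V) : fracVec z v < 1 := by
  have := Nat.lt_floor_add_one (z v)
  rw [fracVec]
  linarith

theorem natVec_floorVec_mem_openCone {K : AbstractSimplicialComplex V} {z : V → ℝ}
    (hz : z ∈ openCone K) : natVec (floorVec z) ∈ openCone K :=
  mem_openCone_of_support_subset hz (fun _ => Nat.cast_nonneg _) fun v hv h => by
    rw [Function.mem_support] at hv
    simp [natVec, floorVec, h] at hv

variable [Fintype V]

/-- The largest fractional part. -/
noncomputable def maxFrac (z : V → ℝ) : ℝ := ‖fracVec z‖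

/-- The point where the ray from the integral part of `z` through `z` leaves the unit cube. -/
noncomputable def pushOut (z : V → ℝ) : V → ℝ := fun v => ⌊z v⌋₊ + fracVec z v / maxFrac z

open Classical in
/-- The number of nonintegral components. -/
noncomputable def nonintCount (z : V → ℝ) : ℕ := (Finset.univ.filter fun v => fracVec z v ≠ 0).card

theorem maxFrac_nonneg (z : V → ℝ) : 0 ≤ maxFrac z := norm_nonneg _

theorem fracVec_le_maxFrac (z : V → ℝ) (v : V) : fracVec z v ≤ maxFrac z :=
  (le_abs_self _).trans (norm_le_pi_norm (fracVec z) v)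

theorem maxFrac_lt_one {z : V → ℝ} (hz : ∀ v, 0 ≤ z v) : maxFrac z < 1 := by
  rw [maxFrac, pi_norm_lt_iff one_pos]
  intro v
  rw [Real.norm_of_nonneg (fracVec_nonneg hz v)]
  exact fracVec_lt_one z v

theorem maxFrac_eq_zero {z : V → ℝ} : maxFrac z = 0 ↔ fracVec z = 0 := norm_eq_zero

theorem exists_fracVec_eq_maxFrac {z : V → ℝ} (hz : ∀ v, 0 ≤ z v) (h : maxFrac z ≠ 0) :
    ∃ v, fracVec z v = maxFrac z := by
  have hne : Nonempty V := by
    by_contra hV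
    rw [not_nonempty_iff] at hV
    exact h (maxFrac_eq_zero.2 (Subsingleton.elim _ _))
  obtain ⟨v, -, hv⟩ := Finset.exists_max_image Finset.univ (fracVec z) Finset.univ_nonempty
  refine ⟨v, le_antisymm (fracVec_le_maxFrac z v) ?_⟩
  rw [maxFrac, pi_norm_le_iff_of_nonneg (fracVec_nonneg hz v)]
  intro w
  rw [Real.norm_of_nonneg (fracVec_nonneg hz w)]
  exact hv w (Finset.mem_univ w)

theorem floor_le_pushOut {z : V → ℝ} (hz : ∀ v, 0 ≤ z v) (v : V) : (⌊z v⌋₊ : ℝ) ≤ pushOut z v :=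
  le_add_of_nonneg_right (div_nonneg (fracVec_nonneg hz v) (maxFrac_nonneg z))

theorem pushOut_le (z : V → ℝ) (v : V) : pushOut z v ≤ ⌊z v⌋₊ + 1 := by
  rw [pushOut]
  have := div_le_one_of_le₀ (fracVec_le_maxFrac z v) (maxFrac_nonneg z)
  linarith

theorem pushOut_nonneg {z : V → ℝ} (hz : ∀ v, 0 ≤ z v) (v : V) : 0 ≤ pushOut z v :=
  (Nat.cast_nonneg _).trans (floor_le_pushOut hz v)

theorem floorVec_le_floorVec_pushOut {z : V → ℝ} (hz : ∀ v, 0 ≤ z v) :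
    floorVec z ≤ floorVec (pushOut z) := fun v => Nat.le_floor (floor_le_pushOut hz v)

theorem floorVec_pushOut_le (z : V → ℝ) : floorVec (pushOut z) ≤ floorVec z + 1 := fun v => by
  have h := Nat.floor_le_floor (pushOut_le z v)
  rw [← Nat.cast_one (R := ℝ), ← Nat.cast_add, Nat.floor_natCast] at h
  exact h

theorem pushOut_eq_of_maxFrac_eq_zero {z : V → ℝ} (h : maxFrac z = 0) : pushOut z = z := by
  funext v
  have := congrFun (maxFrac_eq_zero.1 h) v
  rw [fracVec, Pi.zero_apply] at this
  simp only [pushOut, h, div_zero, add_zero]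
  linarith

theorem eq_natVec_of_maxFrac_eq_zero {z : V → ℝ} (h : maxFrac z = 0) : z = natVec (floorVec z) := by
  funext v
  have := congrFun (maxFrac_eq_zero.1 h) v
  rw [fracVec, Pi.zero_apply] at this
  simp only [natVec, floorVec]
  linarith

theorem pushOut_eq_zero_iff {z : V → ℝ} (hz : ∀ v, 0 ≤ z v) (v : V) : pushOut z v = 0 ↔ z v = 0 := by
  by_cases hm : maxFrac z = 0
  · rw [pushOut_eq_of_maxFrac_eq_zero hm]
  · have hm' : 0 < maxFrac z := (maxFrac_nonneg z).lt_of_ne' hm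
    constructor
    · intro h
      have h1 := floor_le_pushOut hz v
      have h2 : (⌊z v⌋₊ : ℝ) = 0 := le_antisymm (h ▸ h1) (Nat.cast_nonneg _)
      rw [pushOut, h2, zero_add, div_eq_zero_iff, or_iff_left hm, fracVec, h2, sub_zero] at h
      exact h
    · intro h
      simp [pushOut, fracVec, h]

theorem pushOut_mem_openCone {K : AbstractSimplicialComplex V} {z : V → ℝ} (hz : z ∈ openCone K) :
    pushOut z ∈ openCone K :=
  mem_openCone_of_support_subset hz (pushOut_nonneg hz.1) fun v hv h =>
    hv ((pushOut_eq_zero_iff hz.1 v).2 h)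

/-- Integral components are unchanged, and a component with the largest fractional part reaches the
next integer. This is the induction measure for both the triangulation and the interpolation. -/
theorem nonintCount_pushOut_lt {z : V → ℝ} (hz : ∀ v, 0 ≤ z v) (h : maxFrac z ≠ 0) :
    nonintCount (pushOut z) < nonintCount z := by
  classical
  obtain ⟨v₀, hv₀⟩ := exists_fracVec_eq_maxFrac hz h
  refine Finset.card_lt_card (Finset.ssubset_iff_of_subset ?_ |>.2 ⟨v₀, ?_, ?_⟩)
  · intro v hv
    simp only [Finset.mem_filter, Finset.mem_univ, true_and] at hv ⊢
    intro h0
    apply hv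
    have : pushOut z v = (⌊z v⌋₊ : ℝ) := by rw [pushOut, h0, zero_div, add_zero]
    rw [fracVec, this, Nat.floor_natCast, sub_self]
  · simp [hv₀, h]
  · simp only [Finset.mem_filter, Finset.mem_univ, true_and, not_not]
    have : pushOut z v₀ = ((⌊z v₀⌋₊ + 1 : ℕ) : ℝ) := by
      rw [pushOut, hv₀, div_self h]
      push_cast
      rfl
    rw [fracVec, this, Nat.floor_natCast, sub_self]

theorem eq_add_smul_pushOut {z : V → ℝ} (h : maxFrac z ≠ 0) (v : V) :
    z v = (1 - maxFrac z) * ⌊z v⌋₊ + maxFrac z * pushOut z v := by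
  rw [pushOut, fracVec]
  field_simp
  ring

end Lattice

/-! ### The Kuhn triangulation of the open cone -/

section Kuhn

variable {V : Type*}

/-- The vertices of a simplex of the Kuhn triangulation. -/
def IsKuhn (t : Finset (V → ℕ)) : Prop := ∀ x ∈ t, ∀ y ∈ t, x ≤ y ∧ y ≤ x + 1 ∨ y ≤ x ∧ x ≤ y + 1

theorem IsKuhn.mono {t t' : Finset (V → ℕ)} (h : IsKuhn t) (ht : t' ⊆ t) : IsKuhn t' :=
  fun x hx y hy => h x (ht hx) y (ht hy)

theorem IsKuhn.le_add_one {t : Finset (V → ℕ)} (h : IsKuhn t) {x y : V → ℕ} (hx : x ∈ t)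
    (hy : y ∈ t) : y ≤ x + 1 := by
  rcases h x hx y hy with h | h
  · exact h.2
  · exact h.1.trans (fun v => Nat.le_succ (x v))

theorem IsKuhn.le_of_not_lt {t : Finset (V → ℕ)} (h : IsKuhn t) {x y : V → ℕ} (hx : x ∈ t)
    (hy : y ∈ t) (hxy : ¬ x < y) : y ≤ x := by
  rcases h x hx y hy with h | h
  · rcases h.1.lt_or_eq with h' | rfl
    · exact absurd h' hxy
    · exact le_rfl
  · exact h.1

theorem mem_convexHull_map_natEmb {t : Finset (V → ℕ)} {p : V → ℝ} :
    p ∈ convexHull ℝ ((t.map natEmb : Finset (V → ℝ)) : Set (V → ℝ)) ↔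
      ∃ w : (V → ℕ) → ℝ, (∀ x ∈ t, 0 ≤ w x) ∧ ∑ x ∈ t, w x = 1 ∧
        ∀ v, ∑ x ∈ t, w x * x v = p v := by
  constructor
  · intro hp
    obtain ⟨w, h0, h1, h2⟩ := Finset.mem_convexHull'.1 hp
    refine ⟨fun x => w (natVec x), fun x hx => h0 _ (Finset.mem_map_of_mem natEmb hx), ?_, ?_⟩
    · rwa [Finset.sum_map] at h1
    · intro v
      rw [Finset.sum_map] at h2
      rw [← h2]
      simp [natEmb, natVec]
  · rintro ⟨w, h0, h1, h2⟩
    have : p = ∑ x ∈ t, w x • natVec x := by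
      funext v
      rw [← h2 v]
      simp [natVec]
    rw [this]
    exact (convex_convexHull ℝ _).sum_mem h0 h1 fun x hx =>
      subset_convexHull ℝ _ (Finset.mem_coe.2 (Finset.mem_map_of_mem natEmb hx))

open Classical in
/-- The vertices of the carrier of a point are found by rounding. -/
theorem IsKuhn.floor_eq {t : Finset (V → ℕ)} (ht : IsKuhn t) {w : (V → ℕ) → ℝ}
    (hw0 : ∀ x ∈ t, 0 ≤ w x) (hw1 : ∑ x ∈ t, w x = 1) {x : V → ℕ} (hx : x ∈ t) {θ : ℝ}
    (h1 : ∑ y ∈ t with x < y, w y < θ) (h2 : θ ≤ ∑ y ∈ t with x ≤ y, w y) (v : V) :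
    ⌊∑ y ∈ t, w y * y v + 1 - θ⌋ = x v := by
  rw [Int.floor_eq_iff]
  -- A vertex `y` has `y v ≥ x v - 1` always and `y v ≥ x v` if `x ≤ y`; take the weighted average.
  have lower : (x v : ℝ) - 1 + ∑ y ∈ t with x ≤ y, w y ≤ ∑ y ∈ t, w y * y v := by
    calc (x v : ℝ) - 1 + ∑ y ∈ t with x ≤ y, w y
        = ∑ y ∈ t, w y * ((x v : ℝ) - 1 + if x ≤ y then 1 else 0) := by
          simp only [mul_add, mul_ite, mul_one, mul_zero, Finset.sum_add_distrib, ← Finset.sum_mul,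
            hw1, one_mul, Finset.sum_filter]
      _ ≤ ∑ y ∈ t, w y * y v := by
          refine Finset.sum_le_sum fun y hy => mul_le_mul_of_nonneg_left ?_ (hw0 y hy)
          split_ifs with h
          · have : (x v : ℝ) ≤ y v := by exact_mod_cast h v
            linarith
          · have h3 : x v ≤ y v + 1 := ht.le_add_one hy hx v
            have : (x v : ℝ) ≤ y v + 1 := by exact_mod_cast h3
            linarith
  have upper : ∑ y ∈ t, w y * y v ≤ (x v : ℝ) + ∑ y ∈ t with x < y, w y := by
    calc ∑ y ∈ t, w y * y v ≤ ∑ y ∈ t, w y * ((x v : ℝ) + if x < y then 1 else 0) := by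
          refine Finset.sum_le_sum fun y hy => mul_le_mul_of_nonneg_left ?_ (hw0 y hy)
          split_ifs with h
          · have h3 : y v ≤ x v + 1 := ht.le_add_one hx hy v
            exact_mod_cast h3
          · have h3 := ht.le_of_not_lt hx hy h v
            rw [add_zero]
            exact_mod_cast h3
      _ = _ := by
          simp only [mul_add, mul_ite, mul_one, mul_zero, Finset.sum_add_distrib, ← Finset.sum_mul,
            hw1, one_mul, Finset.sum_filter]
  constructor
  · push_cast
    linarith
  · push_cast
    linarith

/-- The simplex is a chain. Take the largest vertex `x` above which (inclusively) the weight is at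
least `θ`; by maximality the weight strictly above `x` is less than `θ`. -/
theorem IsKuhn.exists_floor_eq {t : Finset (V → ℕ)} (ht : IsKuhn t) {w : (V → ℕ) → ℝ}
    (hw0 : ∀ x ∈ t, 0 ≤ w x) (hw1 : ∑ x ∈ t, w x = 1) {θ : ℝ} (hθ : 0 < θ) (hθ' : θ ≤ 1) :
    ∃ x ∈ t, ∀ v, ⌊∑ y ∈ t, w y * y v + 1 - θ⌋ = x v := by
  classical
  have hne : t.Nonempty := by
    rw [Finset.nonempty_iff_ne_empty]
    rintro rfl
    simp at hw1
  have hT : (t.filter fun x => θ ≤ ∑ y ∈ t with x ≤ y, w y).Nonempty := by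
    obtain ⟨x, hx, hxm⟩ := t.exists_minimal hne
    refine ⟨x, Finset.mem_filter.2 ⟨hx, ?_⟩⟩
    rw [Finset.filter_true_of_mem, hw1]
    · exact hθ'
    · intro y hy
      by_cases h : y < x
      · exact absurd h (fun h => h.not_ge (hxm hy h.le))
      · exact ht.le_of_not_lt hy hx h
  obtain ⟨x, hx⟩ := Finset.exists_maximal hT
  obtain ⟨hxt, hxU⟩ := Finset.mem_filter.1 hx.1
  refine ⟨x, hxt, ht.floor_eq hw0 hw1 hxt ?_ hxU⟩
  rcases (t.filter fun y => x < y).eq_empty_or_nonempty with h | h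
  · rw [h, Finset.sum_empty]
    exact hθ
  · obtain ⟨y, hy⟩ := Finset.exists_minimal h
    obtain ⟨hyt, hxy⟩ := Finset.mem_filter.1 hy.1
    have h1 : (t.filter fun z => x < z) = t.filter fun z => y ≤ z := by
      refine Finset.filter_congr fun z hz => ⟨fun hxz => ?_, fun hyz => hxy.trans_le hyz⟩
      by_cases h : z < y
      · exact hy.2 (Finset.mem_filter.2 ⟨hz, hxz⟩) h.le
      · exact ht.le_of_not_lt hz hyt h
    rw [h1]
    by_contra! hcon
    exact hxy.not_ge (hx.2 (Finset.mem_filter.2 ⟨hyt, hcon⟩) hxy.le)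

/-- Rounding a point at a threshold `θ` yields a vertex that depends on the point and `θ` only. Each
vertex of positive weight in one simplex arises in this way, so it is also a vertex of the other. -/
theorem IsKuhn.convexHull_inter_subset [DecidableEq (V → ℝ)] {t t' : Finset (V → ℕ)} (ht : IsKuhn t)
    (ht' : IsKuhn t') :
    convexHull ℝ ((t.map natEmb : Finset (V → ℝ)) : Set (V → ℝ)) ∩
        convexHull ℝ ((t'.map natEmb : Finset (V → ℝ)) : Set (V → ℝ)) ⊆
      convexHull ℝ ((t.map natEmb : Finset (V → ℝ)) ∩ (t'.map natEmb : Finset (V → ℝ)) :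
        Set (V → ℝ)) := by
  classical
  rintro p ⟨hp, hp'⟩
  obtain ⟨w, hw0, hw1, hwp⟩ := mem_convexHull_map_natEmb.1 hp
  obtain ⟨w', hw0', hw1', hwp'⟩ := mem_convexHull_map_natEmb.1 hp'
  have key : ∀ x ∈ t, 0 < w x → x ∈ t' := by
    intro x hx hwx
    have h1 : ∑ y ∈ t with x ≤ y, w y = w x + ∑ y ∈ t with x < y, w y := by
      rw [← Finset.sum_erase_add (a := x) _ _ (Finset.mem_filter.2 ⟨hx, le_rfl⟩), add_comm]
      congr 2
      ext y
      simp only [Finset.mem_erase, Finset.mem_filter, lt_iff_le_and_ne]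
      tauto
    have h0 : 0 ≤ ∑ y ∈ t with x < y, w y :=
      Finset.sum_nonneg fun y hy => hw0 y (Finset.mem_filter.1 hy).1
    have hle : ∑ y ∈ t with x ≤ y, w y ≤ 1 := by
      rw [← hw1]
      exact Finset.sum_le_sum_of_subset_of_nonneg (Finset.filter_subset _ _) fun y hy _ => hw0 y hy
    have h2 := ht.floor_eq hw0 hw1 hx (θ := ∑ y ∈ t with x ≤ y, w y) (by linarith) le_rfl
    obtain ⟨x', hx', h3⟩ := ht'.exists_floor_eq hw0' hw1' (θ := ∑ y ∈ t with x ≤ y, w y)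
      (by linarith) hle
    have : x = x' := by
      funext v
      have h4 := h2 v
      have h5 := h3 v
      rw [hwp] at h4
      rw [hwp', h4] at h5
      exact_mod_cast h5
    rwa [this]
  have hp2 : p = ∑ x ∈ t with 0 < w x, w x • natVec x := by
    funext v
    rw [← hwp v, Finset.sum_apply, Finset.sum_filter_of_ne]
    · rfl
    · intro x hx hne
      refine (hw0 x hx).lt_of_ne' fun h => hne ?_
      simp [h]
  rw [hp2]
  refine (convex_convexHull ℝ _).sum_mem (fun x hx => (Finset.mem_filter.1 hx).2.le) ?_
    fun x hx => subset_convexHull ℝ _ ?_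
  · rw [Finset.sum_filter_of_ne, hw1]
    exact fun x hx hne => (hw0 x hx).lt_of_ne' hne
  · obtain ⟨hxt, hwx⟩ := Finset.mem_filter.1 hx
    exact ⟨Finset.mem_coe.2 (Finset.mem_map_of_mem natEmb hxt),
      Finset.mem_coe.2 (Finset.mem_map_of_mem natEmb (key x hxt hwx))⟩

theorem IsKuhn.eq_zero_of_sum_eq_zero : ∀ (n : ℕ) {t : Finset (V → ℕ)}, t.card = n → IsKuhn t →
    ∀ {c : (V → ℕ) → ℝ}, ∑ x ∈ t, c x = 0 → (∀ v, ∑ x ∈ t, c x * x v = 0) → ∀ x ∈ t, c x = 0 := by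
  classical
  intro n
  induction n with
  | zero =>
    intro t ht _ c _ _ x hx
    rw [Finset.card_eq_zero.1 ht] at hx
    simp at hx
  | succ n ih =>
    intro t htn ht c h0 h1
    have hne : t.Nonempty := Finset.card_pos.1 (by omega)
    obtain ⟨m, hm, hmax⟩ := t.exists_maximal hne
    have hcm : c m = 0 := by
      rcases (t.erase m).eq_empty_or_nonempty with h | h
      · rwa [← Finset.sum_erase_add _ _ hm, h, Finset.sum_empty, zero_add] at h0
      -- Let `m'` be the second largest vertex. In a coordinate where `m` exceeds `m'`, all vertices
      -- but `m` take the value `m v - 1`, which isolates the coefficient of `m`.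
      · obtain ⟨m', hm', hmax'⟩ := Finset.exists_maximal h
        obtain ⟨hmm', hm't⟩ := Finset.mem_erase.1 hm'
        have hlt : m' < m := by
          have : m' ≤ m := ht.le_of_not_lt hm hm't fun h => h.not_ge (hmax hm't h.le)
          exact this.lt_of_ne hmm'
        obtain ⟨-, v, hv⟩ := Pi.lt_def.1 hlt
        have h2 : ∀ y ∈ t.erase m, y v + 1 = m v := by
          intro y hy
          obtain ⟨hym, hyt⟩ := Finset.mem_erase.1 hy
          have h3 : y ≤ m' := (ht.mono (t.erase_subset m)).le_of_not_lt hm' hy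
            fun h => h.not_ge (hmax' hy h.le)
          have h4 : y v ≤ m' v := h3 v
          have h5 : m v ≤ y v + 1 := ht.le_add_one hyt hm v
          omega
        have h3 : ∑ x ∈ t, c x * ((x v : ℝ) - (m v - 1)) = c m := by
          rw [← Finset.sum_erase_add _ _ hm, Finset.sum_eq_zero]
          · ring
          · intro y hy
            rw [← h2 y hy]
            push_cast
            ring
        rw [← h3]
        simp only [mul_sub, Finset.sum_sub_distrib, ← Finset.sum_mul, h1, h0]
        ring
    intro x hx
    by_cases hxm : x = m
    · rw [hxm, hcm]
    · refine ih (t := t.erase m) ?_ (ht.mono (t.erase_subset m)) ?_ ?_ x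
        (Finset.mem_erase.2 ⟨hxm, hx⟩)
      · rw [Finset.card_erase_of_mem hm, htn]; rfl
      · rwa [← Finset.sum_erase_add _ _ hm, hcm, add_zero] at h0
      · intro v
        have := h1 v
        rwa [← Finset.sum_erase_add _ _ hm, hcm, zero_mul, add_zero] at this

theorem IsKuhn.affineIndependent {t : Finset (V → ℕ)} (ht : IsKuhn t) :
    AffineIndependent ℝ (Subtype.val : {e // e ∈ t.map natEmb} → V → ℝ) := by
  classical
  rw [affineIndependent_iff]
  intro u c hc hcu e he
  set c' : (V → ℕ) → ℝ := fun x =>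
    if h : natVec x ∈ t.map natEmb then if (⟨natVec x, h⟩ : (t.map natEmb : Finset (V → ℝ))) ∈ u
      then c ⟨natVec x, h⟩ else 0 else 0 with hc'
  have hsum : ∀ F : (V → ℝ) → ℝ, ∑ x ∈ t, c' x * F (natVec x) = ∑ e ∈ u, c e * F e := by
    intro F
    have h1 : ∑ e : (t.map natEmb : Finset (V → ℝ)), (if e ∈ u then c e else 0) * F e =
        ∑ e ∈ u, c e * F e := by
      simp only [ite_mul, zero_mul, Finset.sum_ite_mem, Finset.univ_inter]
    rw [← h1]
    have h2 : ∑ x ∈ t, c' x * F (natVec x) = ∑ y ∈ t.map natEmb,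
        (if h : y ∈ t.map natEmb then if (⟨y, h⟩ : (t.map natEmb : Finset (V → ℝ))) ∈ u
          then c ⟨y, h⟩ else 0 else 0) * F y := by
      rw [Finset.sum_map]
      rfl
    rw [h2, ← Finset.sum_coe_sort]
    refine Finset.sum_congr rfl fun e _ => ?_
    rw [dif_pos e.2]
  obtain ⟨x, hx, hxe⟩ := Finset.mem_map.1 e.2
  have h0 := IsKuhn.eq_zero_of_sum_eq_zero _ rfl ht (c := c') ?_ ?_ x hx
  · have hx' : natVec x = e.1 := hxe
    simp only [hc', hx', Subtype.coe_eta, dif_pos e.2, if_pos he] at h0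
    exact h0
  · have := hsum fun _ => 1
    simp only [mul_one] at this
    rw [this, hc]
  · intro v
    have := hsum fun y => y v
    simp only [natVec] at this
    rw [this]
    have h3 := congrFun hcu v
    simpa using h3

theorem support_subset_of_mem_convexHull {t : Finset (V → ℕ)} {p : V → ℝ} {A : Set V}
    (hA : ∀ x ∈ t, Function.support (natVec x) ⊆ A)
    (hp : p ∈ convexHull ℝ ((t.map natEmb : Finset (V → ℝ)) : Set (V → ℝ))) :
    Function.support p ⊆ A := by
  obtain ⟨w, hw0, hw1, hwp⟩ := mem_convexHull_map_natEmb.1 hp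
  intro v hv
  rw [Function.mem_support, ← hwp] at hv
  obtain ⟨x, hx, hne⟩ := Finset.exists_ne_zero_of_sum_ne_zero hv
  exact hA x hx (right_ne_zero_of_mul hne)

theorem nonneg_of_mem_convexHull {t : Finset (V → ℕ)} {p : V → ℝ}
    (hp : p ∈ convexHull ℝ ((t.map natEmb : Finset (V → ℝ)) : Set (V → ℝ))) (v : V) : 0 ≤ p v := by
  obtain ⟨w, hw0, hw1, hwp⟩ := mem_convexHull_map_natEmb.1 hp
  rw [← hwp]
  exact Finset.sum_nonneg fun x hx => mul_nonneg (hw0 x hx) (Nat.cast_nonneg _)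

variable [Fintype V]

/-- The point lies on the segment from its integral part to the point where the ray leaves the unit
cube. The latter has fewer nonintegral components; cone its simplex off from the integral part. The
bounds on the vertices keep the enlarged set in one cube and control supports. -/
theorem exists_isKuhn_of_nonneg : ∀ (n : ℕ) {p : V → ℝ}, nonintCount p = n → (∀ v, 0 ≤ p v) →
    ∃ t : Finset (V → ℕ), IsKuhn t ∧ p ∈ convexHull ℝ ((t.map natEmb : Finset (V → ℝ)) : Set (V → ℝ)) ∧
      ∀ x ∈ t, (∀ v, p v = 0 → x v = 0) ∧ floorVec p ≤ x ∧ ∀ v, x v < p v + 1 := by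
  classical
  intro n
  induction n using Nat.strong_induction_on with
  | _ n ih =>
    intro p hn hp
    by_cases hm : maxFrac p = 0
    · have hpe := eq_natVec_of_maxFrac_eq_zero hm
      refine ⟨{floorVec p}, ?_, ?_, ?_⟩
      · intro x hx y hy
        rw [Finset.mem_singleton.1 hx, Finset.mem_singleton.1 hy]
        exact .inl ⟨le_rfl, fun v => Nat.le_succ _⟩
      · rw [Finset.map_singleton, Finset.coe_singleton, convexHull_singleton]
        exact hpe
      · intro x hx
        rw [Finset.mem_singleton.1 hx]
        refine ⟨fun v hv => by simp [floorVec, hv], le_rfl, fun v => ?_⟩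
        have := congrFun hpe v
        rw [natVec] at this
        linarith
    · have hm' : 0 < maxFrac p := (maxFrac_nonneg p).lt_of_ne' hm
      obtain ⟨t, ht, hpt, htp⟩ := ih _ (hn ▸ nonintCount_pushOut_lt hp hm) rfl (pushOut_nonneg hp)
      have hlow : ∀ x ∈ t, floorVec p ≤ x := fun x hx =>
        (floorVec_le_floorVec_pushOut hp).trans (htp x hx).2.1
      have hup : ∀ x ∈ t, x ≤ floorVec p + 1 := by
        intro x hx v
        have h1 := (htp x hx).2.2 v
        have h2 := pushOut_le p v
        have h3 : (x v : ℝ) < ((⌊p v⌋₊ + 1 + 1 : ℕ) : ℝ) := by push_cast; linarith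
        exact Nat.lt_succ_iff.1 (by exact_mod_cast h3)
      refine ⟨insert (floorVec p) t, ?_, ?_, ?_⟩
      · intro x hx y hy
        rcases Finset.mem_insert.1 hx with rfl | hx
        · rcases Finset.mem_insert.1 hy with rfl | hy
          · exact .inl ⟨le_rfl, fun v => Nat.le_succ _⟩
          · exact .inl ⟨hlow y hy, hup y hy⟩
        · rcases Finset.mem_insert.1 hy with rfl | hy
          · exact .inr ⟨hlow x hx, hup x hx⟩
          · exact ht x hx y hy
      · have h1 : p = (1 - maxFrac p) • natVec (floorVec p) + maxFrac p • pushOut p := by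
          funext v
          exact eq_add_smul_pushOut hm v
        have h2 : (1 - maxFrac p) • natVec (floorVec p) + maxFrac p • pushOut p ∈
            convexHull ℝ (((insert (floorVec p) t).map natEmb : Finset (V → ℝ)) : Set (V → ℝ)) := by
          refine convex_convexHull ℝ _ (subset_convexHull ℝ _ ?_) (convexHull_mono ?_ hpt)
            (sub_nonneg.2 (maxFrac_lt_one hp).le) hm'.le (by ring)
          · exact Finset.mem_coe.2 (Finset.mem_map_of_mem natEmb (Finset.mem_insert_self _ _))
          · exact Finset.coe_subset.2 (Finset.map_subset_map.2 (Finset.subset_insert _ _))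
        rwa [← h1] at h2
      · intro x hx
        rcases Finset.mem_insert.1 hx with rfl | hx
        · refine ⟨fun v hv => by simp [floorVec, hv], le_rfl, fun v => ?_⟩
          have := Nat.floor_le (hp v)
          rw [floorVec]
          linarith
        · refine ⟨fun v hv => (htp x hx).1 v ((pushOut_eq_zero_iff hp v).2 hv), hlow x hx, fun v => ?_⟩
          by_cases hfr : fracVec p v = 0
          · have h2 := (htp x hx).2.2 v
            have h3 : pushOut p v = p v := by
              rw [pushOut, hfr, zero_div, add_zero]
              rw [fracVec] at hfr
              linarith
            rwa [h3] at h2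
          · have h2 := hup x hx v
            have h3 : (x v : ℝ) ≤ ⌊p v⌋₊ + 1 := by exact_mod_cast h2
            have h4 := (fracVec_nonneg hp v).lt_of_ne' hfr
            rw [fracVec] at h4
            linarith

/-- The Kuhn triangulation of the open cone over `K`. -/
def kuhnComplex (K : AbstractSimplicialComplex V) : Geometry.SimplicialComplex ℝ (V → ℝ) where
  faces := {s | ∃ t : Finset (V → ℕ), t.Nonempty ∧ IsKuhn t ∧ (∀ x ∈ t, natVec x ∈ openCone K) ∧
    t.map natEmb = s}
  isRelLowerSet_faces := by
    classical
    rintro _ ⟨t, hne, ht, htK, rfl⟩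
    refine ⟨hne.map, fun s hs hsne => ?_⟩
    obtain ⟨t', ht', rfl⟩ := Finset.subset_map_iff.1 hs
    exact ⟨t', Finset.map_nonempty.1 hsne, ht.mono ht', fun x hx => htK x (ht' hx), rfl⟩
  indep := by
    rintro _ ⟨t, hne, ht, htK, rfl⟩
    exact ht.affineIndependent
  inter_subset_convexHull := by
    classical
    rintro _ _ ⟨t, hne, ht, htK, rfl⟩ ⟨t', hne', ht', htK', rfl⟩
    exact ht.convexHull_inter_subset ht'

theorem exists_kuhn_face {K : AbstractSimplicialComplex V} {p : V → ℝ} (hp : p ∈ openCone K) :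
    ∃ s ∈ (kuhnComplex K).faces, p ∈ convexHull ℝ (s : Set (V → ℝ)) ∧
      ∀ x ∈ s, Function.support x ⊆ Function.support p := by
  obtain ⟨t, ht, hpt, htp⟩ := exists_isKuhn_of_nonneg _ rfl hp.1
  have hsupp : ∀ x ∈ t, Function.support (natVec x) ⊆ Function.support p := by
    intro x hx v hv h
    exact hv (by rw [natVec, (htp x hx).1 v h, Nat.cast_zero])
  refine ⟨t.map natEmb, ⟨t, ?_, ht, fun x hx => ?_, rfl⟩, hpt, ?_⟩
  · rw [Finset.nonempty_iff_ne_empty]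
    rintro rfl
    simp at hpt
  · exact mem_openCone_of_support_subset hp (fun _ => Nat.cast_nonneg _) (hsupp x hx)
  · intro y hy
    obtain ⟨x, hx, rfl⟩ := Finset.mem_map.1 hy
    exact hsupp x hx

theorem kuhnComplex_space (K : AbstractSimplicialComplex V) :
    (kuhnComplex K).space = openCone K := by
  ext p
  rw [Geometry.SimplicialComplex.mem_space_iff]
  constructor
  · rintro ⟨_, ⟨t, hne, ht, htK, rfl⟩, hp⟩
    obtain ⟨m, hm, hmax⟩ := t.exists_maximal hne
    -- The top vertex has the largest support, so its face of `K` carries the whole simplex.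
    refine mem_openCone_of_support_subset (htK m hm) (nonneg_of_mem_convexHull hp)
      (support_subset_of_mem_convexHull (fun x hx v hv h => hv ?_) hp)
    have h1 : x ≤ m := ht.le_of_not_lt hm hx fun h => h.not_ge (hmax hx h.le)
    have h2 : x v ≤ m v := h1 v
    have h3 : (m v : ℝ) = 0 := h
    rw [natVec]
    have h4 : m v = 0 := by exact_mod_cast h3
    have h5 : x v = 0 := by omega
    rw [h5, Nat.cast_zero]
  · intro hp
    obtain ⟨s, hs, hps, -⟩ := exists_kuhn_face hp
    exact ⟨s, hs, hps⟩

theorem locallyFinite_kuhnComplex (K : AbstractSimplicialComplex V) :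
    LocallyFinite fun s : (kuhnComplex K).faces =>
      {x : (kuhnComplex K).space | (x : V → ℝ) ∈ convexHull ℝ ((s : Finset (V → ℝ)) : Set (V → ℝ))} := by
  classical
  intro p
  refine ⟨Metric.ball p 1, Metric.ball_mem_nhds p one_pos, ?_⟩
  obtain ⟨B, hB⟩ := exists_nat_gt (‖(p : V → ℝ)‖ + 2)
  have hfin : {s : Finset (V → ℝ) | ∃ t ∈ (Fintype.piFinset fun _ : V => Finset.range B).powerset,
      t.map natEmb = s}.Finite :=
    ((Fintype.piFinset fun _ : V => Finset.range B).powerset.finite_toSet).image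
      (fun t : Finset (V → ℕ) => t.map natEmb)
  refine Set.Finite.of_finite_image (f := Subtype.val) (hfin.subset ?_) Subtype.val_injective.injOn
  rintro _ ⟨⟨_, t, hne, ht, htK, rfl⟩, ⟨q, hq, hqp⟩, rfl⟩
  refine ⟨t, Finset.mem_powerset.2 fun x hx => Fintype.mem_piFinset.2 fun v => ?_, rfl⟩
  obtain ⟨w, hw0, hw1, hwq⟩ := mem_convexHull_map_natEmb.1 hq
  have h1 : (x v : ℝ) ≤ q.1 v + 1 := by
    rw [← hwq v]
    calc (x v : ℝ) = ∑ y ∈ t, w y * x v := by rw [← Finset.sum_mul, hw1, one_mul]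
      _ ≤ ∑ y ∈ t, (w y * y v + w y) := by
        refine Finset.sum_le_sum fun y hy => ?_
        have h2 := ht.le_add_one hy hx v
        have h3 : (x v : ℝ) ≤ y v + 1 := by exact_mod_cast h2
        nlinarith [hw0 y hy]
      _ = _ := by rw [Finset.sum_add_distrib, hw1]
  have h2 : |q.1 v - p.1 v| < 1 :=
    (norm_le_pi_norm (q.1 - p.1) v).trans_lt (dist_eq_norm q.1 p.1 ▸ hqp)
  have h3 : |p.1 v| ≤ ‖(p : V → ℝ)‖ := norm_le_pi_norm p.1 v
  rw [Finset.mem_range]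
  have h4 : (x v : ℝ) < B := by
    have := le_abs_self (p.1 v)
    have := (abs_lt.1 h2).2
    linarith
  exact_mod_cast h4

/-- The Kuhn triangulation of the open cone. -/
noncomputable def kuhnTriangulation (K : AbstractSimplicialComplex V) :
    Triangulation (V → ℝ) (openCone K) where
  complex := kuhnComplex K
  locallyFinite := locallyFinite_kuhnComplex K
  homeo := Homeomorph.setCongr (kuhnComplex_space K)

theorem kuhnTriangulation_isSubcomplex (K : AbstractSimplicialComplex V) (σ : Finset V) :
    (kuhnTriangulation K).IsSubcomplex (simplexCone K σ) := by
  refine ⟨{s | s ∈ (kuhnComplex K).faces ∧ ∀ x ∈ s, Function.support x ⊆ (σ : Set V)},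
    fun s hs => hs.1, ?_⟩
  ext p
  simp only [Set.mem_ofPred_eq, Set.mem_iUnion, exists_prop]
  constructor
  · rintro ⟨h, hp⟩
    have hp' : Function.support p ⊆ (σ : Set V) := hp
    have hpK : p ∈ openCone K := kuhnComplex_space K ▸ h
    obtain ⟨s, hs, hps, hsupp⟩ := exists_kuhn_face hpK
    exact ⟨s, ⟨hs, fun x hx => (hsupp x hx).trans hp'⟩, hps⟩
  · rintro ⟨s, ⟨hs, hsupp⟩, hps⟩
    have h : p ∈ (kuhnComplex K).space := Geometry.SimplicialComplex.mem_space_iff.2 ⟨s, hs, hps⟩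
    refine ⟨h, ?_⟩
    change Function.support p ⊆ (σ : Set V)
    obtain ⟨t, hne, ht, htK, rfl⟩ := hs
    exact support_subset_of_mem_convexHull
      (fun x hx => hsupp _ (Finset.mem_map_of_mem natEmb hx)) hps

end Kuhn

/-! ### Expanding maps on the lattice points of the open cone -/

section LatticeExpanding

variable {Γ : Type*} [Group Γ] {V : Type*}

/-- A proper, Lipschitz, expanding map from the lattice points of the open cone of `K` to `Γ`. -/
structure IsLatticeExpanding (S : Finset Γ) (K : AbstractSimplicialComplex V)
    (f : (V → ℕ) → Γ) : Prop where
  proper : ∀ B : Set Γ, B.Finite → {x | natVec x ∈ openCone K ∧ f x ∈ B}.Finite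
  lipschitz : ∃ C : ℕ, ∀ x y, natVec x ∈ openCone K → natVec y ∈ openCone K → x ≤ y → y ≤ x + 1 →
    wordDist S (f x) (f y) ≤ C
  diverge : ∀ σ ∈ K.faces, ∀ τ ∈ K.faces, Disjoint σ τ → ∀ D : ℕ, ∃ R : ℕ, ∀ x y : V → ℕ,
    Function.support x ⊆ σ → Function.support y ⊆ τ → (∃ v, R < x v) → (∃ v, R < y v) →
      D < wordDist S (f x) (f y)

theorem support_natVec (x : V → ℕ) : Function.support (natVec x) = Function.support x := by
  ext v; simp [natVec]

theorem mem_vertices_kuhnComplex [Fintype V] {K : AbstractSimplicialComplex V} {p : V → ℝ}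
    (hp : p ∈ (kuhnComplex K).vertices) :
    natVec (floorVec p) = p ∧ p ∈ openCone K := by
  obtain ⟨t, hne, -, htK, ht⟩ := hp
  obtain ⟨x, hx⟩ := hne
  have h : natVec x = p := Finset.mem_singleton.1 (ht ▸ Finset.mem_map_of_mem natEmb hx)
  rw [← h, floorVec_natVec]
  exact ⟨rfl, htK x hx⟩

theorem finite_setOf_forall_le [Fintype V] (R : ℕ) : {x : V → ℕ | ∀ v, x v ≤ R}.Finite := by
  classical
  refine (Set.finite_Iic (fun _ : V => R)).subset fun x hx => hx

theorem IsLatticeExpanding.hasExpandingObstructor {V : Type} [Fintype V] [DecidableEq V]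
    {S : Finset Γ} {K : AbstractSimplicialComplex V} {m : ℕ} (hK : IsObstructor K m) {f : (V → ℕ) → Γ}
    (hf : IsLatticeExpanding S K f) : HasExpandingObstructor S m := by
  refine ⟨V, V, inferInstance, inferInstance, inferInstance, K, kuhnTriangulation K, hK,
    fun σ _ => kuhnTriangulation_isSubcomplex K σ, fun a => f (floorVec a.1), ?_⟩
  have hinj : Function.Injective fun a : (kuhnTriangulation K).Vertex => floorVec a.1 := by
    intro a b hab
    apply Subtype.ext
    rw [← (mem_vertices_kuhnComplex a.2).1, ← (mem_vertices_kuhnComplex b.2).1]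
    exact congrArg natVec hab
  constructor
  · intro B hB
    refine ((hf.proper B hB).preimage hinj.injOn).subset fun a ha => ⟨?_, ha⟩
    rw [(mem_vertices_kuhnComplex a.2).1]
    exact (mem_vertices_kuhnComplex a.2).2
  · obtain ⟨C, hC⟩ := hf.lipschitz
    refine ⟨C, fun a b hab => ?_⟩
    obtain ⟨s, ⟨t, -, ht, htK, rfl⟩, -, hs⟩ := hab
    have hmem : ∀ p ∈ ((t.map natEmb : Finset (V → ℝ)) : Set (V → ℝ)), floorVec p ∈ t := by
      intro p hp
      obtain ⟨x, hx, rfl⟩ := Finset.mem_map.1 (Finset.mem_coe.1 hp)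
      change floorVec (natVec x) ∈ t
      rwa [floorVec_natVec]
    have ha : floorVec a.1 ∈ t := hmem _ (hs ▸ Set.mem_insert _ _)
    have hb : floorVec b.1 ∈ t := hmem _ (hs ▸ Set.mem_insert_of_mem _ rfl)
    rcases ht _ ha _ hb with h | h
    · exact hC _ _ (htK _ ha) (htK _ hb) h.1 h.2
    · rw [wordDist_comm]
      exact hC _ _ (htK _ hb) (htK _ ha) h.1 h.2
  · intro σ hσ τ hτ hστ D
    obtain ⟨R, hR⟩ := hf.diverge σ hσ τ hτ hστ D
    have hfin := (finite_setOf_forall_le (V := V) R).preimage hinj.injOn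
    refine ⟨_, _, hfin, hfin, fun a ha b hb => ?_⟩
    have hsupp : ∀ (ρ : Finset V) (c : (kuhnTriangulation K).Vertex),
        c ∈ (kuhnTriangulation K).verticesIn (simplexCone K ρ) →
        Function.support (floorVec c.1) ⊆ ρ := by
      rintro ρ c ⟨h, hc⟩
      rw [← support_natVec, (mem_vertices_kuhnComplex c.2).1]
      exact hc
    refine hR _ _ (hsupp σ a ha.1) (hsupp τ b hb.1) ?_ ?_
    · by_contra! h
      exact ha.2 h
    · by_contra! h
      exact hb.2 h

end LatticeExpanding

/-! ### Coarsely continuous expanding maps on the open cone -/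

section CoarseExpanding

open Topology Filter

variable {Γ : Type*} [Group Γ] {V : Type*}

/-- A proper, coarsely continuous, expanding map from the open cone of `K` to `Γ`. -/
structure IsCoarseExpanding [Fintype V] (S : Finset Γ) (K : AbstractSimplicialComplex V)
    (F : (V → ℝ) → Γ) : Prop where
  proper : ∀ B : Set Γ, B.Finite → ∃ R : ℝ, ∀ p ∈ openCone K, F p ∈ B → ‖p‖ ≤ R
  coarselyContinuous : ∃ M : ℕ, ∀ p ∈ openCone K, ∀ᶠ q in 𝓝[openCone K] p,
    wordDist S (F p) (F q) ≤ M
  diverge : ∀ σ ∈ K.faces, ∀ τ ∈ K.faces, Disjoint σ τ → ∀ D : ℕ, ∃ R : ℝ,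
    ∀ p ∈ openCone K, ∀ q ∈ openCone K, Function.support p ⊆ σ → Function.support q ⊆ τ →
      R < ‖p‖ → R < ‖q‖ → D < wordDist S (F p) (F q)

/-- A minimal face through the point: it is contained in any other such face, since its intersection
with that face is again a face through the point. -/
theorem exists_carrier {E : Type*} [AddCommGroup E] [Module ℝ E]
    (C : Geometry.SimplicialComplex ℝ E) {x : E} (hx : x ∈ C.space) :
    ∃ e ∈ C.faces, x ∈ convexHull ℝ (e : Set E) ∧
      ∀ s ∈ C.faces, x ∈ convexHull ℝ (s : Set E) → e ⊆ s := by
  classical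
  obtain ⟨s, hs, hxs⟩ := Geometry.SimplicialComplex.mem_space_iff.1 hx
  obtain ⟨e, ⟨he, hxe⟩, hmin⟩ := exists_minimal_of_wellFoundedLT
    (fun e : Finset E => e ∈ C.faces ∧ x ∈ convexHull ℝ (e : Set E)) ⟨s, hs, hxs⟩
  refine ⟨e, he, hxe, fun s hs hxs => ?_⟩
  have h := C.inter_subset_convexHull he hs ⟨hxe, hxs⟩
  rw [← Finset.coe_inter] at h
  have hne : (e ∩ s).Nonempty := by
    rw [← Finset.coe_nonempty]
    exact convexHull_nonempty_iff.1 ⟨x, h⟩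
  have h2 := hmin (y := e ∩ s)
    ⟨(C.isRelLowerSet_faces he).2 Finset.inter_subset_left hne, h⟩ Finset.inter_subset_left
  exact h2.trans Finset.inter_subset_right

/-- Send a point to the value at a vertex of its carrier. Choosing the vertex in the carrier keeps
the points of each subcomplex `cone(σ)` inside it, so divergence carries over. -/
theorem IsExpanding.exists_isCoarseExpanding [Fintype V] {S : Finset Γ} {E : Type*} [NormedAddCommGroup E] [NormedSpace ℝ E]
    {K : AbstractSimplicialComplex V} {T : Triangulation E (openCone K)}
    (hT : ∀ σ ∈ K.faces, T.IsSubcomplex (simplexCone K σ)) {f : T.Vertex → Γ}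
    (hf : IsExpanding S K T f) : ∃ F, IsCoarseExpanding S K F := by
  classical
  choose e he hxe hmin using fun x : T.complex.space => exists_carrier T.complex x.2
  have hvert : ∀ s ∈ T.complex.faces, ∀ a ∈ s, a ∈ T.complex.vertices := fun s hs a ha =>
    (T.complex.isRelLowerSet_faces hs).2 (Finset.singleton_subset_iff.2 ha)
      (Finset.singleton_nonempty a)
  choose a ha using fun x : T.complex.space => (T.complex.isRelLowerSet_faces (he x)).1
  have hav : ∀ x, a x ∈ T.complex.vertices := fun x => hvert _ (he x) _ (ha x)
  set g : openCone K → T.Vertex := fun p => ⟨a (T.homeo.symm p), hav _⟩ with hg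
  have hcompact : ∀ s : Finset E, s ∈ T.complex.faces →
      IsCompact {x : T.complex.space | (x : E) ∈ convexHull ℝ (s : Set E)} := by
    intro s hs
    refine Topology.IsInducing.subtypeVal.isCompact_preimage_iff ?_ |>.2
      (s.finite_toSet.isCompact_convexHull ℝ)
    rw [Subtype.range_coe]
    exact Geometry.SimplicialComplex.convexHull_subset_space hs
  have hbdd : ∀ A : Set T.Vertex, A.Finite → ∃ R : ℝ, ∀ p, g p ∈ A → ‖(p : V → ℝ)‖ ≤ R := by
    intro A hA
    have hfin : (⋃ b ∈ A, {s : T.complex.faces | b.1 ∈ (s : Finset E)}).Finite := by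
      refine hA.biUnion fun b _ => ?_
      have hb : b.1 ∈ T.complex.space := Geometry.SimplicialComplex.vertices_subset_space b.2
      refine (T.locallyFinite.point_finite ⟨b.1, hb⟩).subset fun s hs => ?_
      exact subset_convexHull ℝ _ (Finset.mem_coe.2 hs)
    have hc := hfin.isCompact_biUnion fun s _ => hcompact s.1 s.2
    obtain ⟨R, hR⟩ := (hc.image (continuous_subtype_val.comp T.homeo.continuous)).isBounded.exists_norm_le
    refine ⟨R, fun p hp => hR _ ⟨T.homeo.symm p, ?_, ?_⟩⟩
    · simp only [Set.mem_iUnion]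
      exact ⟨⟨e (T.homeo.symm p), he _⟩, ⟨g p, hp, ha _⟩, hxe _⟩
    · simp
  have hin : ∀ σ ∈ K.faces, ∀ p : openCone K, Function.support (p : V → ℝ) ⊆ σ →
      g p ∈ T.verticesIn (simplexCone K σ) := by
    intro σ hσ p hp
    obtain ⟨F, hF, hFeq⟩ := hT σ hσ
    have h1 : (T.homeo.symm p : E) ∈ ⋃ s ∈ F, convexHull ℝ (s : Set E) := by
      rw [← hFeq]
      refine ⟨(T.homeo.symm p).2, ?_⟩
      rw [Subtype.coe_eta, T.homeo.apply_symm_apply]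
      exact hp
    simp only [Set.mem_iUnion] at h1
    obtain ⟨s, hs, hps⟩ := h1
    have h2 : (g p).1 ∈ ⋃ s ∈ F, convexHull ℝ (s : Set E) := by
      simp only [Set.mem_iUnion]
      exact ⟨s, hs, subset_convexHull ℝ _ (hmin _ s (hF hs) hps (ha _))⟩
    rw [← hFeq] at h2
    exact h2
  refine ⟨fun p => if h : p ∈ openCone K then f (g ⟨p, h⟩) else 1, ?_, ?_, ?_⟩
  · intro B hB
    obtain ⟨R, hR⟩ := hbdd _ (hf.proper B hB)
    refine ⟨R, fun p hp hpB => hR ⟨p, hp⟩ ?_⟩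
    simp only [dif_pos hp] at hpB
    exact hpB
  · obtain ⟨C, hC⟩ := hf.lipschitz
    refine ⟨C, fun p hp => ?_⟩
    have h1 := T.locallyFinite.eventually_subset (fun s => (hcompact s.1 s.2).isClosed)
      (T.homeo.symm ⟨p, hp⟩)
    have h2 : ∀ᶠ q : openCone K in 𝓝 ⟨p, hp⟩, wordDist S (f (g ⟨p, hp⟩)) (f (g q)) ≤ C := by
      have h3 := T.homeo.symm.continuous.continuousAt.eventually h1
      filter_upwards [h3] with q hq
      -- By local finiteness every face through a point near `p` contains `p`; so carriers only grow
      -- nearby, and the two chosen vertices span an edge or agree.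
      have h4 : e (T.homeo.symm ⟨p, hp⟩) ⊆ e (T.homeo.symm q) :=
        hmin _ _ (he _) (hq (a := ⟨e (T.homeo.symm q), he _⟩) (hxe _))
      by_cases hab : g ⟨p, hp⟩ = g q
      · rw [hab, wordDist_self]
        exact Nat.zero_le _
      · have hne : a (T.homeo.symm ⟨p, hp⟩) ≠ a (T.homeo.symm q) := fun h => hab (Subtype.ext h)
        refine hC _ _ ⟨{a (T.homeo.symm ⟨p, hp⟩), a (T.homeo.symm q)}, ?_, ?_, ?_⟩
        · refine (T.complex.isRelLowerSet_faces (he (T.homeo.symm q))).2 ?_ (Finset.insert_nonempty _ _)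
          intro b hb
          rcases Finset.mem_insert.1 hb with rfl | hb
          · exact h4 (ha _)
          · rw [Finset.mem_singleton.1 hb]
            exact ha _
        · exact Finset.card_pair hne
        · simp [hg]
    rw [eventually_nhdsWithin_iff]
    rw [nhds_subtype_eq_comap, eventually_comap] at h2
    filter_upwards [h2] with q hq hqK
    rw [dif_pos hp, dif_pos hqK]
    exact hq ⟨q, hqK⟩ rfl
  · intro σ hσ τ hτ hστ D
    obtain ⟨C₁, C₂, hC₁, hC₂, h⟩ := hf.diverge σ hσ τ hτ hστ D
    obtain ⟨R, hR⟩ := hbdd _ (hC₁.union hC₂)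
    refine ⟨R, fun p hp q hq hpσ hqτ hpR hqR => ?_⟩
    rw [dif_pos hp, dif_pos hq]
    refine h _ ⟨hin σ hσ _ hpσ, fun hc => ?_⟩ _ ⟨hin τ hτ _ hqτ, fun hc => ?_⟩
    · exact hpR.not_ge (hR ⟨p, hp⟩ (.inl hc))
    · exact hqR.not_ge (hR ⟨q, hq⟩ (.inr hc))

end CoarseExpanding

/-! ### Slow radial reparametrization: from coarse continuity to Lipschitz maps -/

section Reparametrization

open Topology Filter

/-- For every positive nonincreasing function there is an unbounded nondecreasing sequence, whose
increments and whose averages are controlled by that function. -/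
theorem exists_slow_sequence {ε : ℕ → ℝ} (hε : ∀ n, 0 < ε n) (hε1 : ∀ n, ε n ≤ 1)
    (hanti : Antitone ε) : ∃ r : ℕ → ℝ, r 0 = 0 ∧ Monotone r ∧ Tendsto r atTop atTop ∧
      ∀ k, ∃ N : ℕ, r (k + 1) ≤ N ∧ r (k + 1) - r k ≤ ε N / 4 ∧ r k ≤ k * (ε N / 4) ∧
        r (k + 1) ≤ (k + 1) * (ε N / 4) := by
  classical
  set N : ℝ → ℕ := fun x => ⌈x⌉₊ + 1 with hN
  -- The sequence advances only when the average bound would survive. An increment is at most 1 and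
  -- raises `N` by at most 1, so testing `x + 1` against `ε (N x + 1)` is safe.
  set r : ℕ → ℝ := fun k => Nat.rec 0 (fun k x =>
    if x + 1 ≤ (k + 1) * (ε (N x + 1) / 4) then x + ε (N x) / 4 else x) k with hr
  have hr0 : r 0 = 0 := rfl
  have hrs : ∀ k, r (k + 1) = if r k + 1 ≤ (k + 1) * (ε (N (r k) + 1) / 4) then
    r k + ε (N (r k)) / 4 else r k := fun k => rfl
  have hstep : ∀ k, r k ≤ r (k + 1) ∧ r (k + 1) ≤ r k + ε (N (r k)) / 4 := by
    intro k
    have := hε (N (r k))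
    rw [hrs]
    split_ifs
    · exact ⟨by linarith, le_rfl⟩
    · exact ⟨le_rfl, by linarith⟩
  have hmono : Monotone r := monotone_nat_of_le_succ fun k => (hstep k).1
  have hnn : ∀ k, 0 ≤ r k := fun k => hr0 ▸ hmono (Nat.zero_le k)
  have hNmono : Monotone N := fun x y h => Nat.succ_le_succ (Nat.ceil_mono h)
  have hNs : ∀ k, N (r (k + 1)) ≤ N (r k) + 1 := by
    intro k
    have h1 : r (k + 1) ≤ r k + 1 := (hstep k).2.trans (by linarith [hε1 (N (r k))])
    have h2 := hNmono h1
    simp only [hN] at h2 ⊢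
    rwa [Nat.ceil_add_one (hnn k)] at h2
  have hinv : ∀ k : ℕ, r k ≤ k * (ε (N (r k)) / 4) := by
    intro k
    induction k with
    | zero => simp [hr0]
    | succ k ih =>
      by_cases h : r k + 1 ≤ (k + 1) * (ε (N (r k) + 1) / 4)
      · have h1 := hanti (hNs k)
        have h2 : r (k + 1) ≤ r k + 1 := (hstep k).2.trans (by linarith [hε1 (N (r k))])
        refine h2.trans (h.trans ?_)
        push_cast
        gcongr
      · have h1 : r (k + 1) = r k := by rw [hrs, if_neg h]
        rw [h1]
        refine ih.trans ?_
        have := hε (N (r k))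
        gcongr
        simp
  refine ⟨r, hr0, hmono, ?_, fun k => ⟨N (r k), ?_, ?_, hinv k, ?_⟩⟩
  · rw [tendsto_atTop_atTop_iff_of_monotone hmono]
    by_contra! hB
    obtain ⟨b, hB⟩ := hB
    set e := ε (N b + 1) with he
    have he0 : 0 < e := hε _
    have hle : ∀ k, e ≤ ε (N (r k) + 1) := fun k => hanti (Nat.succ_le_succ (hNmono (hB k).le))
    -- If `r` stayed below `b`, the test would succeed at every index from `k₀` on, and each step
    -- would add at least `e / 4`.
    obtain ⟨k₀, hk₀⟩ := exists_nat_gt ((b + 1) / (e / 4))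
    rw [div_lt_iff₀ (by positivity)] at hk₀
    have hinc : ∀ j : ℕ, (j : ℝ) * (e / 4) ≤ r (k₀ + j) := by
      intro j
      induction j with
      | zero => simpa using hnn _
      | succ j ih =>
        have h1 : r (k₀ + j) + 1 ≤ ((k₀ + j : ℕ) + 1) * (ε (N (r (k₀ + j)) + 1) / 4) := by
          have h2 : (k₀ : ℝ) * (e / 4) ≤ ((k₀ + j : ℕ) + 1) * (ε (N (r (k₀ + j)) + 1) / 4) := by
            have := hle (k₀ + j)
            gcongr
            push_cast
            linarith [(Nat.cast_nonneg j : (0 : ℝ) ≤ j)]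
          linarith [hB (k₀ + j)]
        have h3 : r (k₀ + (j + 1)) = r (k₀ + j) + ε (N (r (k₀ + j))) / 4 := by
          rw [← add_assoc, hrs, if_pos h1]
        have h4 : e ≤ ε (N (r (k₀ + j))) := (hle _).trans (hanti (Nat.le_succ _))
        rw [h3]
        push_cast
        linarith
    obtain ⟨j, hj⟩ := exists_nat_gt (b / (e / 4))
    rw [div_lt_iff₀ (by positivity)] at hj
    linarith [hinc j, hB (k₀ + j)]
  · have h1 : r (k + 1) ≤ r k + 1 := (hstep k).2.trans (by linarith [hε1 (N (r k))])
    have h2 := Nat.le_ceil (r k)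
    simp only [hN]
    push_cast
    linarith
  · linarith [(hstep k).2]
  · have h1 := hinv (k + 1)
    have h2 := hanti (hNmono (hstep k).1)
    refine h1.trans ?_
    push_cast
    gcongr

variable {V : Type*} [Fintype V]

theorem isClosed_openCone (K : AbstractSimplicialComplex V) : IsClosed (openCone K) := by
  classical
  have h : openCone K = {0} ∪ ⋃ σ : {σ // σ ∈ K.faces}, Set.univ.pi fun v : V =>
      if v ∈ σ.1 then Set.Ici (0 : ℝ) else {0} := by
    ext x
    simp only [Set.mem_union, Set.mem_singleton_iff, Set.mem_iUnion, Set.mem_univ_pi]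
    constructor
    · rintro ⟨hx, rfl | ⟨σ, hσ, hxσ⟩⟩
      · exact .inl rfl
      · refine .inr ⟨⟨σ, hσ⟩, fun v => ?_⟩
        split_ifs with h
        · exact hx v
        · by_contra h0
          exact h (Finset.mem_coe.1 (hxσ ▸ h0))
    · rintro (rfl | ⟨⟨σ, hσ⟩, h⟩)
      · exact ⟨fun _ => le_rfl, .inl rfl⟩
      · refine mem_openCone_of_support_subset_face hσ (fun v => ?_) fun v hv => ?_
        · have := h v
          split_ifs at this
          · exact this
          · exact le_of_eq (Set.mem_singleton_iff.1 this).symm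
        · by_contra hv'
          have h1 : v ∉ σ := hv'
          have h2 : x v ∈ if v ∈ σ then Set.Ici (0 : ℝ) else {0} := h v
          rw [if_neg h1] at h2
          exact hv h2
  rw [h]
  refine isClosed_singleton.union (isClosed_iUnion_of_finite fun σ => isClosed_set_pi fun v _ => ?_)
  split_ifs
  · exact isClosed_Ici
  · exact isClosed_singleton

variable {Γ : Type*} [Group Γ]

/-- Bounded parts of the closed cone are compact. Nearby points lie in a common ball whose centre's
image is within `M` of both images, hence the bound `M + M`. -/
theorem exists_lebesgue_number {S : Finset Γ} (hS : Subgroup.closure (S : Set Γ) = ⊤)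
    {K : AbstractSimplicialComplex V} {F : (V → ℝ) → Γ} {M : ℕ}
    (hM : ∀ p ∈ openCone K, ∀ᶠ q in 𝓝[openCone K] p, wordDist S (F p) (F q) ≤ M) (R : ℝ) :
    ∃ δ > 0, ∀ p ∈ openCone K, ∀ q ∈ openCone K, ‖p‖ ≤ R → dist p q < δ →
      wordDist S (F p) (F q) ≤ M + M := by
  have hc : IsCompact (Metric.closedBall 0 R ∩ openCone K) :=
    (isCompact_closedBall 0 R).inter_right (isClosed_openCone K)
  have h : ∀ p : openCone K, ∃ ρ > 0, ∀ q ∈ openCone K, dist q p < ρ →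
      wordDist S (F p) (F q) ≤ M := by
    intro p
    obtain ⟨ρ, hρ, h⟩ := Metric.nhdsWithin_basis_ball.eventually_iff.1 (hM p p.2)
    exact ⟨ρ, hρ, fun q hq hqp => h ⟨hqp, hq⟩⟩
  choose ρ hρ hρM using h
  obtain ⟨δ, hδ, hδM⟩ := lebesgue_number_lemma_of_metric hc
    (c := fun p : openCone K => Metric.ball p.1 (ρ p)) (fun _ => Metric.isOpen_ball)
    (fun p hp => Set.mem_iUnion.2 ⟨⟨p, hp.2⟩, Metric.mem_ball_self (hρ _)⟩)
  refine ⟨δ, hδ, fun p hp q hq hpR hpq => ?_⟩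
  obtain ⟨c, hcδ⟩ := hδM p ⟨by simpa using hpR, hp⟩
  have h1 := hρM c p hp (hcδ (Metric.mem_ball_self hδ))
  have h2 := hρM c q hq (hcδ (by rwa [Metric.mem_ball, dist_comm]))
  rw [wordDist_comm] at h1
  exact (wordDist_triangle hS _ _ _).trans (Nat.add_le_add h1 h2)

/-- The multiple of the lattice point `x` whose norm is `r ‖x‖`. -/
noncomputable def rescale (r : ℕ → ℝ) (x : V → ℕ) : V → ℝ :=
  (r (Finset.univ.sup x) / (Finset.univ.sup x : ℕ)) • natVec x

theorem norm_natVec (x : V → ℕ) : ‖natVec x‖ = (Finset.univ.sup x : ℕ) := by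
  apply le_antisymm
  · rw [pi_norm_le_iff_of_nonneg (Nat.cast_nonneg _)]
    intro v
    rw [natVec, Real.norm_of_nonneg (Nat.cast_nonneg _)]
    exact_mod_cast Finset.le_sup (f := x) (Finset.mem_univ v)
  · rcases isEmpty_or_nonempty V with h | h
    · simp
    · obtain ⟨v, -, hv⟩ := Finset.exists_mem_eq_sup Finset.univ Finset.univ_nonempty x
      rw [hv]
      exact (le_abs_self _).trans (norm_le_pi_norm (natVec x) v)

theorem norm_rescale {r : ℕ → ℝ} (h0 : r 0 = 0) (hr : ∀ k, 0 ≤ r k) (x : V → ℕ) :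
    ‖rescale r x‖ = r (Finset.univ.sup x) := by
  rw [rescale, norm_smul, norm_natVec, Real.norm_of_nonneg (div_nonneg (hr _) (Nat.cast_nonneg _))]
  rcases Nat.eq_zero_or_pos (Finset.univ.sup x) with h | h
  · simp [h, h0]
  · field_simp

theorem support_rescale_subset (r : ℕ → ℝ) (x : V → ℕ) :
    Function.support (rescale r x) ⊆ Function.support x := by
  intro v hv h
  simp [rescale, natVec, h] at hv

theorem rescale_mem_openCone {K : AbstractSimplicialComplex V} {r : ℕ → ℝ} (hr : ∀ k, 0 ≤ r k)
    {x : V → ℕ} (hx : natVec x ∈ openCone K) : rescale r x ∈ openCone K := by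
  refine mem_openCone_of_support_subset hx (fun v => ?_) ?_
  · exact mul_nonneg (div_nonneg (hr _) (Nat.cast_nonneg _)) (Nat.cast_nonneg _)
  · rw [support_natVec]
    exact support_rescale_subset r x

theorem norm_natVec_sub_le {x y : V → ℕ} (hxy : x ≤ y) (hyx : y ≤ x + 1) :
    ‖natVec x - natVec y‖ ≤ 1 := by
  rw [pi_norm_le_iff_of_nonneg zero_le_one]
  intro v
  have h1 : (x v : ℝ) ≤ y v := by exact_mod_cast hxy v
  have h2 : (y v : ℝ) ≤ x v + 1 := by exact_mod_cast hyx v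
  rw [Pi.sub_apply, natVec, natVec, Real.norm_eq_abs, abs_le]
  exact ⟨by linarith, by linarith⟩

theorem dist_rescale_lt {ε : ℕ → ℝ} (hε : ∀ n, 0 < ε n) {r : ℕ → ℝ} (h0 : r 0 = 0)
    (hmono : Monotone r)
    {k N : ℕ} (h1 : r (k + 1) - r k ≤ ε N / 4) (h2 : r k ≤ k * (ε N / 4))
    (h3 : r (k + 1) ≤ (k + 1) * (ε N / 4)) {x y : V → ℕ} (hxk : Finset.univ.sup x = k)
    (hxy : x ≤ y) (hyx : y ≤ x + 1) : dist (rescale r x) (rescale r y) < ε N := by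
  have hr : ∀ k, 0 ≤ r k := fun k => h0 ▸ hmono (Nat.zero_le k)
  have hn := norm_natVec_sub_le hxy hyx
  have hl : Finset.univ.sup x ≤ Finset.univ.sup y := Finset.sup_mono_fun fun v _ => hxy v
  have hl' : Finset.univ.sup y ≤ Finset.univ.sup x + 1 := Finset.sup_le fun v _ =>
    (hyx v).trans (Nat.succ_le_succ (Finset.le_sup (f := x) (Finset.mem_univ v)))
  have ha : r k / k ≤ ε N / 4 := div_le_of_le_mul₀ (Nat.cast_nonneg _) (by linarith [hε N])
    (by linarith)
  have ha0 : 0 ≤ r k / k := div_nonneg (hr _) (Nat.cast_nonneg _)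
  have hεN := hε N
  rw [dist_eq_norm]
  rcases hl.eq_or_lt with h | h
  · have h4 : rescale r x - rescale r y = (r k / k) • (natVec x - natVec y) := by
      rw [rescale, rescale, ← h, hxk, smul_sub]
    rw [h4, norm_smul, Real.norm_of_nonneg ha0]
    nlinarith
  · have hy : Finset.univ.sup y = k + 1 := by omega
    set b := r (k + 1) / ((k + 1 : ℕ) : ℝ) with hb
    have hkb : r (k + 1) = (k + 1) * b := by
      rw [hb]; push_cast; field_simp
    have hka : r k = k * (r k / k) := by
      rcases Nat.eq_zero_or_pos k with rfl | hk
      · simp [h0]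
      · field_simp
    have hb0 : 0 ≤ b := div_nonneg (hr _) (Nat.cast_nonneg _)
    have hbε : b ≤ ε N / 4 := div_le_of_le_mul₀ (Nat.cast_nonneg _) (by linarith)
      (by push_cast; linarith)
    -- Split into a radial part, of norm at most `2 ε / 4`, and a displacement of the lattice point
    -- scaled by `b`, of norm at most `ε / 4`.
    have h4 : rescale r x - rescale r y =
        (r k / k - b) • natVec x + b • (natVec x - natVec y) := by
      rw [rescale, rescale, hy, hxk, smul_sub, sub_smul]
      abel
    have h5 : ‖(r k / k - b) • natVec x‖ ≤ 2 * (ε N / 4) := by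
      have h7 : |r k / k - b| * k = |(r k / k - b) * k| := by
        rw [abs_mul, abs_of_nonneg (Nat.cast_nonneg (α := ℝ) k)]
      rw [norm_smul, norm_natVec, hxk, Real.norm_eq_abs, h7, sub_mul, abs_le]
      have h6 := hmono (Nat.le_succ k)
      rw [Nat.succ_eq_add_one] at h6
      constructor <;> nlinarith
    have h6 : ‖b • (natVec x - natVec y)‖ ≤ ε N / 4 := by
      rw [norm_smul, Real.norm_of_nonneg hb0]
      nlinarith
    rw [h4]
    linarith [norm_add_le ((r k / k - b) • natVec x) (b • (natVec x - natVec y))]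

theorem IsCoarseExpanding.exists_isLatticeExpanding {S : Finset Γ}
    (hS : Subgroup.closure (S : Set Γ) = ⊤) {K : AbstractSimplicialComplex V} {F : (V → ℝ) → Γ}
    (hF : IsCoarseExpanding S K F) : ∃ f, IsLatticeExpanding S K f := by
  obtain ⟨M, hM⟩ := hF.coarselyContinuous
  choose δ hδ hδM using fun n : ℕ => exists_lebesgue_number hS hM (n : ℝ)
  -- Running minima make the scale nonincreasing, and it is capped at 1, as the slow sequence
  -- requires.
  set ε : ℕ → ℝ := fun n => min 1 ((Finset.range (n + 1)).inf' Finset.nonempty_range_add_one δ) with hε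
  have hε0 : ∀ n, 0 < ε n := fun n => lt_min one_pos <| by
    rw [Finset.lt_inf'_iff]
    exact fun i _ => hδ i
  have hanti : Antitone ε := fun m n h => min_le_min le_rfl
    (Finset.inf'_mono _ (Finset.range_mono (Nat.succ_le_succ h)) _)
  have hεδ : ∀ n, ε n ≤ δ n := fun n =>
    (min_le_right _ _).trans (Finset.inf'_le _ (Finset.self_mem_range_succ n))
  obtain ⟨r, h0, hmono, htend, hr⟩ := exists_slow_sequence hε0 (fun n => min_le_left _ _) hanti
  have hnn : ∀ k, 0 ≤ r k := fun k => h0 ▸ hmono (Nat.zero_le k)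
  refine ⟨fun x => F (rescale r x), ?_, ⟨M + M, fun x y hx hy hxy hyx => ?_⟩, ?_⟩
  · intro B hB
    obtain ⟨R, hR⟩ := hF.proper B hB
    obtain ⟨k, hk⟩ := (htend.eventually_gt_atTop R).exists
    refine (finite_setOf_forall_le k).subset fun x hx v => ?_
    have h1 := hR _ (rescale_mem_openCone hnn hx.1) hx.2
    rw [norm_rescale h0 hnn] at h1
    by_contra! h2
    have h3 : k ≤ Finset.univ.sup x := h2.le.trans (Finset.le_sup (Finset.mem_univ v))
    linarith [hmono h3]
  · obtain ⟨N, hN, h1, h2, h3⟩ := hr (Finset.univ.sup x)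
    refine hδM N _ (rescale_mem_openCone hnn hx) _ (rescale_mem_openCone hnn hy) ?_ ?_
    · rw [norm_rescale h0 hnn]
      exact (hmono (Nat.le_succ _)).trans hN
    · exact (dist_rescale_lt hε0 h0 hmono h1 h2 h3 rfl hxy hyx).trans_le (hεδ N)
  · intro σ hσ τ hτ hστ D
    obtain ⟨R, hR⟩ := hF.diverge σ hσ τ hτ hστ D
    obtain ⟨k, hk⟩ := (htend.eventually_gt_atTop R).exists
    have key : ∀ x : V → ℕ, (∃ v, k < x v) → R < ‖rescale r x‖ := by
      rintro x ⟨v, hv⟩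
      rw [norm_rescale h0 hnn]
      exact hk.trans_le (hmono (hv.le.trans (Finset.le_sup (Finset.mem_univ v))))
    have hcone : ∀ ρ ∈ K.faces, ∀ x : V → ℕ, Function.support x ⊆ ρ → natVec x ∈ openCone K :=
      fun ρ hρ x hx => mem_openCone_of_support_subset_face hρ (fun _ => Nat.cast_nonneg _)
        (support_natVec x ▸ hx)
    refine ⟨k, fun x y hx hy hxk hyk => hR _ (rescale_mem_openCone hnn (hcone σ hσ x hx)) _
      (rescale_mem_openCone hnn (hcone τ hτ y hy)) ?_ ?_ (key x hxk) (key y hyk)⟩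
    · exact (support_rescale_subset r x).trans hx
    · exact (support_rescale_subset r y).trans hy

end Reparametrization

/-! ### Extending a map from the lattice points to the open cone -/

section Interpolation

open Topology Filter

/-- Paths in the fibres of `π`, the path from `a` towards `b` lying in the fibre of `a` and ending
close to `b` if the fibres are close. -/
structure IsFibrewisePath {Γ Q : Type*} [Group Γ] [Group Q] (S : Finset Γ) (S' : Finset Q)
    (π : Γ → Q) (Ψ : Γ → Γ → ℝ → Γ) : Prop where
  zero : ∀ a b, Ψ a b 0 = a
  proj : ∀ a b t, π (Ψ a b t) = π a
  one : ∀ D : ℕ, ∃ C : ℕ, ∀ a b, wordDist S' (π a) (π b) ≤ D → wordDist S (Ψ a b 1) b ≤ C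
  bounded : ∀ R : ℕ, ∃ C : ℕ, ∀ a b, wordDist S a b ≤ R → ∀ t, wordDist S a (Ψ a b t) ≤ C
  steps : ∃ M : ℕ, ∀ a b, ∃ ε > 0, ∀ t ∈ Set.Icc (0 : ℝ) 1, ∀ t' ∈ Set.Icc (0 : ℝ) 1, |t - t'| < ε →
    wordDist S (Ψ a b t) (Ψ a b t') ≤ M
  stable : ∀ D R : ℕ, ∃ C : ℕ, ∀ a b b', wordDist S' (π a) (π b) ≤ D →
    wordDist S' (π a) (π b') ≤ D → wordDist S b b' ≤ R → ∀ t, wordDist S (Ψ a b t) (Ψ a b' t) ≤ C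

variable {Γ Q : Type*} [Group Γ] [Group Q] {S : Finset Γ} {S' : Finset Q} {π : Γ → Q}
  {Ψ : Γ → Γ → ℝ → Γ}

/-- The time scale of a path may depend on its endpoints; near a given point of the cone only
finitely many endpoints occur. -/
theorem exists_common_step {M : ℕ} (hM : ∀ a b, ∃ ε > 0, ∀ t ∈ Set.Icc (0 : ℝ) 1,
      ∀ t' ∈ Set.Icc (0 : ℝ) 1, |t - t'| < ε → wordDist S (Ψ a b t) (Ψ a b t') ≤ M)
    {A B : Set Γ} (hA : A.Finite) (hB : B.Finite) :
    ∃ ε > 0, ∀ a ∈ A, ∀ b ∈ B, ∀ t ∈ Set.Icc (0 : ℝ) 1, ∀ t' ∈ Set.Icc (0 : ℝ) 1, |t - t'| < ε →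
      wordDist S (Ψ a b t) (Ψ a b t') ≤ M := by
  have h : ∀ᶠ ε : ℝ in 𝓝[>] 0, ∀ a ∈ A, ∀ b ∈ B, ∀ t ∈ Set.Icc (0 : ℝ) 1,
      ∀ t' ∈ Set.Icc (0 : ℝ) 1, |t - t'| < ε → wordDist S (Ψ a b t) (Ψ a b t') ≤ M := by
    refine (eventually_all_finite hA).2 fun a _ => (eventually_all_finite hB).2 fun b _ => ?_
    obtain ⟨ε, hε, h⟩ := hM a b
    filter_upwards [Ioo_mem_nhdsGT hε] with η hη t ht t' ht' htt'
    exact h t ht t' ht' (htt'.trans hη.2)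
  obtain ⟨ε, h, hε⟩ := (h.and self_mem_nhdsWithin).exists
  exact ⟨ε, hε, h⟩

variable {V : Type*} [Fintype V]

/-- The extension by induction over the number of nonintegral components, where on each unit cube
the path starting at the smallest vertex is followed. -/
noncomputable def interpolate (Ψ : Γ → Γ → ℝ → Γ) (f : (V → ℕ) → Γ) : ℕ → (V → ℝ) → Γ
  | 0, z => f (floorVec z)
  | k + 1, z => Ψ (f (floorVec z)) (interpolate Ψ f k (pushOut z)) (maxFrac z)

variable {f : (V → ℕ) → Γ} {K : AbstractSimplicialComplex V}

theorem proj_interpolate (hΨ : IsFibrewisePath S S' π Ψ) (k : ℕ) (z : V → ℝ) :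
    π (interpolate Ψ f k z) = π (f (floorVec z)) := by
  cases k with
  | zero => rfl
  | succ k => exact hΨ.proj _ _ _

theorem interpolate_of_maxFrac_eq_zero (hΨ : IsFibrewisePath S S' π Ψ) (k : ℕ) {z : V → ℝ}
    (hz : maxFrac z = 0) : interpolate Ψ f k z = f (floorVec z) := by
  cases k with
  | zero => rfl
  | succ k => rw [interpolate, hz, hΨ.zero]

theorem maxFrac_eq_zero_of_nonintCount_eq_zero {z : V → ℝ} (h : nonintCount z = 0) :
    maxFrac z = 0 := by
  classical
  rw [maxFrac_eq_zero]
  funext v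
  have h1 := Finset.card_eq_zero.1 h
  by_contra h2
  exact Finset.notMem_empty v (h1 ▸ Finset.mem_filter.2 ⟨Finset.mem_univ v, h2⟩)

/-- The recursion reaches a lattice point after at most `nonintCount z` steps, and there further
levels have no effect. -/
theorem interpolate_succ (hΨ : IsFibrewisePath S S' π Ψ) : ∀ (k : ℕ) {z : V → ℝ},
    (∀ v, 0 ≤ z v) → nonintCount z ≤ k → interpolate Ψ f (k + 1) z = interpolate Ψ f k z := by
  intro k
  induction k with
  | zero =>
    intro z hz hk
    have h := maxFrac_eq_zero_of_nonintCount_eq_zero (Nat.le_zero.1 hk)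
    rw [interpolate_of_maxFrac_eq_zero hΨ _ h, interpolate_of_maxFrac_eq_zero hΨ _ h]
  | succ k ih =>
    intro z hz hk
    by_cases h : maxFrac z = 0
    · rw [interpolate_of_maxFrac_eq_zero hΨ _ h, interpolate_of_maxFrac_eq_zero hΨ _ h]
    · have h1 := nonintCount_pushOut_lt hz h
      rw [interpolate, ih (pushOut_nonneg hz) (by omega), interpolate]

/-- The extension is close to the given map on the parts of the cone where the latter is
coarsely Lipschitz. -/
theorem exists_wordDist_interpolate_le (hS : Subgroup.closure (S : Set Γ) = ⊤)
    (hΨ : IsFibrewisePath S S' π Ψ) {W : ℕ → Set (V → ℕ)}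
    (hW : ∀ R, ∀ x ∈ W R, ∀ y ≤ x + 1, x ≤ y → y ∈ W (R + 1))
    (hf : ∀ R, ∃ C : ℕ, ∀ x ∈ W R, ∀ y, natVec x ∈ openCone K → natVec y ∈ openCone K → x ≤ y →
      y ≤ x + 1 → wordDist S (f x) (f y) ≤ C) (k : ℕ) :
    ∀ R, ∃ C : ℕ, ∀ z ∈ openCone K, floorVec z ∈ W R →
      wordDist S (f (floorVec z)) (interpolate Ψ f k z) ≤ C := by
  induction k with
  | zero => exact fun R => ⟨0, fun z _ _ => (wordDist_self _).le⟩
  | succ k ih =>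
    intro R
    obtain ⟨C₁, hC₁⟩ := hf R
    obtain ⟨C₂, hC₂⟩ := ih (R + 1)
    obtain ⟨C, hC⟩ := hΨ.bounded (C₁ + C₂)
    refine ⟨C, fun z hz hzR => hC _ _ ((wordDist_triangle hS _ (f (floorVec (pushOut z))) _).trans
      (Nat.add_le_add (hC₁ _ hzR _ (natVec_floorVec_mem_openCone hz)
        (natVec_floorVec_mem_openCone (pushOut_mem_openCone hz))
        (floorVec_le_floorVec_pushOut hz.1) (floorVec_pushOut_le z))
        (hC₂ _ (pushOut_mem_openCone hz) (hW R _ hzR _ (floorVec_pushOut_le z)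
        (floorVec_le_floorVec_pushOut hz.1))))) _⟩

theorem finite_image_interpolate (hS : Subgroup.closure (S : Set Γ) = ⊤)
    (hΨ : IsFibrewisePath S S' π Ψ) (k R : ℕ) :
    (interpolate Ψ f k '' {z | z ∈ openCone K ∧ ∀ v, floorVec z v ≤ R}).Finite := by
  obtain ⟨C, hC⟩ := exists_wordDist_interpolate_le (K := K) (f := f) hS hΨ
    (W := fun R => {x | ∀ v, x v ≤ R}) (fun R x hx y hyx _ v => (hyx v).trans (Nat.succ_le_succ (hx v)))
    (fun R => by
      have h := ((finite_setOf_forall_le (V := V) R).prod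
        (finite_setOf_forall_le (V := V) (R + 1))).image fun p => wordDist S (f p.1) (f p.2)
      obtain ⟨C, hC⟩ := h.bddAbove
      exact ⟨C, fun x hx y _ _ _ hyx => hC ⟨(x, y), ⟨hx, fun v =>
        (hyx v).trans (Nat.succ_le_succ (hx v))⟩, rfl⟩⟩) k R
  refine ((finite_setOf_forall_le (V := V) R).biUnion fun x _ =>
    finite_wordDist_le hS (f x) C).subset ?_
  rintro _ ⟨z, ⟨hz, hzR⟩, rfl⟩
  exact Set.mem_biUnion (x := floorVec z) hzR (hC z hz hzR)

theorem eventually_floor_eq {z : V → ℝ} (hz : ∀ v, 0 ≤ z v) : ∀ᶠ z' in 𝓝 z, ∀ v, fracVec z v ≠ 0 →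
    ⌊z' v⌋₊ = ⌊z v⌋₊ ∧ fracVec z' v ≠ 0 := by
  refine eventually_all.2 fun v => ?_
  by_cases h : fracVec z v = 0
  · exact Eventually.of_forall fun _ h' => absurd h h'
  · have h1 : (⌊z v⌋₊ : ℝ) < z v := by
      have := (fracVec_nonneg hz v).lt_of_ne' h
      rw [fracVec] at this
      linarith
    have h2 : ∀ᶠ t in 𝓝 (z v), t ∈ Set.Ioo (⌊z v⌋₊ : ℝ) (⌊z v⌋₊ + 1) :=
      Ioo_mem_nhds h1 (Nat.lt_floor_add_one _)
    filter_upwards [(continuous_apply v).continuousAt.eventually h2] with z' hz' _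
    have h3 : ⌊z' v⌋₊ = ⌊z v⌋₊ :=
      (Nat.floor_eq_iff ((Nat.cast_nonneg _).trans hz'.1.le)).2 ⟨hz'.1.le, hz'.2⟩
    refine ⟨h3, ?_⟩
    rw [fracVec, h3]
    exact (sub_pos.2 hz'.1).ne'

/-- The integral part can jump only where a component of `z` is an integer and that of `z'` is
slightly smaller, so its fractional part is close to 1. -/
theorem exists_fracVec_of_floorVec_ne {z z' : V → ℝ} (hz' : ∀ v, 0 ≤ z' v)
    (h : ∀ v, fracVec z v ≠ 0 → ⌊z' v⌋₊ = ⌊z v⌋₊ ∧ fracVec z' v ≠ 0) (hd : dist z' z < 1)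
    (hne : floorVec z' ≠ floorVec z) :
    ∃ v, fracVec z v = 0 ∧ 1 - dist z' z ≤ fracVec z' v := by
  obtain ⟨v, hv⟩ := Function.ne_iff.1 hne
  have h0 : fracVec z v = 0 := by
    by_contra h0
    exact hv (h v h0).1
  refine ⟨v, h0, ?_⟩
  rw [fracVec] at h0
  have h1 := (dist_le_pi_dist z' z v)
  rw [Real.dist_eq] at h1
  have h2 := abs_le.1 h1
  have h3 : z' v < ⌊z v⌋₊ := by
    by_contra! h3
    have h4 : z' v < ⌊z v⌋₊ + 1 := by linarith
    exact hv ((Nat.floor_eq_iff (hz' v)).2 ⟨h3, h4⟩)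
  have h4 : ⌊z' v⌋₊ < ⌊z v⌋₊ := (Nat.floor_lt (hz' v)).2 h3
  have h5 : (⌊z' v⌋₊ : ℝ) + 1 ≤ ⌊z v⌋₊ := by exact_mod_cast h4
  rw [fracVec]
  linarith

theorem nonintCount_lt {z z' : V → ℝ} (h : ∀ v, fracVec z v ≠ 0 → fracVec z' v ≠ 0) {v : V}
    (hv : fracVec z v = 0) (hv' : fracVec z' v ≠ 0) : nonintCount z < nonintCount z' := by
  classical
  refine Finset.card_lt_card (Finset.ssubset_iff_of_subset ?_ |>.2 ⟨v, ?_, ?_⟩)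
  · intro w hw
    simp only [Finset.mem_filter, Finset.mem_univ, true_and] at hw ⊢
    exact h w hw
  · simpa using hv'
  · simpa using hv

theorem dist_pushOut_le {z : V → ℝ} (hz : ∀ v, 0 ≤ z v) (h : maxFrac z ≠ 0) :
    dist (pushOut z) z ≤ 1 - maxFrac z := by
  have h1 := maxFrac_lt_one hz
  have hm := (maxFrac_nonneg z).lt_of_ne' h
  rw [dist_pi_le_iff (by linarith)]
  intro v
  have h2 := fracVec_le_maxFrac z v
  have h3 : pushOut z v - z v = fracVec z v / maxFrac z * (1 - maxFrac z) := by
    rw [pushOut, fracVec]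
    field_simp
    ring
  have h4 : fracVec z v / maxFrac z ≤ 1 := div_le_one_of_le₀ h2 hm.le
  have h5 : 0 ≤ fracVec z v / maxFrac z := div_nonneg (fracVec_nonneg hz v) hm.le
  rw [Real.dist_eq, h3, abs_of_nonneg (mul_nonneg h5 (by linarith))]
  nlinarith

/-- On a half open cube, `maxFrac` is given by a continuous formula. -/
theorem maxFrac_eq_of_floorVec_eq {z z' : V → ℝ} (h : floorVec z' = floorVec z) :
    maxFrac z' = ‖z' - natVec (floorVec z)‖ := by
  rw [maxFrac, ← h]
  rfl

theorem pushOut_eq_of_floorVec_eq {z z' : V → ℝ} (h : floorVec z' = floorVec z) :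
    pushOut z' = natVec (floorVec z) +
      ‖z' - natVec (floorVec z)‖⁻¹ • (z' - natVec (floorVec z)) := by
  rw [← maxFrac_eq_of_floorVec_eq h, ← h]
  funext v
  simp only [pushOut, fracVec, Pi.add_apply, Pi.smul_apply, Pi.sub_apply, natVec, floorVec,
    smul_eq_mul]
  ring

theorem eventually_pushOut {z : V → ℝ} (hm : maxFrac z ≠ 0) {P : (V → ℝ) → Prop}
    (hP : ∀ᶠ p in 𝓝 (pushOut z), P p) {ε : ℝ} (hε : 0 < ε) :
    ∀ᶠ z' in 𝓝 z, floorVec z' = floorVec z →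
      P (pushOut z') ∧ |maxFrac z - maxFrac z'| < ε ∧ maxFrac z' ≠ 0 := by
  have h0 : ‖z - natVec (floorVec z)‖ ≠ 0 := by rwa [← maxFrac_eq_of_floorVec_eq rfl]
  have hc : ContinuousAt (fun z' : V → ℝ => ‖z' - natVec (floorVec z)‖) z := by fun_prop
  have h1 : ContinuousAt (fun z' : V → ℝ => natVec (floorVec z) +
      ‖z' - natVec (floorVec z)‖⁻¹ • (z' - natVec (floorVec z))) z :=
    continuousAt_const.add ((hc.inv₀ h0).smul (by fun_prop))
  rw [pushOut_eq_of_floorVec_eq rfl] at hP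
  have h2 := Metric.continuousAt_iff'.1 hc ε hε
  filter_upwards [h1.eventually hP, h2, hc.eventually_ne h0] with z' h3 h4 h5 hz'
  rw [pushOut_eq_of_floorVec_eq hz', maxFrac_eq_of_floorVec_eq hz', maxFrac_eq_of_floorVec_eq rfl]
  refine ⟨h3, ?_, h5⟩
  rw [abs_sub_comm]
  exact h4

/-- Induct over the level. Neighbours in the same half open cube are compared along the paths. A
neighbour `z'` in another cube is near the end of its path, which is compared with `z` at the lower
level. The constant depends on the level only; only the neighbourhood depends on `z`. -/
theorem coarselyContinuous_interpolate (hS : Subgroup.closure (S : Set Γ) = ⊤)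
    (hΨ : IsFibrewisePath S S' π Ψ) {D : ℕ}
    (hD : ∀ x y, natVec x ∈ openCone K → natVec y ∈ openCone K → x ≤ y → y ≤ x + 1 →
      wordDist S' (π (f x)) (π (f y)) ≤ D) (k : ℕ) :
    ∃ M : ℕ, ∀ z ∈ openCone K, nonintCount z ≤ k → ∀ᶠ z' in 𝓝 z, z' ∈ openCone K →
      nonintCount z' ≤ k → wordDist S (interpolate Ψ f k z) (interpolate Ψ f k z') ≤ M := by
  induction k with
  | zero =>
    refine ⟨0, fun z hz hk => ?_⟩
    filter_upwards [Metric.ball_mem_nhds z one_pos] with z' hzz' hz' hk'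
    have h1 := eq_natVec_of_maxFrac_eq_zero
      (maxFrac_eq_zero_of_nonintCount_eq_zero (Nat.le_zero.1 hk))
    have h2 := eq_natVec_of_maxFrac_eq_zero
      (maxFrac_eq_zero_of_nonintCount_eq_zero (Nat.le_zero.1 hk'))
    have h3 : z' = z := by
      rw [h1, h2]
      refine congrArg natVec (funext fun v => ?_)
      have h4 := (dist_le_pi_dist z' z v).trans_lt hzz'
      rw [h1, h2, Real.dist_eq, natVec, natVec, abs_lt] at h4
      have h5 : floorVec z' v < floorVec z v + 1 := by
        have : (floorVec z' v : ℝ) < floorVec z v + 1 := by linarith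
        exact_mod_cast this
      have h6 : floorVec z v < floorVec z' v + 1 := by
        have : (floorVec z v : ℝ) < floorVec z' v + 1 := by linarith
        exact_mod_cast this
      omega
    rw [h3, wordDist_self]
  | succ k ih =>
    obtain ⟨M, hM⟩ := ih
    obtain ⟨M₁, hM₁⟩ := hΨ.steps
    obtain ⟨C₁, hC₁⟩ := hΨ.one D
    obtain ⟨C₂, hC₂⟩ := hΨ.stable D M
    have hproj : ∀ z ∈ openCone K, wordDist S' (π (f (floorVec z)))
        (π (interpolate Ψ f k (pushOut z))) ≤ D := by
      intro z hz
      rw [proj_interpolate hΨ]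
      exact hD _ _ (natVec_floorVec_mem_openCone hz)
        (natVec_floorVec_mem_openCone (pushOut_mem_openCone hz))
        (floorVec_le_floorVec_pushOut hz.1) (floorVec_pushOut_le z)
    have hIcc : ∀ z ∈ openCone K, maxFrac z ∈ Set.Icc (0 : ℝ) 1 := fun z hz =>
      ⟨maxFrac_nonneg z, (maxFrac_lt_one hz.1).le⟩
    refine ⟨M + M₁ + C₁ + C₂, fun z hz hk => ?_⟩
    obtain ⟨R, hR⟩ := exists_nat_gt (‖z‖ + 1)
    obtain ⟨ε, hε, hεM⟩ := exists_common_step hM₁ ((finite_setOf_forall_le (V := V) R).image f)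
      (finite_image_interpolate (K := K) (f := f) hS hΨ k (R + 1))
    have hRz : ∀ z' : V → ℝ, dist z' z < 1 → ∀ v, floorVec z' v ≤ R := by
      intro z' hz' v
      have h1 : z' v ≤ R := by
        have h2 := (le_abs_self _).trans (norm_le_pi_norm z' v)
        have h3 := norm_le_norm_add_norm_sub' z' z
        rw [← dist_eq_norm] at h3
        linarith
      exact Nat.floor_le_of_le h1
    have hRp : ∀ z' ∈ openCone K, dist z' z < 1 →
        interpolate Ψ f k (pushOut z') ∈ interpolate Ψ f k ''
          {z | z ∈ openCone K ∧ ∀ v, floorVec z v ≤ R + 1} := fun z' hz' hd =>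
      ⟨_, ⟨pushOut_mem_openCone hz', fun v =>
        (floorVec_pushOut_le z' v).trans (Nat.succ_le_succ (hRz z' hd v))⟩, rfl⟩
    have h0 := Metric.ball_mem_nhds z (lt_min one_pos hε)
    have hA : ∀ᶠ z' in 𝓝 z, z' ∈ openCone K → nonintCount z' ≤ k + 1 → floorVec z' = floorVec z →
        wordDist S (interpolate Ψ f (k + 1) z) (interpolate Ψ f (k + 1) z') ≤ M₁ + C₂ := by
      by_cases hm : maxFrac z = 0
      · filter_upwards [h0] with z' hd hz' _ hfl
        rw [Metric.mem_ball, lt_min_iff] at hd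
        have h1 : maxFrac z' ≤ dist z' z := by
          rw [maxFrac_eq_of_floorVec_eq hfl, ← eq_natVec_of_maxFrac_eq_zero hm, dist_eq_norm]
        have h2 := hεM _ ⟨_, hRz z' hd.1, rfl⟩ _ (hRp z' hz' hd.1) 0 ⟨le_rfl, zero_le_one⟩ _
          (hIcc z' hz') (by
            rw [zero_sub, abs_neg, abs_of_nonneg (maxFrac_nonneg _)]
            exact h1.trans_lt hd.2)
        rw [hΨ.zero] at h2
        rw [interpolate_of_maxFrac_eq_zero hΨ _ hm, ← hfl, interpolate]
        exact h2.trans (Nat.le_add_right _ _)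
      · have h1 := nonintCount_pushOut_lt hz.1 hm
        -- Away from the lowest vertex, exit point and time depend continuously on `z'`. First the
        -- time is changed along the fixed path of `z`, then the path is changed at a fixed time.
        obtain ⟨η, hη, hηM⟩ := hM₁ (f (floorVec z)) (interpolate Ψ f k (pushOut z))
        filter_upwards [eventually_pushOut hm (hM _ (pushOut_mem_openCone hz) (by omega)) hη]
          with z' h2 hz' hk' hfl
        obtain ⟨h3, h4, h5⟩ := h2 hfl
        have h6 := nonintCount_pushOut_lt hz'.1 h5
        have h7 := h3 (pushOut_mem_openCone hz') (by omega)
        rw [interpolate, interpolate, hfl]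
        refine (wordDist_triangle hS _ (Ψ (f (floorVec z)) (interpolate Ψ f k (pushOut z))
          (maxFrac z')) _).trans (Nat.add_le_add (hηM _ (hIcc z hz) _ (hIcc z' hz') h4) ?_)
        exact hC₂ _ _ _ (hproj z hz) (hfl ▸ hproj z' hz') h7 _
    have hB : ∀ᶠ z' in 𝓝 z, z' ∈ openCone K → nonintCount z' ≤ k + 1 → floorVec z' ≠ floorVec z →
        wordDist S (interpolate Ψ f (k + 1) z) (interpolate Ψ f (k + 1) z') ≤ M + M₁ + C₁ := by
      by_cases hzk : nonintCount z ≤ k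
      · obtain ⟨ρ, hρ, hρM⟩ := Metric.eventually_nhds_iff.1 (hM z hz hzk)
        filter_upwards [eventually_floor_eq hz.1, h0, Metric.ball_mem_nhds z (half_pos hρ)]
          with z' h1 hd hd' hz' hk' hfl
        rw [Metric.mem_ball, lt_min_iff] at hd
        rw [Metric.mem_ball] at hd'
        -- Now `maxFrac z'` is nearly 1, so the exit point of `z'` is near `z`, and the value at
        -- `z'` is near the value at this exit point.
        obtain ⟨v, -, hv'⟩ := exists_fracVec_of_floorVec_ne hz'.1 h1 hd.1 hfl
        have h2 := hv'.trans (fracVec_le_maxFrac z' v)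
        have hm : maxFrac z' ≠ 0 := by
          have := hd.1
          exact (by linarith : 0 < maxFrac z').ne'
        have h3 := dist_pushOut_le hz'.1 hm
        have h4 := nonintCount_pushOut_lt hz'.1 hm
        have h5 : dist (pushOut z') z < ρ := by
          linarith [dist_triangle (pushOut z') z' z]
        have h6 := hρM h5 (pushOut_mem_openCone hz') (by omega)
        have h7 := hεM _ ⟨_, hRz z' hd.1, rfl⟩ _ (hRp z' hz' hd.1) _
          (hIcc z' hz') 1 ⟨zero_le_one, le_rfl⟩ (by
            rw [abs_sub_comm, abs_of_nonneg (sub_nonneg.2 (hIcc z' hz').2)]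
            linarith [hd.2])
        have h8 := hC₁ _ _ (hproj z' hz')
        rw [interpolate_succ hΨ k hz.1 hzk]
        rw [interpolate]
        rw [wordDist_comm] at h7 h8
        have h9 := wordDist_triangle hS (interpolate Ψ f k z) (interpolate Ψ f k (pushOut z'))
          (Ψ (f (floorVec z')) (interpolate Ψ f k (pushOut z')) (maxFrac z'))
        have h10 := wordDist_triangle hS (interpolate Ψ f k (pushOut z'))
          (Ψ (f (floorVec z')) (interpolate Ψ f k (pushOut z')) 1)
          (Ψ (f (floorVec z')) (interpolate Ψ f k (pushOut z')) (maxFrac z'))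
        omega
      -- Here `z` already has `k + 1` nonintegral components; a neighbour in another cube would have
      -- more.
      · filter_upwards [eventually_floor_eq hz.1, h0] with z' h1 hd hz' hk' hfl
        rw [Metric.mem_ball, lt_min_iff] at hd
        obtain ⟨v, hv, hv'⟩ := exists_fracVec_of_floorVec_ne hz'.1 h1 hd.1 hfl
        have h2 : fracVec z' v ≠ 0 := by
          have := hd.1
          exact (by linarith : 0 < fracVec z' v).ne'
        have := nonintCount_lt (fun w hw => (h1 w hw).2) hv h2
        omega
    filter_upwards [hA, hB] with z' hA hB hz' hk'
    by_cases h : floorVec z' = floorVec z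
    · exact (hA hz' hk' h).trans (by omega)
    · exact (hB hz' hk' h).trans (by omega)

end Interpolation

/-! ### Fibrewise paths and the expanding map into an extension -/

section Extension

variable {H : Type*} {G : Type*} {Q : Type*} [Group H] [Group G] [Group Q]

theorem wordDist_mul_mul_le {S : Finset G} (hS : Subgroup.closure (S : Set G) = ⊤) (a b q q' : G) :
    wordDist S (a * q) (b * q') ≤ wordDist S 1 q + wordDist S a b + wordDist S 1 q' := by
  have h1 := wordDist_triangle hS (a * q) a (b * q')
  have h2 := wordDist_triangle hS a b (b * q')
  have h3 := wordDist_mul_left hS a 1 q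
  have h4 := wordDist_mul_left hS b 1 q'
  rw [mul_one] at h3 h4
  rw [wordDist_comm] at h3
  omega

theorem wordDist_le_mul_mul {S : Finset G} (hS : Subgroup.closure (S : Set G) = ⊤) (a b q q' : G) :
    wordDist S a b ≤ wordDist S 1 q + wordDist S (a * q) (b * q') + wordDist S 1 q' := by
  have h1 := wordDist_triangle hS a (a * q) b
  have h2 := wordDist_triangle hS (a * q) (b * q') b
  have h3 := wordDist_mul_left hS a 1 q
  have h4 := wordDist_mul_left hS b 1 q'
  rw [mul_one] at h3 h4
  rw [wordDist_comm] at h4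
  omega

theorem finite_ker_inl (X : GroupExtension H G Q) : (X.inl.ker : Set H).Finite := by
  rw [(MonoidHom.ker_eq_bot_iff X.inl).2 X.inl_injective]
  exact Set.finite_singleton 1

/-- Left translates of a system of paths in the kernel to the cosets. -/
noncomputable def fibrewisePath (X : GroupExtension H G Q) (s : Q → G) (φ : H → H → unitInterval → H)
    (a b : G) (t : ℝ) : G :=
  s (X.rightHom a) * X.inl (φ (Function.invFun X.inl ((s (X.rightHom a))⁻¹ * a))
    (Function.invFun X.inl ((s (X.rightHom a))⁻¹ * (b * (s (X.rightHom b))⁻¹ * s (X.rightHom a))))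
    (Set.projIcc 0 1 zero_le_one t))

theorem inl_invFun (X : GroupExtension H G Q) {g : G} (hg : X.rightHom g = 1) :
    X.inl (Function.invFun X.inl g) = g := by
  refine Function.invFun_eq ?_
  have : g ∈ X.inl.range := by rwa [X.range_inl_eq_ker_rightHom, MonoidHom.mem_ker]
  exact this

/-- The fibre of `a` is the left translate of the kernel by `s (π a)`, and left translation is an
isometry, so the constants for `H` serve all fibres. The kernel may be distorted in `G`, but its
inclusion is uniformly proper, which turns bounds in `G` into bounds in `H`. -/
theorem exists_isFibrewisePath {SH : Finset H} {SG : Finset G} {SQ : Finset Q}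
    (hSH : Subgroup.closure (SH : Set H) = ⊤) (hSG : Subgroup.closure (SG : Set G) = ⊤)
    (hSQ : Subgroup.closure (SQ : Set Q) = ⊤) (hH : WeaklyConvex SH) (X : GroupExtension H G Q)
    (s : X.Section) (hs : IsLipschitz SQ SG s) :
    ∃ Ψ, IsFibrewisePath SG SQ X.rightHom Ψ := by
  obtain ⟨φ, M, hM, hends, ⟨γ, hγ⟩, hsteps, hstable⟩ := hH
  obtain ⟨L, hL⟩ := hs
  obtain ⟨Lι, hLι⟩ := isLipschitz_monoidHom hSH hSG X.inl
  obtain ⟨Lπ, hLπ⟩ := isLipschitz_monoidHom hSG hSQ X.rightHom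
  have hunif := exists_wordDist_le_of_finite_ker hSH hSG X.inl (finite_ker_inl X)
  set x : G → H := fun a => Function.invFun X.inl ((s (X.rightHom a))⁻¹ * a) with hx
  -- The target `b` is moved into the fibre of `a` by right multiplication with `s(π b)⁻¹ s(π a)`,
  -- whose length is at most `L` times the distance of the fibres.
  set y : G → G → H := fun a b => Function.invFun X.inl
    ((s (X.rightHom a))⁻¹ * (b * (s (X.rightHom b))⁻¹ * s (X.rightHom a))) with hy
  have hxa : ∀ a, s (X.rightHom a) * X.inl (x a) = a := by
    intro a
    rw [hx, inl_invFun X (by simp), mul_inv_cancel_left]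
  have hyab : ∀ a b, s (X.rightHom a) * X.inl (y a b) =
      b * (s (X.rightHom b))⁻¹ * s (X.rightHom a) := by
    intro a b
    rw [hy, inl_invFun X (by simp), mul_inv_cancel_left]
  set Ψ := fibrewisePath X s φ with hΨ
  have hΨt : ∀ a b t, Ψ a b t = s (X.rightHom a) * X.inl (φ (x a) (y a b)
    (Set.projIcc 0 1 zero_le_one t)) := fun a b t => rfl
  have hzero : ∀ a b, Ψ a b 0 = a := by
    intro a b
    rw [hΨt, Set.projIcc_left]
    exact (congrArg (fun h => s (X.rightHom a) * X.inl h) (hends _ _).1).trans (hxa a)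
  have hone : ∀ a b, Ψ a b 1 = b * (s (X.rightHom b))⁻¹ * s (X.rightHom a) := by
    intro a b
    rw [hΨt, Set.projIcc_right]
    exact (congrArg (fun h => s (X.rightHom a) * X.inl h) (hends _ _).2).trans (hyab a b)
  have hend : ∀ a b, wordDist SG (Ψ a b 1) b ≤ L * wordDist SQ (X.rightHom a) (X.rightHom b) := by
    intro a b
    refine le_trans (le_of_eq ?_) (hL _ _)
    rw [hone, wordDist_eq_one hSG, wordDist_eq_one hSG (s (X.rightHom a))]
    exact congrArg _ (by group)
  have hdist : ∀ a b b' t t', wordDist SG (Ψ a b t) (Ψ a b' t') ≤ Lι * wordDist SH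
      (φ (x a) (y a b) (Set.projIcc 0 1 zero_le_one t))
      (φ (x a) (y a b') (Set.projIcc 0 1 zero_le_one t')) := by
    intro a b b' t t'
    rw [hΨt, hΨt, wordDist_mul_left hSG]
    exact hLι _ _
  have hLip : ∀ z w w' t, wordDist SH (φ z w t) (φ z w' t) ≤ ⌈M⌉₊ * wordDist SH w w' := by
    intro z w w' t
    refine wordDist_le_mul_of_adj (φ := fun w => φ z w t) hSH hSH (fun w w' hww' => ?_) w w'
    have h := (hstable z z w w' (by rw [wordDist_self]; exact zero_le_one)
      (SimpleGraph.dist_eq_one_iff_adj.2 hww').le t).trans (Nat.le_ceil M)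
    exact_mod_cast h
  refine ⟨Ψ, ⟨hzero, fun a b t => ?_, fun D => ⟨L * D, fun a b h =>
    (hend a b).trans (Nat.mul_le_mul_left L h)⟩, fun R => ?_, ⟨Lι * ⌈M⌉₊, fun a b => ?_⟩,
    fun D R => ?_⟩⟩
  · rw [hΨt, map_mul, X.rightHom_inl, mul_one, s.rightHom_section]
  · obtain ⟨R', hR'⟩ := hunif (R + L * (Lπ * R))
    refine ⟨Lι * ⌈γ R'⌉₊, fun a b hab t => ?_⟩
    have h1 : wordDist SH (x a) (y a b) ≤ R' := by
      refine hR' _ _ ?_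
      rw [← wordDist_mul_left hSG (s (X.rightHom a)), hxa, hyab, ← hone]
      refine (wordDist_triangle hSG _ b _).trans (Nat.add_le_add hab ?_)
      rw [wordDist_comm]
      exact (hend a b).trans (Nat.mul_le_mul_left L ((hLπ a b).trans (Nat.mul_le_mul_left Lπ hab)))
    have h2 := hdist a b b 0 t
    rw [hzero] at h2
    refine h2.trans (Nat.mul_le_mul_left Lι ?_)
    have h3 := (hγ R' (Nat.cast_nonneg _) (x a) (y a b) (by exact_mod_cast h1)
      (Set.projIcc 0 1 zero_le_one 0) (Set.projIcc 0 1 zero_le_one t)).trans (Nat.le_ceil (γ R'))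
    exact_mod_cast h3
  · obtain ⟨ε, hε, h⟩ := hsteps (x a) (y a b)
    refine ⟨ε, hε, fun t ht t' ht' htt' => (hdist a b b t t').trans (Nat.mul_le_mul_left Lι ?_)⟩
    rw [Set.projIcc_of_mem _ ht, Set.projIcc_of_mem _ ht']
    have h3 := (h ⟨t, ht⟩ ⟨t', ht'⟩ htt').le.trans (Nat.le_ceil M)
    exact_mod_cast h3
  · obtain ⟨R', hR'⟩ := hunif (L * D + R + L * D)
    refine ⟨Lι * (⌈M⌉₊ * R'), fun a b b' hab hab' hbb' t => (hdist a b b' t t).trans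
      (Nat.mul_le_mul_left Lι ((hLip _ _ _ _).trans (Nat.mul_le_mul_left _ (hR' _ _ ?_))))⟩
    rw [← wordDist_mul_left hSG (s (X.rightHom a)), hyab, hyab, ← hone, ← hone]
    have h1 := (hend a b).trans (Nat.mul_le_mul_left L hab)
    have h2 := (hend a b').trans (Nat.mul_le_mul_left L hab')
    rw [wordDist_comm] at h2
    have h3 := wordDist_triangle hSG (Ψ a b 1) b (Ψ a b' 1)
    have h4 := wordDist_triangle hSG b b' (Ψ a b' 1)
    omega

variable {V W : Type*}

theorem natVec_comp_inl_mem_openCone {K : AbstractSimplicialComplex V}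
    {L : AbstractSimplicialComplex W} {x : V ⊕ W → ℕ} (hx : natVec x ∈ openCone (joinComplex K L)) :
    natVec (fun v => x (Sum.inl v)) ∈ openCone K := by
  refine ⟨fun _ => Nat.cast_nonneg _, ?_⟩
  rcases hx.2 with h | ⟨σ, hσ, h⟩
  · exact .inl (funext fun v => congrFun h (Sum.inl v))
  · have h1 : Function.support (natVec fun v => x (Sum.inl v)) = (σ.toLeft : Set V) := by
      ext v
      rw [Finset.mem_coe, Finset.mem_toLeft, ← Finset.mem_coe, ← h]
      rfl
    rcases σ.toLeft.eq_empty_or_nonempty with h2 | h2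
    · left
      rwa [h2, Finset.coe_empty, Function.support_eq_empty_iff] at h1
    · exact .inr ⟨_, hσ.2.1 h2, h1⟩

theorem natVec_comp_inr_mem_openCone {K : AbstractSimplicialComplex V}
    {L : AbstractSimplicialComplex W} {x : V ⊕ W → ℕ} (hx : natVec x ∈ openCone (joinComplex K L)) :
    natVec (fun v => x (Sum.inr v)) ∈ openCone L := by
  refine ⟨fun _ => Nat.cast_nonneg _, ?_⟩
  rcases hx.2 with h | ⟨σ, hσ, h⟩
  · exact .inl (funext fun v => congrFun h (Sum.inr v))
  · have h1 : Function.support (natVec fun v => x (Sum.inr v)) = (σ.toRight : Set W) := by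
      ext v
      rw [Finset.mem_coe, Finset.mem_toRight, ← Finset.mem_coe, ← h]
      rfl
    rcases σ.toRight.eq_empty_or_nonempty with h2 | h2
    · left
      rwa [h2, Finset.coe_empty, Function.support_eq_empty_iff] at h1
    · exact .inr ⟨_, hσ.2.2 h2, h1⟩

theorem support_floorVec_subset {z : V → ℝ} {σ : Finset V} (h : Function.support z ⊆ σ) :
    Function.support (floorVec z) ⊆ σ := fun v hv => h fun h0 => hv (by simp [floorVec, h0])

variable [Fintype V] [Fintype W]

theorem exists_bound_of_forall_le (F : (V → ℕ) → ℕ) (R : ℕ) :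
    ∃ B, ∀ x : V → ℕ, (∀ v, x v ≤ R) → F x ≤ B := by
  obtain ⟨B, hB⟩ := ((finite_setOf_forall_le (V := V) R).image F).bddAbove
  exact ⟨B, fun x hx => hB ⟨x, hx, rfl⟩⟩

theorem exists_forall_le_of_finite {A : Set (V → ℕ)} (hA : A.Finite) : ∃ R, ∀ x ∈ A, ∀ v, x v ≤ R := by
  obtain ⟨b, hb⟩ := hA.bddAbove
  exact ⟨Finset.univ.sup b, fun x hx v => (hb hx v).trans (Finset.le_sup (Finset.mem_univ v))⟩

theorem IsLatticeExpanding.exists_bound_of_close {S : Finset G}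
    (hS : Subgroup.closure (S : Set G) = ⊤) {K : AbstractSimplicialComplex V} {f : (V → ℕ) → G}
    (hf : IsLatticeExpanding S K f) (R D : ℕ) : ∃ R', ∀ x y, (∀ v, x v ≤ R) →
      natVec y ∈ openCone K → wordDist S (f x) (f y) ≤ D → ∀ v, y v ≤ R' := by
  obtain ⟨R', hR'⟩ := exists_forall_le_of_finite (hf.proper _
    ((finite_setOf_forall_le (V := V) R).biUnion fun x _ => finite_wordDist_le hS (f x) D))
  exact ⟨R', fun x y hx hy hxy => hR' y ⟨hy, Set.mem_biUnion hx hxy⟩⟩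

/-- Divergence in the form used for joins: a simplex of the join may have an empty part in one
factor, and then the corresponding coordinates are zero. -/
theorem IsLatticeExpanding.exists_bound_or {S : Finset G} {K : AbstractSimplicialComplex V}
    {f : (V → ℕ) → G} (hf : IsLatticeExpanding S K f) {σ τ : Finset V}
    (hσ : σ.Nonempty → σ ∈ K.faces) (hτ : τ.Nonempty → τ ∈ K.faces) (hστ : Disjoint σ τ) (D : ℕ) :
    ∃ R, ∀ x y : V → ℕ, Function.support x ⊆ σ → Function.support y ⊆ τ →
      wordDist S (f x) (f y) ≤ D → (∀ v, x v ≤ R) ∨ ∀ v, y v ≤ R := by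
  have h0 : ∀ x : V → ℕ, Function.support x ⊆ (∅ : Finset V) → ∀ v, x v ≤ 0 := by
    intro x hx v
    by_contra h
    exact Finset.notMem_empty v (Finset.mem_coe.1 (hx fun h' => h h'.le))
  rcases σ.eq_empty_or_nonempty with rfl | hσ'
  · exact ⟨0, fun x y hx _ _ => .inl (h0 x hx)⟩
  · rcases τ.eq_empty_or_nonempty with rfl | hτ'
    · exact ⟨0, fun x y _ hy _ => .inr (h0 y hy)⟩
    · obtain ⟨R, hR⟩ := hf.diverge σ (hσ hσ') τ (hτ hτ') hστ D
      refine ⟨R, fun x y hx hy hxy => ?_⟩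
      by_contra! h
      exact (hR x y hx hy h.1 h.2).not_ge hxy

theorem nonintCount_le_card (z : V → ℝ) : nonintCount z ≤ Fintype.card V := Finset.card_le_univ _

theorem norm_le_of_floorVec_le {z : V → ℝ} (hz : ∀ v, 0 ≤ z v) {R : ℕ} (h : ∀ v, floorVec z v ≤ R) :
    ‖z‖ ≤ R + 1 := by
  rw [pi_norm_le_iff_of_nonneg (by positivity)]
  intro v
  rw [Real.norm_of_nonneg (hz v)]
  have h1 := (Nat.lt_floor_add_one (z v)).le
  have h2 : (⌊z v⌋₊ : ℝ) ≤ R := by exact_mod_cast h v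
  linarith

open Filter Topology in
theorem exists_isCoarseExpanding_joinComplex {SH : Finset H} {SG : Finset G} {SQ : Finset Q}
    (hSH : Subgroup.closure (SH : Set H) = ⊤) (hSG : Subgroup.closure (SG : Set G) = ⊤)
    (hSQ : Subgroup.closure (SQ : Set Q) = ⊤) (hH : WeaklyConvex SH) (X : GroupExtension H G Q)
    (s : X.Section) (hs : IsLipschitz SQ SG s) {K : AbstractSimplicialComplex V}
    {L : AbstractSimplicialComplex W} {f : (V → ℕ) → H} (hf : IsLatticeExpanding SH K f)
    {g : (W → ℕ) → Q} (hg : IsLatticeExpanding SQ L g) :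
    ∃ F, IsCoarseExpanding SG (joinComplex K L) F := by
  obtain ⟨Ψ, hΨ⟩ := exists_isFibrewisePath hSH hSG hSQ hH X s hs
  obtain ⟨Lι, hLι⟩ := isLipschitz_monoidHom hSH hSG X.inl
  obtain ⟨Lπ, hLπ⟩ := isLipschitz_monoidHom hSG hSQ X.rightHom
  obtain ⟨Cf, hCf⟩ := hf.lipschitz
  obtain ⟨Cg, hCg⟩ := hg.lipschitz
  -- With the kernel factor on the left, steps in the `W`-coordinates are bounded by left
  -- invariance; steps in the `V`-coordinates are conjugated by `s (g _)`, and bounded only while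
  -- the `W`-coordinates are.
  set F₀ : (V ⊕ W → ℕ) → G := fun x =>
    X.inl (f fun v => x (Sum.inl v)) * s (g fun w => x (Sum.inr w)) with hF₀
  have hπ : ∀ x, X.rightHom (F₀ x) = g fun w => x (Sum.inr w) := fun x => by simp [hF₀]
  set F := interpolate Ψ F₀ (Fintype.card (V ⊕ W)) with hF
  have hπF : ∀ z, X.rightHom (F z) = g fun w => floorVec z (Sum.inr w) := fun z =>
    (proj_interpolate hΨ _ z).trans (hπ _)
  choose B hB using exists_bound_of_forall_le fun n : W → ℕ => wordDist SG 1 (s (g n))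
  have hclose := exists_wordDist_interpolate_le (K := joinComplex K L) (f := F₀) hSG hΨ
    (W := fun R => {x | ∀ w, x (Sum.inr w) ≤ R})
    (fun R x hx y hyx _ w => (hyx _).trans (Nat.succ_le_succ (hx w)))
    (fun R => ⟨B R + Lι * Cf + B (R + 1), fun x hx y hxK hyK hxy hyx =>
      (wordDist_mul_mul_le hSG _ _ _ _).trans (Nat.add_le_add (Nat.add_le_add (hB R _ hx)
        ((hLι _ _).trans (Nat.mul_le_mul_left Lι (hCf _ _ (natVec_comp_inl_mem_openCone hxK)
          (natVec_comp_inl_mem_openCone hyK) (fun v => hxy _) fun v => hyx _))))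
        (hB (R + 1) _ fun w => (hyx _).trans (Nat.succ_le_succ (hx w))))⟩)
    (Fintype.card (V ⊕ W))
  have hcone := fun (z : V ⊕ W → ℝ) (hz : z ∈ openCone (joinComplex K L)) =>
    natVec_floorVec_mem_openCone hz
  refine ⟨F, ?_, ?_, ?_⟩
  · intro A hA
    obtain ⟨R₁, hR₁⟩ := exists_forall_le_of_finite (hg.proper _ (hA.image X.rightHom))
    obtain ⟨C, hC⟩ := hclose R₁
    -- The projection has bounded the `W`-coordinates; so the kernel factor is within bounded
    -- distance of the finite set `A`.
    have hfin : {h : H | ∃ a ∈ A, wordDist SG a (X.inl h) ≤ C + B R₁}.Finite := by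
      refine ((hA.biUnion fun a _ => finite_wordDist_le hSG a (C + B R₁)).preimage
        X.inl_injective.injOn).subset ?_
      rintro h ⟨a, ha, hah⟩
      exact Set.mem_biUnion ha hah
    obtain ⟨R₂, hR₂⟩ := exists_forall_le_of_finite (hf.proper _ hfin)
    refine ⟨(max R₁ R₂ : ℕ) + 1, fun z hz hzA => norm_le_of_floorVec_le hz.1 ?_⟩
    have h1 := hR₁ _ ⟨natVec_comp_inr_mem_openCone (hcone z hz), F z, hzA, hπF z⟩
    have h2 := hR₂ _ ⟨natVec_comp_inl_mem_openCone (hcone z hz), F z, hzA, by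
      have h3 := hC z hz h1
      have h4 := hB R₁ _ h1
      have h5 := wordDist_mul_mul_le hSG (X.inl (f fun v => floorVec z (Sum.inl v)))
        (X.inl (f fun v => floorVec z (Sum.inl v))) (s (g fun w => floorVec z (Sum.inr w))) 1
      rw [wordDist_self, wordDist_self, mul_one] at h5
      have h6 := wordDist_triangle hSG (F z) (F₀ (floorVec z))
        (X.inl (f fun v => floorVec z (Sum.inl v)))
      rw [wordDist_comm] at h3
      exact h6.trans (Nat.add_le_add h3 (h5.trans (by omega)))⟩
    rintro (v | w)
    · exact (h2 v).trans (le_max_right _ _)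
    · exact (h1 w).trans (le_max_left _ _)
  · obtain ⟨M, hM⟩ := coarselyContinuous_interpolate (K := joinComplex K L) (f := F₀) hSG hΨ
      (D := Cg) (fun x y hx hy hxy hyx => by
        rw [hπ, hπ]
        exact hCg _ _ (natVec_comp_inr_mem_openCone hx) (natVec_comp_inr_mem_openCone hy)
          (fun _ => hxy _) fun _ => hyx _) (Fintype.card (V ⊕ W))
    refine ⟨M, fun z hz => ?_⟩
    rw [eventually_nhdsWithin_iff]
    filter_upwards [hM z hz (nonintCount_le_card z)] with z' h hz'
    exact h hz' (nonintCount_le_card z')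
  · intro σ hσ τ hτ hστ D
    -- If the images of `p` and `q` are close, divergence of `g` bounds the `W`-coordinates of one
    -- of them, and properness those of the other. There `F` is close to `F₀`, so the values of `f`
    -- are close, and divergence of `f` bounds the rest of `p` or of `q`.
    obtain ⟨R₁, hR₁⟩ := hg.exists_bound_or hσ.2.2 hτ.2.2 (Finset.disjoint_left.2 fun w h h' =>
      Finset.disjoint_left.1 hστ (Finset.mem_toRight.1 h) (Finset.mem_toRight.1 h')) (Lπ * D)
    obtain ⟨R₂, hR₂⟩ := hg.exists_bound_of_close hSQ R₁ (Lπ * D)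
    set R₃ := max R₁ R₂ with hR₃
    obtain ⟨C, hC⟩ := hclose R₃
    obtain ⟨D', hD'⟩ := exists_wordDist_le_of_finite_ker hSH hSG X.inl (finite_ker_inl X)
      (B R₃ + (C + D + C) + B R₃)
    obtain ⟨R₄, hR₄⟩ := hf.exists_bound_or hσ.2.1 hτ.2.1 (Finset.disjoint_left.2 fun w h h' =>
      Finset.disjoint_left.1 hστ (Finset.mem_toLeft.1 h) (Finset.mem_toLeft.1 h')) D'
    refine ⟨(max R₃ R₄ : ℕ) + 1, fun p hp q hq hpσ hqτ hpR hqR => ?_⟩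
    by_contra! hpq
    have hsupp := support_floorVec_subset hpσ
    have hsupp' := support_floorVec_subset hqτ
    have h1 : wordDist SQ (g fun w => floorVec p (Sum.inr w)) (g fun w => floorVec q (Sum.inr w)) ≤
        Lπ * D := by
      rw [← hπF, ← hπF]
      exact (hLπ _ _).trans (Nat.mul_le_mul_left Lπ hpq)
    have h2 : (∀ w, floorVec p (Sum.inr w) ≤ R₃) ∧ ∀ w, floorVec q (Sum.inr w) ≤ R₃ := by
      rcases hR₁ _ _ (fun w hw => Finset.mem_coe.2 (Finset.mem_toRight.2 (hsupp hw)))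
        (fun w hw => Finset.mem_coe.2 (Finset.mem_toRight.2 (hsupp' hw))) h1 with h | h
      · exact ⟨fun w => (h w).trans (le_max_left _ _), fun w => (hR₂ _ _ h
          (natVec_comp_inr_mem_openCone (hcone q hq)) h1 w).trans (le_max_right _ _)⟩
      · exact ⟨fun w => (hR₂ _ _ h (natVec_comp_inr_mem_openCone (hcone p hp))
          (wordDist_comm (S := SQ) _ _ ▸ h1) w).trans (le_max_right _ _),
          fun w => (h w).trans (le_max_left _ _)⟩
    have h3 : wordDist SH (f fun v => floorVec p (Sum.inl v)) (f fun v => floorVec q (Sum.inl v)) ≤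
        D' := by
      refine hD' _ _ ((wordDist_le_mul_mul hSG _ _ (s (g fun w => floorVec p (Sum.inr w)))
        (s (g fun w => floorVec q (Sum.inr w)))).trans
        (Nat.add_le_add (Nat.add_le_add (hB _ _ h2.1) ?_) (hB _ _ h2.2)))
      have h4 : wordDist SG (F₀ (floorVec p)) (F p) ≤ C := hC p hp h2.1
      have h5 : wordDist SG (F₀ (floorVec q)) (F q) ≤ C := hC q hq h2.2
      have h6 := wordDist_triangle hSG (F₀ (floorVec p)) (F p) (F₀ (floorVec q))
      have h7 := wordDist_triangle hSG (F p) (F q) (F₀ (floorVec q))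
      rw [wordDist_comm] at h5
      change wordDist SG (F₀ (floorVec p)) (F₀ (floorVec q)) ≤ _
      omega
    rcases hR₄ _ _ (fun w hw => Finset.mem_coe.2 (Finset.mem_toLeft.2 (hsupp hw)))
      (fun w hw => Finset.mem_coe.2 (Finset.mem_toLeft.2 (hsupp' hw))) h3 with h | h
    · refine hpR.not_ge (norm_le_of_floorVec_le hp.1 ?_)
      rintro (v | w)
      · exact (h v).trans (le_max_right _ _)
      · exact (h2.1 w).trans (le_max_left _ _)
    · refine hqR.not_ge (norm_le_of_floorVec_le hq.1 ?_)
      rintro (v | w)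
      · exact (h v).trans (le_max_right _ _)
      · exact (h2.2 w).trans (le_max_left _ _)

end Extension

/-! ### Coarse invariance of the obstructor dimension -/

section CoarseInvariance

variable {Γ Γ' : Type*} [Group Γ] [Group Γ'] {S : Finset Γ} {S' : Finset Γ'}

theorem HasExpandingObstructor.of_isCoarseEmbedding (hS : Subgroup.closure (S : Set Γ) = ⊤)
    {φ : Γ → Γ'} (hφ : IsCoarseEmbedding S S' φ) {m : ℕ} (h : HasExpandingObstructor S m) :
    HasExpandingObstructor S' m := by
  obtain ⟨V, ι, _, _, _, K, T, hK, hT, f, hf⟩ := h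
  refine ⟨V, ι, inferInstance, inferInstance, inferInstance, K, T, hK, hT, fun a => φ (f a),
    fun B hB => hf.proper _ (hφ.finite_preimage hS hB), ?_, ?_⟩
  · obtain ⟨L, hL⟩ := hφ.lipschitz
    obtain ⟨C, hC⟩ := hf.lipschitz
    exact ⟨L * C, fun a b hab => (hL _ _).trans (Nat.mul_le_mul_left L (hC a b hab))⟩
  · intro σ hσ τ hτ hστ D
    obtain ⟨D', hD'⟩ := hφ.expanding D
    obtain ⟨C₁, C₂, hC₁, hC₂, h⟩ := hf.diverge σ hσ τ hτ hστ D'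
    refine ⟨C₁, C₂, hC₁, hC₂, fun a ha b hb => ?_⟩
    by_contra! hab
    exact (h a ha b hb).not_ge (hD' _ _ hab)

theorem obdim_le_of_isCoarseEmbedding (hS : Subgroup.closure (S : Set Γ) = ⊤)
    (hS' : Subgroup.closure (S' : Set Γ') = ⊤) {φ : Γ → Γ'} (hφ : IsCoarseEmbedding S S' φ) {D : ℕ}
    (hD : ∀ y, ∃ x, wordDist S' y (φ x) ≤ D) : obdim S ≤ obdim S' := by
  by_cases h : Finite Γ
  · rw [obdim, if_pos h]
    exact zero_le
  · have h' : ¬ Finite Γ' := fun h' => h (Set.finite_univ_iff.1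
      (hφ.finite_preimage hS (Set.finite_univ (α := Γ'))))
    rw [obdim, obdim, if_neg h, if_neg h', isTwoEnded_iff_of_isCoarseEmbedding hS hS' hφ hD]
    split_ifs
    · exact le_rfl
    · exact biSup_mono fun m hm => hm.of_isCoarseEmbedding hS hφ

end CoarseInvariance

/-! ### Extensions with finite kernel or finite quotient -/

section Extension

variable {H : Type u} {G : Type w} {Q : Type v} [Group H] [Group G] [Group Q] {SH : Finset H}
  {SG : Finset G} {SQ : Finset Q}

/-- The section is a coarse equivalence: the projection is a Lipschitz left inverse, and `y` differs
from `s (π y)` by an element of the finite kernel. -/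
theorem obdim_le_of_finite_kernel [Finite H] (hSG : Subgroup.closure (SG : Set G) = ⊤)
    (hSQ : Subgroup.closure (SQ : Set Q) = ⊤) (X : GroupExtension H G Q) (s : X.Section)
    (hs : IsLipschitz SQ SG s) : obdim SQ ≤ obdim SG := by
  obtain ⟨D, hD⟩ := (Set.finite_range fun h => wordDist SG 1 (X.inl h)).bddAbove
  obtain ⟨L, hL⟩ := isLipschitz_monoidHom hSG hSQ X.rightHom
  refine obdim_le_of_isCoarseEmbedding (D := D) hSQ hSG (φ := s) ⟨hs, fun D => ⟨L * D, fun a b hab => ?_⟩⟩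
    fun y => ⟨X.rightHom y, ?_⟩
  · have h := (hL (s a) (s b)).trans (Nat.mul_le_mul_left L hab)
    rwa [s.rightHom_section, s.rightHom_section] at h
  · rw [wordDist_eq_one hSG, ← inl_invFun X (g := y⁻¹ * s (X.rightHom y)) (by simp)]
    exact hD ⟨_, rfl⟩

theorem obdim_le_of_finite_quotient [Finite Q] (hSH : Subgroup.closure (SH : Set H) = ⊤)
    (hSG : Subgroup.closure (SG : Set G) = ⊤) (X : GroupExtension H G Q) (s : X.Section) :
    obdim SH ≤ obdim SG := by
  obtain ⟨D, hD⟩ := (Set.finite_range fun q => wordDist SG 1 (s q)⁻¹).bddAbove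
  refine obdim_le_of_isCoarseEmbedding (D := D) hSH hSG (φ := X.inl) ⟨isLipschitz_monoidHom hSH hSG _,
    exists_wordDist_le_of_finite_ker hSH hSG X.inl (finite_ker_inl X)⟩
    fun y => ⟨Function.invFun X.inl (y * (s (X.rightHom y))⁻¹), ?_⟩
  rw [wordDist_eq_one hSG, inl_invFun X (by simp), inv_mul_cancel_left]
  exact hD ⟨_, rfl⟩

end Extension

/-! ### Lattice obstructors, with rays included -/

section Directions

variable {Γ : Type*} [Group Γ]

/-- There is a proper, Lipschitz, expanding map to `Γ` from the lattice points of the open cone of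
an `(N - 2)`-obstructor, or `N = 1` and there is such a map from a ray. -/
def HasLatticeObstructor (S : Finset Γ) (N : ℕ) : Prop :=
  (N = 1 ∧ ∃ f, IsLatticeExpanding S pointComplex f) ∨
  ∃ (m : ℕ) (V : Type) (_ : Fintype V) (_ : DecidableEq V) (K : AbstractSimplicialComplex V),
    N = m + 2 ∧ IsObstructor K m ∧ ∃ f, IsLatticeExpanding S K f

/-- A geodesic ray serves; divergence is vacuous, since a point has no two disjoint simplices. -/
theorem exists_isLatticeExpanding_pointComplex [Infinite Γ] {S : Finset Γ}
    (hS : Subgroup.closure (S : Set Γ) = ⊤) : ∃ f, IsLatticeExpanding S pointComplex f := by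
  obtain ⟨r, hr⟩ := exists_geodesic_line hS
  have hinj : Function.Injective fun x : Unit → ℕ => r (x ()) := by
    intro x y hxy
    have h := hr (x ()) (y ())
    rw [show r (x ()) = r (y ()) from hxy, wordDist_self] at h
    funext u
    change x () = y ()
    omega
  refine ⟨fun x => r (x ()), fun B hB => (hB.preimage hinj.injOn).subset fun x hx => hx.2,
    ⟨1, fun x y _ _ hxy hyx => ?_⟩, ?_⟩
  · rw [hr]
    have h1 : x () ≤ y () := hxy ()
    have h2 : y () ≤ x () + 1 := hyx ()
    omega
  · intro σ hσ τ hτ hστ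
    obtain ⟨⟨⟩, hs⟩ := (hσ : σ.Nonempty)
    obtain ⟨⟨⟩, ht⟩ := (hτ : τ.Nonempty)
    exact absurd ht (Finset.disjoint_left.1 hστ hs)

theorem HasExpandingObstructor.hasLatticeObstructor {S : Finset Γ}
    (hS : Subgroup.closure (S : Set Γ) = ⊤) {m : ℕ} (h : HasExpandingObstructor S m) :
    HasLatticeObstructor S (m + 2) := by
  obtain ⟨V, ι, _, _, _, K, T, hK, hT, f, hf⟩ := h
  obtain ⟨F, hF⟩ := hf.exists_isCoarseExpanding hT
  exact .inr ⟨m, V, inferInstance, inferInstance, K, rfl, hK, hF.exists_isLatticeExpanding hS⟩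

theorem obdim_le_iSup [Infinite Γ] {S : Finset Γ} (hS : Subgroup.closure (S : Set Γ) = ⊤) :
    obdim S ≤ ⨆ N : {N // HasLatticeObstructor S N}, ((N : ℕ) : ℕ∞) := by
  rw [obdim, if_neg (not_finite_iff_infinite.2 inferInstance)]
  split_ifs
  · exact le_iSup (fun N : {N // HasLatticeObstructor S N} => ((N : ℕ) : ℕ∞))
      ⟨1, .inl ⟨rfl, exists_isLatticeExpanding_pointComplex hS⟩⟩
  · exact iSup₂_le fun m hm => le_iSup (fun N : {N // HasLatticeObstructor S N} => ((N : ℕ) : ℕ∞))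
      ⟨m + 2, hm.hasLatticeObstructor hS⟩

end Directions

/-! ### Three diverging rays -/

section ThreeRays

variable {Γ : Type*} [Group Γ]

theorem eq_zero_of_mem_openCone_threePoints {x : Fin 3 → ℕ} (hx : natVec x ∈ openCone threePoints)
    {i j : Fin 3} (hi : x i ≠ 0) (hj : j ≠ i) : x j = 0 := by
  rcases hx.2 with h | ⟨σ, hσ, h⟩
  · exact Nat.cast_eq_zero.1 (congrFun h j)
  · obtain ⟨k, rfl⟩ := Finset.card_eq_one.1 (hσ : σ.card = 1)
    rw [support_natVec] at h
    have h1 : i ∈ Function.support x := hi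
    rw [h, Finset.mem_coe, Finset.mem_singleton] at h1
    by_contra h0
    have h2 : j ∈ Function.support x := h0
    rw [h, Finset.mem_coe, Finset.mem_singleton, ← h1] at h2
    exact hj h2

/-- Three diverging rays form a proper, Lipschitz, expanding map from the cone over three points. -/
theorem exists_isLatticeExpanding_threePoints {S : Finset Γ} {a : Fin 3 → ℕ → Γ}
    (hinj : ∀ i, Function.Injective (a i)) {C : ℕ}
    (hC : ∀ i n, wordDist S (a i n) (a i (n + 1)) ≤ C)
    (hdiv : ∀ i j, i < j → ∀ D, ∃ R, ∀ m n, R < m → R < n → D < wordDist S (a i m) (a j n)) :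
    ∃ f, IsLatticeExpanding S threePoints f := by
  classical
  set f : (Fin 3 → ℕ) → Γ := fun x =>
    if h : ∃ i, x i ≠ 0 then a h.choose (x h.choose) else a 0 0 with hf
  have hf0 : f 0 = a 0 0 := dif_neg (by simp)
  have hfi : ∀ x i, x i ≠ 0 → (∀ j, j ≠ i → x j = 0) → f x = a i (x i) := by
    intro x i hi hx
    have h : ∃ i, x i ≠ 0 := ⟨i, hi⟩
    have h1 : h.choose = i := by
      by_contra h1
      exact h.choose_spec (hx _ h1)
    rw [hf]
    simp only [dif_pos h, h1]
  refine ⟨f, ?_, ?_, ?_⟩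
  · intro B hB
    choose R hR using fun i => ((hB.preimage (hinj i).injOn)).bddAbove
    refine (finite_setOf_forall_le (Finset.univ.sup R)).subset ?_
    rintro x ⟨hx, hxB⟩ i
    by_cases hi : x i = 0
    · omega
    · rw [hfi x i hi fun j hj => eq_zero_of_mem_openCone_threePoints hx hi hj] at hxB
      exact (hR i hxB).trans (Finset.le_sup (Finset.mem_univ i))
  · refine ⟨C + Finset.univ.sup fun i => wordDist S (a 0 0) (a i 1), fun x y hx hy hxy hyx => ?_⟩
    by_cases h : ∃ i, y i ≠ 0
    · obtain ⟨i, hi⟩ := h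
      have hyj : ∀ j, j ≠ i → y j = 0 := fun j hj => eq_zero_of_mem_openCone_threePoints hy hi hj
      have hxj : ∀ j, j ≠ i → x j = 0 := fun j hj => Nat.le_zero.1 (hyj j hj ▸ hxy j)
      have h1 : x i ≤ y i := hxy i
      have h2 : y i ≤ x i + 1 := hyx i
      rw [hfi y i hi hyj]
      by_cases hxi : x i = 0
      · have hx0 : x = 0 := by
          funext j
          by_cases hj : j = i
          · rw [hj]; exact hxi
          · exact hxj j hj
        rw [hx0, hf0, show y i = 1 by omega]
        exact le_add_left (Finset.le_sup (f := fun i => wordDist S (a 0 0) (a i 1)) (Finset.mem_univ i))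
      · rw [hfi x i hxi hxj]
        rcases h1.eq_or_lt with h3 | h3
        · rw [h3, wordDist_self]
          exact Nat.zero_le _
        · rw [show y i = x i + 1 by omega]
          exact le_add_right (hC i (x i))
    · push Not at h
      have hy0 : y = 0 := funext h
      have hx0 : x = 0 := funext fun j => Nat.le_zero.1 (h j ▸ hxy j)
      rw [hx0, hy0, wordDist_self]
      exact Nat.zero_le _
  · have key : ∀ i j, i ≠ j → ∀ D, ∃ R, ∀ m n, R < m → R < n →
        D < wordDist S (a i m) (a j n) := by
      intro i j hij D
      rcases hij.lt_or_gt with h | h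
      · exact hdiv i j h D
      · obtain ⟨R, hR⟩ := hdiv j i h D
        exact ⟨R, fun m n hm hn => wordDist_comm (S := S) _ _ ▸ hR n m hn hm⟩
    intro σ hσ τ hτ hστ D
    obtain ⟨i, rfl⟩ := Finset.card_eq_one.1 (hσ : σ.card = 1)
    obtain ⟨j, rfl⟩ := Finset.card_eq_one.1 (hτ : τ.card = 1)
    obtain ⟨R, hR⟩ := key i j (Finset.disjoint_singleton.1 hστ) D
    have hray : ∀ (i : Fin 3) (x : Fin 3 → ℕ), Function.support x ⊆ ({i} : Finset (Fin 3)) →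
        (∃ v, R < x v) → R < x i ∧ f x = a i (x i) := by
      rintro i x hx ⟨v, hv⟩
      have hxj : ∀ j, j ≠ i → x j = 0 := by
        intro j hj
        by_contra h
        exact hj (Finset.mem_singleton.1 (Finset.mem_coe.1 (hx h)))
      have hvi : v = i := by
        by_contra h
        have := hxj v h
        omega
      rw [hvi] at hv
      exact ⟨hv, hfi x i (by omega) hxj⟩
    refine ⟨R, fun x y hx hy hxR hyR => ?_⟩
    obtain ⟨h1, h2⟩ := hray i x hx hxR
    obtain ⟨h3, h4⟩ := hray j y hy hyR
    rw [h2, h4]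
    exact hR _ _ h1 h3

end ThreeRays

/-! ### Extensions of infinite groups and the main inequality -/

section ExtensionOfInfinite

variable {H : Type u} {G : Type w} {Q : Type v} [Group H] [Group G] [Group Q] {SH : Finset H}
  {SG : Finset G} {SQ : Finset Q}

/-- Two rays in a line in the kernel and one ray in the quotient. -/
theorem hasExpandingObstructor_zero_of_groupExtension [Infinite H] [Infinite Q]
    (hSH : Subgroup.closure (SH : Set H) = ⊤) (hSG : Subgroup.closure (SG : Set G) = ⊤)
    (hSQ : Subgroup.closure (SQ : Set Q) = ⊤) (X : GroupExtension H G Q) (s : X.Section)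
    (hs : IsLipschitz SQ SG s) : HasExpandingObstructor SG 0 := by
  obtain ⟨r, hr⟩ := exists_geodesic_line hSH
  obtain ⟨q, hq⟩ := exists_geodesic_line hSQ
  obtain ⟨L, hL⟩ := hs
  obtain ⟨Lι, hLι⟩ := isLipschitz_monoidHom hSH hSG X.inl
  obtain ⟨Lπ, hLπ⟩ := isLipschitz_monoidHom hSG hSQ X.rightHom
  have hr' : Function.Injective fun i : ℤ => X.inl (r i) := by
    intro i j hij
    have h := hr i j
    rw [X.inl_injective hij, wordDist_self] at h
    omega
  have hq' : Function.Injective fun i : ℤ => s (q i) := by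
    intro i j hij
    have h := hq i j
    have h2 := congrArg X.rightHom hij
    simp only [s.rightHom_section] at h2
    rw [h2, wordDist_self] at h
    omega
  -- The lifted ray leaves every bounded neighbourhood of the kernel, because its projection is a
  -- geodesic ray in `Q`.
  have hsep : ∀ D, ∃ R, ∀ (h : H) (n : ℕ), R < n → D < wordDist SG (X.inl h) (s (q n)) := by
    intro D
    refine ⟨wordDist SQ (q 0) 1 + Lπ * D, fun h n hn => ?_⟩
    by_contra! hD
    have h1 := (hLπ (X.inl h) (s (q n))).trans (Nat.mul_le_mul_left Lπ hD)
    rw [X.rightHom_inl, s.rightHom_section] at h1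
    have h2 := wordDist_triangle hSQ (q 0) 1 (q n)
    rw [hq] at h2
    omega
  suffices h : ∃ f, IsLatticeExpanding SG threePoints f by
    obtain ⟨f, hf⟩ := h
    exact hf.hasExpandingObstructor isObstructor_threePoints
  refine exists_isLatticeExpanding_threePoints (a := ![fun n => X.inl (r n),
    fun n => X.inl (r (-n)), fun n => s (q n)]) (C := Lι + L) ?_ ?_ ?_
  · rw [Fin.forall_fin_succ, Fin.forall_fin_two]
    exact ⟨fun m n h => by simpa using hr' h, fun m n h => by simpa using hr' h,
      fun m n h => by simpa using hq' h⟩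
  · rw [Fin.forall_fin_succ, Fin.forall_fin_two]
    refine ⟨fun n => (hLι _ _).trans ?_, fun n => (hLι _ _).trans ?_, fun n => (hL _ _).trans ?_⟩
    · rw [hr, show ((n : ℤ) - (n + 1 : ℕ)).natAbs = 1 by omega]
      omega
    · rw [hr, show (-(n : ℤ) - -(n + 1 : ℕ)).natAbs = 1 by omega]
      omega
    · rw [hq, show ((n : ℤ) - (n + 1 : ℕ)).natAbs = 1 by omega]
      omega
  · have hlt : ∀ i j : Fin 3, i < j → i = 0 ∧ j = 1 ∨ i = 0 ∧ j = 2 ∨ i = 1 ∧ j = 2 := by decide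
    intro i j hij D
    rcases hlt i j hij with ⟨rfl, rfl⟩ | ⟨rfl, rfl⟩ | ⟨rfl, rfl⟩
    · obtain ⟨D', hD'⟩ := exists_wordDist_le_of_finite_ker hSH hSG X.inl (finite_ker_inl X) D
      refine ⟨D', fun m n hm hn => ?_⟩
      by_contra! h
      have h1 := hD' (r m) (r (-n)) h
      rw [hr] at h1
      omega
    · obtain ⟨R, hR⟩ := hsep D
      exact ⟨R, fun m n _ hn => hR _ n hn⟩
    · obtain ⟨R, hR⟩ := hsep D
      exact ⟨R, fun m n _ hn => hR _ n hn⟩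

theorem hasExpandingObstructor_of_joinComplex (hSH : Subgroup.closure (SH : Set H) = ⊤)
    (hSG : Subgroup.closure (SG : Set G) = ⊤) (hSQ : Subgroup.closure (SQ : Set Q) = ⊤)
    (hH : WeaklyConvex SH) (X : GroupExtension H G Q) (s : X.Section) (hs : IsLipschitz SQ SG s)
    {V W : Type} [Fintype V] [Fintype W] [DecidableEq V] [DecidableEq W]
    {K : AbstractSimplicialComplex V} {L : AbstractSimplicialComplex W} {f : (V → ℕ) → H}
    (hf : IsLatticeExpanding SH K f) {g : (W → ℕ) → Q} (hg : IsLatticeExpanding SQ L g) {m : ℕ}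
    (hKL : IsObstructor (joinComplex K L) m) : HasExpandingObstructor SG m := by
  obtain ⟨F, hF⟩ := exists_isCoarseExpanding_joinComplex hSH hSG hSQ hH X s hs hf hg
  obtain ⟨f, hf⟩ := hF.exists_isLatticeExpanding hSG
  exact hf.hasExpandingObstructor hKL

/-- A ray counts as a cone over a point, so joins cover all cases but two rays, whose join is an
edge and carries no obstructor; there three rays in `G` are used. -/
theorem HasLatticeObstructor.exists_hasExpandingObstructor [Infinite H] [Infinite Q]
    (hSH : Subgroup.closure (SH : Set H) = ⊤)
    (hSG : Subgroup.closure (SG : Set G) = ⊤) (hSQ : Subgroup.closure (SQ : Set Q) = ⊤)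
    (hH : WeaklyConvex SH) (X : GroupExtension H G Q) (s : X.Section) (hs : IsLipschitz SQ SG s)
    {N N' : ℕ} (hN : HasLatticeObstructor SH N) (hN' : HasLatticeObstructor SQ N') :
    ∃ m, N + N' = m + 2 ∧ HasExpandingObstructor SG m := by
  rcases hN with ⟨rfl, f, hf⟩ | ⟨m, V, _, _, K, rfl, hK, f, hf⟩
  · rcases hN' with ⟨rfl, g, hg⟩ | ⟨n, W, _, _, L, rfl, hL, g, hg⟩
    · exact ⟨0, rfl, hasExpandingObstructor_zero_of_groupExtension hSH hSG hSQ X s hs⟩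
    · exact ⟨n + 1, by ring, hasExpandingObstructor_of_joinComplex hSH hSG hSQ hH X s hs hf hg
        hL.cone⟩
  · rcases hN' with ⟨rfl, g, hg⟩ | ⟨n, W, _, _, L, rfl, hL, g, hg⟩
    · exact ⟨m + 1, by ring, hasExpandingObstructor_of_joinComplex hSH hSG hSQ hH X s hs hf hg
        hK.join_point⟩
    · exact ⟨m + n + 2, by ring, hasExpandingObstructor_of_joinComplex hSH hSG hSQ hH X s hs hf hg
        (hK.join hL)⟩

theorem obdim_add_obdim_le (hSH : Subgroup.closure (SH : Set H) = ⊤)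
    (hSG : Subgroup.closure (SG : Set G) = ⊤) (hSQ : Subgroup.closure (SQ : Set Q) = ⊤)
    (hH : WeaklyConvex SH) (X : GroupExtension H G Q) (s : X.Section) (hs : IsLipschitz SQ SG s) :
    obdim SH + obdim SQ ≤ obdim SG := by
  rcases finite_or_infinite H with hfH | hfH
  · rw [obdim, if_pos hfH, zero_add]
    exact obdim_le_of_finite_kernel hSG hSQ X s hs
  rcases finite_or_infinite Q with hfQ | hfQ
  · rw [obdim.eq_1 SQ, if_pos hfQ, add_zero]
    exact obdim_le_of_finite_quotient hSH hSG X s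
  have hfG : Infinite G := Infinite.of_injective X.inl X.inl_injective
  refine (add_le_add (obdim_le_iSup hSH) (obdim_le_iSup hSQ)).trans ?_
  have : Nonempty {N // HasLatticeObstructor SH N} :=
    ⟨⟨1, .inl ⟨rfl, exists_isLatticeExpanding_pointComplex hSH⟩⟩⟩
  have : Nonempty {N // HasLatticeObstructor SQ N} :=
    ⟨⟨1, .inl ⟨rfl, exists_isLatticeExpanding_pointComplex hSQ⟩⟩⟩
  refine ENat.iSup_add_iSup_le fun N N' => ?_
  obtain ⟨m, hm, h⟩ := N.2.exists_hasExpandingObstructor hSH hSG hSQ hH X s hs N'.2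
  rw [obdim, if_neg (not_finite_iff_infinite.2 hfG),
    if_neg (not_isTwoEnded_of_groupExtension hSH hSG X), ← Nat.cast_add, hm]
  exact le_iSup₂ (f := fun (m : ℕ) (_ : HasExpandingObstructor SG m) => ((m + 2 : ℕ) : ℕ∞)) m h

theorem fg_semidirectProduct (hSH : Subgroup.closure (SH : Set H) = ⊤)
    (hSQ : Subgroup.closure (SQ : Set Q) = ⊤) (θ : Q →* MulAut H) : Group.FG (H ⋊[θ] Q) := by
  classical
  rw [Group.fg_iff]
  refine ⟨SemidirectProduct.inl '' (SH : Set H) ∪ SemidirectProduct.inr '' (SQ : Set Q), ?_,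
    (SH.finite_toSet.image _).union (SQ.finite_toSet.image _)⟩
  rw [Subgroup.closure_union, ← MonoidHom.map_closure, ← MonoidHom.map_closure, hSH, hSQ,
    ← MonoidHom.range_eq_map, ← MonoidHom.range_eq_map, eq_top_iff]
  intro x _
  rw [← SemidirectProduct.inl_left_mul_inr_right x]
  exact Subgroup.mul_mem_sup ⟨_, rfl⟩ ⟨_, rfl⟩

end ExtensionOfInfinite

end ObstructorDim

theorem mainTheorem4 {H : Type u} {Q : Type v} [Group H] [Group Q]
    (SH : Finset H) (SQ : Finset Q)
    (hSH : Subgroup.closure (SH : Set H) = ⊤) (hSQ : Subgroup.closure (SQ : Set Q) = ⊤)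
    (hH : ObstructorDim.WeaklyConvex SH) :
    (∀ {G : Type w} [Group G] (SG : Finset G), Subgroup.closure (SG : Set G) = ⊤ →
      ∀ (X : GroupExtension H G Q) (s : X.Section), ObstructorDim.IsLipschitz SQ SG s →
        ObstructorDim.obdim SH + ObstructorDim.obdim SQ ≤ ObstructorDim.obdim SG) ∧
    (∀ θ : Q →* MulAut H,
      Group.FG (H ⋊[θ] Q) ∧
      ∀ SG : Finset (H ⋊[θ] Q), Subgroup.closure (SG : Set (H ⋊[θ] Q)) = ⊤ →
        ObstructorDim.obdim SH + ObstructorDim.obdim SQ ≤ ObstructorDim.obdim SG) := by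
  refine ⟨fun SG hSG X s hs => ObstructorDim.obdim_add_obdim_le hSH hSG hSQ hH X s hs,
    fun θ => ⟨ObstructorDim.fg_semidirectProduct hSH hSQ θ, fun SG hSG => ?_⟩⟩
  -- The splitting is a homomorphism between finitely generated groups, hence a Lipschitz section.
  exact ObstructorDim.obdim_add_obdim_le hSH hSG hSQ hH (SemidirectProduct.toGroupExtension θ)
    (SemidirectProduct.inr_splitting θ).toSection
    (ObstructorDim.isLipschitz_monoidHom hSQ hSG SemidirectProduct.inr)
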